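/- **Setting.** Let $k\ge 0$ be an integer. A polytope of $\mathbb R^d$ is a connected set that is the interior of a finite union of simplices; polytopes are assumed simply connected with connected Lipschitz boundary. Let $T\subset\mathbb R^3$ be a polyhedron, with planar polygonal faces $F\in\mathcal F_T$, edges $E\in\mathcal E_T$ and vertices $V\in\mathcal V_T$: $\partial T$ is the union of the closed faces, $\partial F$ is the union of the closed edges $E\in\mathcal E_F$ that lie on it, every edge lies on the boundary of some face, and the open faces, open edges and vertices are pairwise disjoint (coplanar faces and collinear edges are allowed). Set $\partial^2T=\bigcup_{E\in\mathcal E_T}\overline E$. Each face has a unit normal $n_F$, and $\omega_{TF}=1$ if $n_F$ points out of $T$, $-1$ otherwise. Each edge has a unit tangent $t_E$, and $\omega_{FE}=1$ if $t_E$ is opposite to the counter-clockwise (with respect to $n_F$) orientation of $\partial F$, $-1$ otherwise; $n_{FE}$ is the unit vector such that $(t_E,n_{FE},n_F)$ is right-handed. $\overline x_T$ is the centroid of $T$. **Polynomials.** For $X$ an edge, a face or $T$, $P^\ell(X)$ is the space of polynomials of total degree $\le \ell$ on $X$ ($P^{-1}(X)=\{0\}$) and $\pi^\ell_X$ is the $L^2(X)$-orthogonal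 projector on it. Write $\operatorname{grad}_F,\operatorname{div}_F$ for the tangential operators and $\operatorname{\mathbf{rot}}_F r=\rho_{-\pi/2}\operatorname{grad}_F r$ ($\rho_{-\pi/2}$ is the rotation by $-\pi/2$ in the oriented plane of $F$). Set $\mathcal R^\ell(F)=\operatorname{\mathbf{rot}}_FP^{\ell+1}(F)$, $\mathcal R^\ell(T)=\operatorname{curl}P^{\ell+1}(T)^3$, $\mathcal G^\ell(T)=\operatorname{grad}P^{\ell+1}(T)$, and let $\perp$ denote $L^2$-orthogonal complements in $P^\ell(F)^2$, resp. $P^\ell(T)^3$. $\pi_{\mathcal R,X}^\ell,\pi_{\mathcal R,X}^{\perp,\ell},\pi_{\mathcal G,T}^\ell,\pi_{\mathcal G,T}^{\perp,\ell}$ are the $L^2$-orthogonal projectors on these spaces. $P_c^{\ell}(\partial^2T)$ and $P_c^\ell(\partial F)$ are the continuous functions on $\partial^2T$, resp. $\partial F$, that are polynomials of degree $\le\ell$ on each edge. Trimmed finite element spaces: $$NE_k(T)=P^k(T)^3+(x-\overline x_T)\times P^k(T)^3,\qquad RT_k(T)=P^k(T)^3+(x-\overline x_T)P^k(T).$$ **Discrete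 spaces.** $$X_{\rm grad}=P^{k-1}(T)\times\prod_FP^{k-1}(F)\times P_c^{k+1}(\partial^2T),$$ $$X_{\rm curl}=\big(\mathcal R^{k-1}(T)\oplus\mathcal R^k(T)^\perp\big)\times\prod_F\big(\mathcal R^{k-1}(F)\oplus\mathcal R^k(F)^\perp\big)\times\prod_{E}P^k(E),$$ $$X_{\rm div}=\big(\mathcal G^{k-1}(T)\oplus\mathcal G^k(T)^\perp\big)\times\prod_FP^k(F).$$ On a face, $X_{{\rm grad},F}=P^{k-1}(F)\times P_c^{k+1}(\partial F)$ and $X_{{\rm rot},F}=(\mathcal R^{k-1}(F)\oplus\mathcal R^k(F)^\perp)\times\prod_{E\in\mathcal E_F}P^k(E)$; $\underline q_F$ and $\underline v_F$ denote the restrictions to $F$ of elements of $X_{\rm grad}$ and $X_{\rm curl}$. **Interpolators** on continuous functions and fields on $\overline T$. $I_{\rm grad}q=(q_T,(q_F)_F,q_{\partial^2T})$ with $q_T=\pi_T^{k-1}q$, $q_F=\pi_F^{k-1}q_{|F}$, $\pi_E^{k-1}(q_{\partial^2T})_{|E}=\pi_E^{k-1}q_{|E}$ for all $E$, and $q_{\partial^2T}(x_V)=q(x_V)$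 for all $V$ ($I_{{\rm grad},F}$ on $F$ is analogous). With $v_{t,F}=n_F\times(v_{|F}\times n_F)$, $$I_{\rm curl}v=\big(\pi_{\mathcal R,T}^{k-1}v+\pi_{\mathcal R,T}^{\perp,k}v,\ (\pi_{\mathcal R,F}^{k-1}v_{t,F}+\pi_{\mathcal R,F}^{\perp,k}v_{t,F})_F,\ (\pi_E^k(v\cdot t_E))_E\big),$$ $$I_{\rm div}v=\big(\pi_{\mathcal G,T}^{k-1}v+\pi_{\mathcal G,T}^{\perp,k}v,\ (\pi_F^k(v\cdot n_F))_F\big).$$ **Operators on a face** $F$. For $\underline q_F=(q_F,q_{\partial F})\in X_{{\rm grad},F}$, $\mathsf G_F\underline q_F\in P^k(F)^2$ satisfies $$\int_F\mathsf G_F\underline q_F\cdot w=-\int_Fq_F\operatorname{div}_Fw+\sum_{E\in\mathcal E_F}\omega_{FE}\int_Eq_{\partial F}(w\cdot n_{FE})\quad\forall w\in P^k(F)^2.$$ For $\underline v_F=(v_{\mathcal R,F}+v^\perp_{\mathcal R,F},v_{\partial F})\in X_{{\rm rot},F}$, $C_F\underline v_F\in P^k(F)$ and $\gamma_{t,F}\underline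 v_F\in P^k(F)^2$ satisfy $$\int_FC_F\underline v_F\,r=\int_Fv_{\mathcal R,F}\cdot\operatorname{\mathbf{rot}}_Fr-\sum_{E\in\mathcal E_F}\omega_{FE}\int_Ev_{\partial F}r\quad\forall r\in P^k(F),$$ $$\int_F\gamma_{t,F}\underline v_F\cdot\operatorname{\mathbf{rot}}_Fr=\int_FC_F\underline v_F\,r+\sum_{E\in\mathcal E_F}\omega_{FE}\int_Ev_{\partial F}r\quad\forall r\in P^{k+1}(F)\text{ with }\int_Fr=0,$$ $$\int_F\gamma_{t,F}\underline v_F\cdot w=\int_Fv^\perp_{\mathcal R,F}\cdot w\quad\forall w\in\mathcal R^k(F)^\perp.$$ Scalar traces $\gamma_F:X_{{\rm grad},F}\to P^{k+1}(F)$, $F\in\mathcal F_T$, are given; they may be any maps with $\gamma_F(I_{{\rm grad},F}q)=q$ for all $q\in P^{k+1}(F)$ and $\pi_F^{k-1}(\gamma_F\underline q_F)=q_F$ for all $\underline q_F\in X_{{\rm grad},F}$. **Operators on** $T$. $\mathsf G_T\underline q_T\in P^k(T)^3$, $\mathsf C_T\underline v_T\in P^k(T)^3$ and $D_T\underline v_T\in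 P^k(T)$ satisfy $$\int_T\mathsf G_T\underline q_T\cdot v=-\int_Tq_T\operatorname{div}v+\sum_F\omega_{TF}\int_F\gamma_F\underline q_F\,(v\cdot n_F)\quad\forall v\in P^k(T)^3,$$ $$\int_T\mathsf C_T\underline v_T\cdot w=\int_Tv_T\cdot\operatorname{curl}w+\sum_F\omega_{TF}\int_F\gamma_{t,F}\underline v_F\cdot(w\times n_F)\quad\forall w\in P^k(T)^3,$$ $$\int_TD_T\underline v_T\,q=-\int_Tv_T\cdot\operatorname{grad}q+\sum_F\omega_{TF}\int_Fv_F\,q\quad\forall q\in P^k(T)$$ (with $\underline q_T\in X_{\rm grad}$, $\underline v_T\in X_{\rm curl}$, $\underline v_T\in X_{\rm div}$ respectively, $v_T$ being the component of $\underline v_T$ in $T$ and $v_F$ its component on $F$). With $(\cdot)'$ the derivative along $t_E$, $$G_T\underline q_T=\big(\pi_{\mathcal R,T}^{k-1}\mathsf G_T\underline q_T+\pi_{\mathcal R,T}^{\perp,k}\mathsf G_T\underline q_T,\ (\pi_{\mathcal R,F}^{k-1}\mathsf G_F\underline q_F+\pi_{\mathcal R,F}^{\perp,k}\mathsf G_F\underline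 q_F)_F,\ ((q_{\partial^2T})_{|E}')_E\big)\in X_{\rm curl},$$ $$C_T\underline v_T=\big(\pi_{\mathcal G,T}^{k-1}\mathsf C_T\underline v_T+\pi_{\mathcal G,T}^{\perp,k}\mathsf C_T\underline v_T,\ (C_F\underline v_F)_F\big)\in X_{\rm div}.$$ **Theorem (Commutative diagrams).** The operators $\operatorname{grad}:P^{k+1}(T)\to NE_k(T)$, $\operatorname{curl}:NE_k(T)\to RT_k(T)$ and $\operatorname{div}:RT_k(T)\to P^k(T)$ are well defined, and $$G_T(I_{\rm grad}q)=I_{\rm curl}(\operatorname{grad}q)\quad\forall q\in P^{k+1}(T),$$ $$C_T(I_{\rm curl}v)=I_{\rm div}(\operatorname{curl}v)\quad\forall v\in NE_k(T),$$ $$D_T(I_{\rm div}v)=\operatorname{div}v\quad\forall v\in RT_k(T).$$ -/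

import Mathlib

open scoped Matrix Topology

noncomputable section

namespace DDR

/-! ### Polynomial spaces and vector operators -/

/-- `ℙ_n^ℓ`: `n`-variate real polynomials of total degree at most `ℓ`; it is `{0}` for `ℓ = -1`. -/
def Poly (n : ℕ) (ℓ : ℤ) : Submodule ℝ (MvPolynomial (Fin n) ℝ) :=
  MvPolynomial.restrictSupport ℝ {m | ((m.degree : ℕ) : ℤ) ≤ ℓ}

/-- Vector-valued polynomials: all `n` components in `ℙ_n^ℓ`. -/
def VPoly (n : ℕ) (ℓ : ℤ) : Submodule ℝ (Fin n → MvPolynomial (Fin n) ℝ) :=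
  Submodule.pi Set.univ fun _ => Poly n ℓ

/-- `P^ℓ(E)` for an edge `E`: univariate polynomials of degree at most `ℓ` in the arc length
along the edge; it is `{0}` for `ℓ = -1`. -/
def PolyE (ℓ : ℤ) : Submodule ℝ (Polynomial ℝ) := Polynomial.degreeLT ℝ (ℓ + 1).toNat

/-- The function defined by a polynomial. -/
def fn {n : ℕ} (q : MvPolynomial (Fin n) ℝ) : (Fin n → ℝ) → ℝ := fun x => MvPolynomial.eval x q

/-- The vector field defined by a vector-valued polynomial. -/
def vfn {n m : ℕ} (v : Fin m → MvPolynomial (Fin n) ℝ) : (Fin n → ℝ) → (Fin m → ℝ) :=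
  fun x i => MvPolynomial.eval x (v i)

/-- The partial derivative as a linear map. -/
def pd {n : ℕ} (i : Fin n) : MvPolynomial (Fin n) ℝ →ₗ[ℝ] MvPolynomial (Fin n) ℝ :=
  (MvPolynomial.pderiv i).toLinearMap

/-- Gradient (in dimension 2: tangential gradient in the coordinates of the face). -/
def grad {n : ℕ} : MvPolynomial (Fin n) ℝ →ₗ[ℝ] (Fin n → MvPolynomial (Fin n) ℝ) :=
  LinearMap.pi pd

/-- Divergence (in dimension 2: tangential divergence in the coordinates of the face). -/
def div {n : ℕ} : (Fin n → MvPolynomial (Fin n) ℝ) →ₗ[ℝ] MvPolynomial (Fin n) ℝ :=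
  ∑ i, pd i ∘ₗ LinearMap.proj i

/-- Three-dimensional curl. -/
def curl : (Fin 3 → MvPolynomial (Fin 3) ℝ) →ₗ[ℝ] (Fin 3 → MvPolynomial (Fin 3) ℝ) :=
  LinearMap.pi ![pd 1 ∘ₗ LinearMap.proj 2 - pd 2 ∘ₗ LinearMap.proj 1,
    pd 2 ∘ₗ LinearMap.proj 0 - pd 0 ∘ₗ LinearMap.proj 2,
    pd 0 ∘ₗ LinearMap.proj 1 - pd 1 ∘ₗ LinearMap.proj 0]

/-- Two-dimensional vector curl: the gradient rotated by `-π/2`, `(a, b) ↦ (b, -a)`. -/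
def vrot : MvPolynomial (Fin 2) ℝ →ₗ[ℝ] (Fin 2 → MvPolynomial (Fin 2) ℝ) :=
  LinearMap.pi ![pd 1, -pd 0]

/-- `G^ℓ = grad P^{ℓ+1}` on a polyhedron. -/
def Goly3 (ℓ : ℤ) : Submodule ℝ (Fin 3 → MvPolynomial (Fin 3) ℝ) := (Poly 3 (ℓ + 1)).map grad

/-- `R^ℓ = curl (P^{ℓ+1})³` on a polyhedron. -/
def Roly3 (ℓ : ℤ) : Submodule ℝ (Fin 3 → MvPolynomial (Fin 3) ℝ) := (VPoly 3 (ℓ + 1)).map curl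

/-- `R^ℓ = vrot P^{ℓ+1}` on a polygon. -/
def Roly2 (ℓ : ℤ) : Submodule ℝ (Fin 2 → MvPolynomial (Fin 2) ℝ) := (Poly 2 (ℓ + 1)).map vrot

/-! ### Polytopes -/

/-- Lipschitz boundary: near each boundary point, and up to a choice of the vertical unit
direction `ν`, the set is the strict epigraph of a Lipschitz function of the component
orthogonal to `ν`. -/
def HasLipschitzBoundary {n : ℕ} (S : Set (Fin n → ℝ)) : Prop :=
  ∀ x ∈ frontier S, ∃ ν : Fin n → ℝ, ν ⬝ᵥ ν = 1 ∧
    ∃ (K : NNReal) (h : (Fin n → ℝ) → ℝ), LipschitzWith K h ∧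
      ∃ U ∈ 𝓝 x, ∀ y ∈ U, y ∈ S ↔ h (y - (ν ⬝ᵥ y) • ν) < ν ⬝ᵥ y

/-- A polytope of `ℝⁿ`: a connected set that is the interior of a finite union of simplices, that
is simply connected and has a connected, Lipschitz boundary. -/
structure Polytope (n : ℕ) where
  carrier : Set (Fin n → ℝ)
  connected : IsConnected carrier
  simplices : ∃ S : Set (Affine.Simplex ℝ (Fin n → ℝ) n), S.Finite ∧
    carrier = interior (⋃ s ∈ S, convexHull ℝ (Set.range s.points))
  simplyConnected : SimplyConnectedSpace carrier
  connected_frontier : IsConnected (frontier carrier)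
  lipschitz : HasLipschitzBoundary carrier

namespace Polytope

variable {n : ℕ} (X : Polytope n)

theorem integrableOn_eval (p : MvPolynomial (Fin n) ℝ) :
    MeasureTheory.IntegrableOn (fun x => MvPolynomial.eval x p) X.carrier := by
  obtain ⟨S, hS, h⟩ := X.simplices
  have hK : IsCompact (⋃ s ∈ S, convexHull ℝ (Set.range s.points)) :=
    hS.isCompact_biUnion fun s _ => (Set.finite_range _).isCompact_convexHull ℝ
  refine (ContinuousOn.integrableOn_compact hK
    (MvPolynomial.continuous_eval p).continuousOn).mono_set ?_
  rw [h]
  exact interior_subset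

/-- The `L²`-product of two vector-valued polynomials. -/
def ip {m : ℕ} (u w : Fin m → MvPolynomial (Fin n) ℝ) : ℝ :=
  ∫ x in X.carrier, MvPolynomial.eval x (u ⬝ᵥ w)

/-- The `L²(X)`-orthogonal complement of `V` in the vector-valued polynomials of degree at
most `ℓ`. -/
def perp (V : Submodule ℝ (Fin n → MvPolynomial (Fin n) ℝ)) (ℓ : ℤ) :
    Submodule ℝ (Fin n → MvPolynomial (Fin n) ℝ) where
  carrier := {w | w ∈ VPoly n ℓ ∧ ∀ u ∈ V, X.ip w u = 0}
  zero_mem' := ⟨zero_mem _, fun u _ => by simp [ip]⟩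
  add_mem' := by
    rintro a b ⟨ha, ha'⟩ ⟨hb, hb'⟩
    refine ⟨add_mem ha hb, fun u hu => ?_⟩
    have h1 := ha' u hu
    have h2 := hb' u hu
    simp only [ip] at h1 h2 ⊢
    simp only [add_dotProduct, map_add]
    rw [MeasureTheory.integral_add (X.integrableOn_eval _) (X.integrableOn_eval _), h1, h2,
      add_zero]
  smul_mem' := by
    rintro c a ⟨ha, ha'⟩
    refine ⟨Submodule.smul_mem _ c ha, fun u hu => ?_⟩
    have h1 := ha' u hu
    simp only [ip] at h1 ⊢
    simp only [smul_dotProduct, MvPolynomial.smul_eval]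
    rw [MeasureTheory.integral_const_mul, h1, mul_zero]

/- Projections and reconstructions below are selected by the relations that characterise them
uniquely; `Classical.epsilon` picks the element that satisfies these relations. -/

/-- The `L²`-orthogonal projection of a scalar function on `P^ℓ(X)`: the polynomial `p` of that
space with `∫_X (p - q) r = 0` for all `r` in the space. -/
def proj (ℓ : ℤ) (q : (Fin n → ℝ) → ℝ) : Poly n ℓ :=
  Classical.epsilon fun p : Poly n ℓ => ∀ r : Poly n ℓ,
    ∫ x in X.carrier, (fn p.1 x - q x) * fn r.1 x = 0

/-- The `L²`-orthogonal projection of a vector field on a space `W` of vector-valued polynomials. -/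
def vproj (W : Submodule ℝ (Fin n → MvPolynomial (Fin n) ℝ)) (v : (Fin n → ℝ) → (Fin n → ℝ)) : W :=
  Classical.epsilon fun p : W => ∀ r : W,
    ∫ x in X.carrier, (vfn p.1 x - v x) ⬝ᵥ vfn r.1 x = 0

end Polytope

/-! ### Edges and faces in `ℝ³` -/

/-- An edge, given by its two vertices, in the order that fixes its orientation. -/
structure Edge where
  x1 : Fin 3 → ℝ
  x2 : Fin 3 → ℝ
  ne : x1 ≠ x2

namespace Edge

variable (e : Edge)

/-- The Euclidean length `|E|`. -/
def length : ℝ := Real.sqrt ((e.x2 - e.x1) ⬝ᵥ (e.x2 - e.x1))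

/-- The unit tangent vector, with `|E| t_E = x2 - x1`. -/
def t : Fin 3 → ℝ := (e.length)⁻¹ • (e.x2 - e.x1)

/-- Arc length parametrisation of the edge, for `s` between `0` and `|E|`. -/
def pt (s : ℝ) : Fin 3 → ℝ := e.x1 + s • e.t

/-- The edge, as a relatively open segment. -/
def op : Set (Fin 3 → ℝ) := openSegment ℝ e.x1 e.x2

/-- The closure of the edge. -/
def cl : Set (Fin 3 → ℝ) := segment ℝ e.x1 e.x2

/-- The `L²`-orthogonal projection on `P^ℓ(E)` of a function of the arc length. -/
def proj (ℓ : ℤ) (q : ℝ → ℝ) : PolyE ℓ :=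
  Classical.epsilon fun p : PolyE ℓ => ∀ r : PolyE ℓ,
    ∫ s in (0 : ℝ)..e.length, (p.1.eval s - q s) * r.1.eval s = 0

end Edge

/-- A planar polygonal face: a polygon of `ℝ²` immersed in `ℝ³` by the isometry
`y ↦ o + y₁ τ₁ + y₂ τ₂`. The oriented orthonormal frame `(τ₁, τ₂)` prescribes the unit normal
`τ₁ × τ₂`. Functions on the face and tangential fields are written in the coordinates of the
frame, so that surface integrals and tangential operators are the planar ones. -/
structure Face where
  o : Fin 3 → ℝ
  τ1 : Fin 3 → ℝ
  τ2 : Fin 3 → ℝ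
  unit1 : τ1 ⬝ᵥ τ1 = 1
  unit2 : τ2 ⬝ᵥ τ2 = 1
  orth : τ1 ⬝ᵥ τ2 = 0
  poly : Polytope 2

namespace Face

variable (f : Face)

/-- The unit normal `n_F`. -/
def n : Fin 3 → ℝ := f.τ1 ⨯₃ f.τ2

/-- The immersion of the plane. -/
def emb (y : Fin 2 → ℝ) : Fin 3 → ℝ := f.o + y 0 • f.τ1 + y 1 • f.τ2

/-- The coordinates in the frame of (the projection on the plane of) a point. -/
def coord (x : Fin 3 → ℝ) : Fin 2 → ℝ := ![f.τ1 ⬝ᵥ (x - f.o), f.τ2 ⬝ᵥ (x - f.o)]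

/-- The coordinates in the frame of the tangential part `n_F × (u × n_F)` of a vector `u`. -/
def tang (u : Fin 3 → ℝ) : Fin 2 → ℝ := ![f.τ1 ⬝ᵥ u, f.τ2 ⬝ᵥ u]

/-- The face as a subset of `ℝ³` (relatively open in its plane). -/
def set : Set (Fin 3 → ℝ) := f.emb '' f.poly.carrier

/-- The boundary `∂F` of the face in its plane. -/
def bdry : Set (Fin 3 → ℝ) := f.emb '' frontier f.poly.carrier

/-- The unit vector `n_{FE}` such that `(t_E, n_{FE}, n_F)` is right-handed. -/
def nE (e : Edge) : Fin 3 → ℝ := f.n ⨯₃ e.t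

end Face

/-- The direction `ν` points out of `S` along `A`. -/
def PointsOut (S A : Set (Fin 3 → ℝ)) (ν : Fin 3 → ℝ) : Prop :=
  ∀ x ∈ A, ∀ᶠ t : ℝ in 𝓝[>] 0, x + t • ν ∉ S

/-! ### Polyhedra -/

open scoped Classical in
/-- A polyhedron `T` with its faces and edges. The boundary of `T` is the union of the closed
faces, the boundary of each face is the union of the closed edges that lie on it, and the (open)
faces, the (open) edges and the vertices are pairwise disjoint. Coplanar faces and collinear
edges are allowed. -/
structure Polyhedron extends Polytope 3 where
  /-- number of faces -/
  nF : ℕ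
  /-- number of edges -/
  nE : ℕ
  face : Fin nF → Face
  edge : Fin nE → Edge
  frontier_eq : frontier carrier = ⋃ f, closure (face f).set
  face_bdry : ∀ f, (face f).bdry = ⋃ e ∈ {e | (edge e).cl ⊆ (face f).bdry}, (edge e).cl
  edge_on_face : ∀ e, ∃ f, (edge e).cl ⊆ (face f).bdry
  face_disjoint : ∀ f f', f ≠ f' → Disjoint (face f).set (face f').set
  face_edge_disjoint : ∀ f e, Disjoint (face f).set (edge e).cl
  edge_disjoint : ∀ e e', e ≠ e' → Disjoint (edge e).op (edge e').cl

namespace Polyhedron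

variable (T : Polyhedron) (k : ℕ)

open scoped Classical in
/-- `ℰ_F`: the edges that lie on the boundary of the face. -/
def edgesOf (f : Fin T.nF) : Finset (Fin T.nE) := {e | (T.edge e).cl ⊆ (T.face f).bdry}

open scoped Classical in
/-- `ω_{TF}`: `1` if `n_F` points out of `T`, `-1` otherwise. -/
def ωF (f : Fin T.nF) : ℝ :=
  if PointsOut T.carrier (T.face f).set (T.face f).n then 1 else -1

open scoped Classical in
/-- `ω_{FE}`: `1` if `t_E` is opposite to the counter-clockwise orientation of `∂F` with respect
to `n_F`, `-1` otherwise. The counter-clockwise orientation has `F` on its left, and `n_{FE}`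
points to the left of `t_E`; so the orientations are opposite when `n_{FE}` points out of `F`. -/
def ωE (f : Fin T.nF) (e : Fin T.nE) : ℝ :=
  if PointsOut (T.face f).set (T.edge e).op ((T.face f).nE (T.edge e)) then 1 else -1

/-- The union of the closures of a set of edges: `∂²T` for all the edges of `T`, `∂F` for the
edges of `F`. -/
def skel (S : Finset (Fin T.nE)) : Set (Fin 3 → ℝ) := ⋃ e ∈ S, (T.edge e).cl

/-- `P_c^ℓ(∂²T)` (`S` the set of all edges) and `P_c^ℓ(∂F)` (`S` the set of edges of `F`):
the families of polynomials on the edges that are the restrictions of a continuous function on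
the union of the closed edges. -/
def Pc (S : Finset (Fin T.nE)) (ℓ : ℤ) : Type :=
  {q : S → PolyE ℓ // ∃ g : (Fin 3 → ℝ) → ℝ, ContinuousOn g (T.skel S) ∧
    ∀ e : S, ∀ s ∈ Set.Icc 0 (T.edge e).length, g ((T.edge e).pt s) = (q e).1.eval s}

instance (S : Finset (Fin T.nE)) (ℓ : ℤ) : Nonempty (T.Pc S ℓ) :=
  ⟨⟨fun _ => 0, fun _ => 0, continuousOn_const, fun _ _ _ => by simp⟩⟩

variable {T} in
/-- Restriction to fewer edges. -/
def Pc.restrict {S S' : Finset (Fin T.nE)} {ℓ : ℤ} (h : S' ⊆ S) (q : T.Pc S ℓ) : T.Pc S' ℓ :=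
  ⟨fun e => q.1 ⟨e.1, h e.2⟩, by
    obtain ⟨g, hg, hq⟩ := q.2
    exact ⟨g, hg.mono (Set.biUnion_subset_biUnion_left h), fun e s hs => hq ⟨e.1, h e.2⟩ s hs⟩⟩

/-- The interpolate of a continuous function in `P_c^{k+1}` of a set of edges: the element with
the same projections of degree `k - 1` on the edges and the same values at the vertices. -/
def interpPc (S : Finset (Fin T.nE)) (q : (Fin 3 → ℝ) → ℝ) : T.Pc S (k + 1) :=
  Classical.epsilon fun p : T.Pc S (k + 1) => ∀ e : S,
    (T.edge e).proj (k - 1) (fun s => (p.1 e).1.eval s)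
        = (T.edge e).proj (k - 1) (fun s => q ((T.edge e).pt s)) ∧
      (p.1 e).1.eval 0 = q (T.edge e).x1 ∧ (p.1 e).1.eval (T.edge e).length = q (T.edge e).x2

/-! ### Discrete spaces and operators on a face

In all spaces, an element of a direct sum `R^{k-1} ⊕ (R^k)^⊥` (or `G^{k-1} ⊕ (G^k)^⊥`) is given
by its two components. -/

/-- The discrete `H¹(F)` space `P^{k-1}(F) × P_c^{k+1}(∂F)`. -/
@[ext]
structure XGradF (f : Fin T.nF) where
  q : Poly 2 (k - 1)
  bd : T.Pc (T.edgesOf f) (k + 1)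

/-- The discrete `H(rot;F)` space `(R^{k-1}(F) ⊕ R^k(F)^⊥) × P^k(ℰ_F)`. -/
@[ext]
structure XRotF (f : Fin T.nF) where
  vR : Roly2 (k - 1)
  vRp : (T.face f).poly.perp (Roly2 k) k
  bd : T.edgesOf f → PolyE k

/-- The interpolator on the discrete `H¹(F)` space, for functions continuous on the closure
of `F`. -/
def IgradF (f : Fin T.nF) (q : (Fin 2 → ℝ) → ℝ) : T.XGradF k f where
  q := (T.face f).poly.proj (k - 1) q
  bd := T.interpPc k (T.edgesOf f) fun x => q ((T.face f).coord x)

/-- A scalar trace reconstruction on the face `F`: it is consistent on the polynomials of degree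
at most `k + 1` and its projection of degree `k - 1` is the face unknown. -/
def IsScalarTrace (f : Fin T.nF) (γ : T.XGradF k f → Poly 2 (k + 1)) : Prop :=
  (∀ q : Poly 2 (k + 1), γ (T.IgradF k f (fn q.1)) = q) ∧
    ∀ u : T.XGradF k f, (T.face f).poly.proj (k - 1) (fn (γ u).1) = u.q

variable {k}

/-- The full gradient reconstruction on `F`. -/
def fullGF (f : Fin T.nF) (u : T.XGradF k f) : VPoly 2 k :=
  Classical.epsilon fun G : VPoly 2 k => ∀ w : VPoly 2 k,
    ∫ x in (T.face f).poly.carrier, vfn G.1 x ⬝ᵥ vfn w.1 x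
      = -(∫ x in (T.face f).poly.carrier, fn u.q.1 x * fn (div w.1) x)
        + ∑ e : T.edgesOf f, T.ωE f e * ∫ s in (0 : ℝ)..(T.edge e).length,
            (u.bd.1 e).1.eval s * (vfn w.1 ((T.face f).coord ((T.edge e).pt s)) ⬝ᵥ
              (T.face f).tang ((T.face f).nE (T.edge e)))

/-- The discrete curl on `F`. -/
def CF (f : Fin T.nF) (v : T.XRotF k f) : Poly 2 k :=
  Classical.epsilon fun C : Poly 2 k => ∀ r : Poly 2 k,
    ∫ x in (T.face f).poly.carrier, fn C.1 x * fn r.1 x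
      = (∫ x in (T.face f).poly.carrier, vfn v.vR.1 x ⬝ᵥ vfn (vrot r.1) x)
        - ∑ e : T.edgesOf f, T.ωE f e * ∫ s in (0 : ℝ)..(T.edge e).length,
            (v.bd e).1.eval s * fn r.1 ((T.face f).coord ((T.edge e).pt s))

/-- The tangential trace reconstruction (two-dimensional vector potential) on `F`. The test
functions `r` of the first relation have zero average on `F`. -/
def tangTrace (f : Fin T.nF) (v : T.XRotF k f) : VPoly 2 k :=
  Classical.epsilon fun γ : VPoly 2 k =>
    (∀ r : Poly 2 (k + 1), ∫ x in (T.face f).poly.carrier, fn r.1 x = 0 →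
      ∫ x in (T.face f).poly.carrier, vfn γ.1 x ⬝ᵥ vfn (vrot r.1) x
        = (∫ x in (T.face f).poly.carrier, fn (T.CF f v).1 x * fn r.1 x)
          + ∑ e : T.edgesOf f, T.ωE f e * ∫ s in (0 : ℝ)..(T.edge e).length,
              (v.bd e).1.eval s * fn r.1 ((T.face f).coord ((T.edge e).pt s))) ∧
    ∀ w : (T.face f).poly.perp (Roly2 k) k,
      ∫ x in (T.face f).poly.carrier, vfn γ.1 x ⬝ᵥ vfn w.1 x
        = ∫ x in (T.face f).poly.carrier, vfn v.vRp.1 x ⬝ᵥ vfn w.1 x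

/-! ### Discrete spaces and interpolators on the polyhedron -/

variable (k)

/-- The discrete `H¹(T)` space `P^{k-1}(T) × P^{k-1}(ℱ_T) × P_c^{k+1}(∂²T)`. -/
@[ext]
structure XGrad where
  q : Poly 3 (k - 1)
  face : Fin T.nF → Poly 2 (k - 1)
  bd : T.Pc Finset.univ (k + 1)

/-- The discrete `H(curl;T)` space
`(R^{k-1}(T) ⊕ R^k(T)^⊥) × ∏_F (R^{k-1}(F) ⊕ R^k(F)^⊥) × P^k(ℰ_T)`. -/
@[ext]
structure XCurl where
  vR : Roly3 (k - 1)
  vRp : T.toPolytope.perp (Roly3 k) k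
  faceR : Fin T.nF → Roly2 (k - 1)
  faceRp : ∀ f : Fin T.nF, (T.face f).poly.perp (Roly2 k) k
  bd : Fin T.nE → PolyE k

/-- The discrete `H(div;T)` space `(G^{k-1}(T) ⊕ G^k(T)^⊥) × P^k(ℱ_T)`. -/
@[ext]
structure XDiv where
  vG : Goly3 (k - 1)
  vGp : T.toPolytope.perp (Goly3 k) k
  face : Fin T.nF → Poly 2 k

/-- The interpolator on the discrete `H¹(T)` space, for functions continuous on the closure
of `T`. -/
def Igrad (q : (Fin 3 → ℝ) → ℝ) : T.XGrad k where
  q := T.proj (k - 1) q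
  face f := (T.face f).poly.proj (k - 1) fun y => q ((T.face f).emb y)
  bd := T.interpPc k Finset.univ q

/-- The interpolator on the discrete `H(curl;T)` space, for fields continuous on the closure
of `T`. -/
def Icurl (v : (Fin 3 → ℝ) → (Fin 3 → ℝ)) : T.XCurl k where
  vR := T.vproj (Roly3 (k - 1)) v
  vRp := T.vproj (T.perp (Roly3 k) k) v
  faceR f := (T.face f).poly.vproj (Roly2 (k - 1))
    fun y => (T.face f).tang (v ((T.face f).emb y))
  faceRp f := (T.face f).poly.vproj ((T.face f).poly.perp (Roly2 k) k)
    fun y => (T.face f).tang (v ((T.face f).emb y))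
  bd e := (T.edge e).proj k fun s => v ((T.edge e).pt s) ⬝ᵥ (T.edge e).t

/-- The interpolator on the discrete `H(div;T)` space, for fields continuous on the closure
of `T`. -/
def Idiv (v : (Fin 3 → ℝ) → (Fin 3 → ℝ)) : T.XDiv k where
  vG := T.vproj (Goly3 (k - 1)) v
  vGp := T.vproj (T.perp (Goly3 k) k) v
  face f := (T.face f).poly.proj k fun y => v ((T.face f).emb y) ⬝ᵥ (T.face f).n

variable {T k}

/-- The restriction of a discrete `H¹(T)` element to a face. -/
def XGrad.onFace (u : T.XGrad k) (f : Fin T.nF) : T.XGradF k f :=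
  ⟨u.face f, u.bd.restrict (Finset.subset_univ _)⟩

/-- The restriction of a discrete `H(curl;T)` element to a face. -/
def XCurl.onFace (v : T.XCurl k) (f : Fin T.nF) : T.XRotF k f :=
  ⟨v.faceR f, v.faceRp f, fun e => v.bd e⟩

/-! ### Discrete operators on the polyhedron -/

variable (T)

/-- The full gradient reconstruction on `T`, for a given family `γ` of scalar traces. -/
def fullGT (γ : ∀ f : Fin T.nF, T.XGradF k f → Poly 2 (k + 1)) (u : T.XGrad k) : VPoly 3 k :=
  Classical.epsilon fun G : VPoly 3 k => ∀ v : VPoly 3 k,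
    ∫ x in T.carrier, vfn G.1 x ⬝ᵥ vfn v.1 x
      = -(∫ x in T.carrier, fn u.q.1 x * fn (div v.1) x)
        + ∑ f, T.ωF f * ∫ y in (T.face f).poly.carrier,
            fn (γ f (u.onFace f)).1 y * (vfn v.1 ((T.face f).emb y) ⬝ᵥ (T.face f).n)

theorem derivative_mem {p : Polynomial ℝ} (hp : p ∈ PolyE (k + 1)) :
    Polynomial.derivative p ∈ PolyE k := by
  have e1 : ((k : ℤ) + 1 + 1).toNat = k + 2 := by omega
  have e2 : ((k : ℤ) + 1).toNat = k + 1 := by omega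
  simp only [PolyE, e1, e2, Polynomial.mem_degreeLT] at hp ⊢
  by_cases h0 : p = 0
  · subst h0
    simp
  · have h1 := Polynomial.degree_derivative_lt h0
    rw [Polynomial.degree_eq_natDegree h0] at h1 hp
    refine lt_of_lt_of_le h1 ?_
    have : p.natDegree < k + 2 := by exact_mod_cast hp
    exact_mod_cast Nat.lt_succ_iff.mp this

/-- The discrete gradient `G_T`. -/
def GT (γ : ∀ f : Fin T.nF, T.XGradF k f → Poly 2 (k + 1)) (u : T.XGrad k) : T.XCurl k where
  vR := T.vproj (Roly3 (k - 1)) (vfn (T.fullGT γ u).1)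
  vRp := T.vproj (T.perp (Roly3 k) k) (vfn (T.fullGT γ u).1)
  faceR f := (T.face f).poly.vproj (Roly2 (k - 1)) (vfn (T.fullGF f (u.onFace f)).1)
  faceRp f := (T.face f).poly.vproj ((T.face f).poly.perp (Roly2 k) k)
    (vfn (T.fullGF f (u.onFace f)).1)
  bd e := ⟨Polynomial.derivative (u.bd.1 ⟨e, Finset.mem_univ e⟩).1,
    derivative_mem (u.bd.1 ⟨e, Finset.mem_univ e⟩).2⟩

/-- The full curl reconstruction on `T`. -/
def fullCT (v : T.XCurl k) : VPoly 3 k :=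
  Classical.epsilon fun C : VPoly 3 k => ∀ w : VPoly 3 k,
    ∫ x in T.carrier, vfn C.1 x ⬝ᵥ vfn w.1 x
      = (∫ x in T.carrier, vfn (v.vR.1 + v.vRp.1) x ⬝ᵥ vfn (curl w.1) x)
        + ∑ f, T.ωF f * ∫ y in (T.face f).poly.carrier,
            vfn (T.tangTrace f (v.onFace f)).1 y ⬝ᵥ
              (T.face f).tang (vfn w.1 ((T.face f).emb y) ⨯₃ (T.face f).n)

/-- The discrete curl `C_T`. -/
def CT (v : T.XCurl k) : T.XDiv k where
  vG := T.vproj (Goly3 (k - 1)) (vfn (T.fullCT v).1)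
  vGp := T.vproj (T.perp (Goly3 k) k) (vfn (T.fullCT v).1)
  face f := T.CF f (v.onFace f)

/-- The discrete divergence `D_T`. -/
def DT (v : T.XDiv k) : Poly 3 k :=
  Classical.epsilon fun D : Poly 3 k => ∀ q : Poly 3 k,
    ∫ x in T.carrier, fn D.1 x * fn q.1 x
      = -(∫ x in T.carrier, vfn (v.vG.1 + v.vGp.1) x ⬝ᵥ vfn (grad q.1) x)
        + ∑ f, T.ωF f * ∫ y in (T.face f).poly.carrier,
            fn (v.face f).1 y * fn q.1 ((T.face f).emb y)

/-! ### Trimmed finite element spaces -/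

/-- The centroid of `T`. -/
def centroid : Fin 3 → ℝ := fun i => (MeasureTheory.volume.real T.carrier)⁻¹ * ∫ x in T.carrier, x i

/-- The vector-valued polynomial `x - x_T`, with `x_T` the centroid of `T`. -/
def position : Fin 3 → MvPolynomial (Fin 3) ℝ :=
  fun i => MvPolynomial.X i - MvPolynomial.C (T.centroid i)

variable (k)

/-- The Nédélec space `P^k(T)³ + (x - x_T) × P^k(T)³`. -/
def NE : Set (Fin 3 → MvPolynomial (Fin 3) ℝ) :=
  {v | ∃ w ∈ VPoly 3 k, ∃ z ∈ VPoly 3 k, v = w + T.position ⨯₃ z}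

/-- The Raviart–Thomas–Nédélec space `P^k(T)³ + (x - x_T) P^k(T)`. -/
def RT : Set (Fin 3 → MvPolynomial (Fin 3) ℝ) :=
  {v | ∃ w ∈ VPoly 3 k, ∃ p ∈ Poly 3 k, v = w + p • T.position}

end Polyhedron

end DDR

end

/-!
The two relations that carry everything are Gauss' theorem on the polyhedron `T` and on each of
its faces; once they are available, the three diagrams commute by integration by parts. The
interpolated components are `L²`-projections. In the relations that define the discrete operators
they are tested against elements of the spaces on which they project (and the component in an
orthogonal complement against elements orthogonal to it), so they can be replaced by the field
itself; the one exception is the tangential trace, discussed below. What is left on the right-hand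
side is, by Gauss' theorem, the `L²`-product of the test function with the exact gradient, curl or
divergence. As `L²`-products are definite on polynomials, the reconstruction is the exact one
(`fullGT_Igrad`, `fullGF_IgradF`, `fullCT_Icurl`, `DT_Idiv`) or its projection (`CF_Icurl`,
`tangTrace_Icurl`).

Three points are special. For the gradient, the interpolate of a polynomial of degree `k + 1` on
the edges is its restriction, since a polynomial of that degree on an edge is determined by its
values at the vertices and its projection of degree `k - 1` (`Edge.eq_of_proj_eq`). For the curl, the tangential
trace on a face is exact up to projection only because the tangential components on the edges of a
field in the Nédélec space have degree `k` (`trTang_mem_of_NE`), although the field itself has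
degree `k + 1`. And the curl of a field of the Nédélec space is itself of degree `k`, hence equal
to its reconstruction.

Gauss' theorem (`FlatBoundary.integral_div`) is proved for a bounded open set `S` of `ℝⁿ` whose
boundary consists of flat pieces, up to a set that is negligible seen from every direction. Given
a direction `ν`, almost every line parallel to `ν` crosses the boundary transversally, and at each
crossing `S` lies on exactly one side. So along the line, the indicator function of `S` and the
sum of the indicator functions of the shadows `A - (0, ∞) ν` of the pieces `A`, with the sign of
the crossing, jump together; both vanish far away, so they agree almost everywhere
(`FlatBoundary.ae_indicator_eq_sum_shadow`). The integral of `∂_ν g` over a shadow is an integral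
of `g` over the piece, by Fubini's theorem.

That a polyhedron and its faces are of this form is a matter of topology: near a point of an open
face the boundary is the plane of the face, since the other closed faces do not contain the point;
the Lipschitz condition then excludes that the polyhedron lies on both sides
(`HasLipschitzBoundary.one_side`), and as the face is connected, the side is the same along the
whole face and is the one recorded by `ω_{TF}` (`eventually_mem_iff_of_pointsOut`). The same
argument in the plane of a face gives the edges and `ω_{FE}`.
-/

namespace DDR

open MeasureTheory Filter Set

/-! ### The divergence theorem for domains with piecewise flat boundary -/

/-- A function on the line that is constant on a punctured neighbourhood of every point is, at each
point where it is locally constant, equal to its value near `+∞`. -/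
theorem eq_of_eventually_const_punctured {α : Type*} {φ : ℝ → α}
    (h : ∀ s, ∃ c, ∀ᶠ s' in 𝓝[≠] s, φ s' = c) {s : ℝ} (hs : ∀ᶠ s' in 𝓝 s, φ s' = φ s)
    {a : α} (ha : ∀ᶠ s' in atTop, φ s' = a) : φ s = a := by
  choose ψ hψ using h
  have huniq : ∀ x c, (∀ᶠ y in 𝓝 x, φ y = c) → ψ x = c := by
    intro x c hx
    obtain ⟨y, hy1, hy2⟩ := ((hψ x).and (hx.filter_mono nhdsWithin_le_nhds)).exists
    exact hy1.symm.trans hy2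
  have hloc : IsLocallyConstant ψ := by
    rw [IsLocallyConstant.iff_eventually_eq]
    intro x
    have h1 : ∀ᶠ y in 𝓝[≠] x, ψ y = ψ x := by
      filter_upwards [eventually_eventually_nhdsWithin.2 (hψ x), self_mem_nhdsWithin] with y hy hyx
      rw [isOpen_compl_singleton.nhdsWithin_eq hyx] at hy
      exact huniq y _ hy
    rw [eventually_nhdsWithin_iff] at h1
    filter_upwards [h1] with y hy
    by_cases hyx : y = x
    · rw [hyx]
    · exact hy hyx
  obtain ⟨M, hM⟩ := eventually_atTop.1 ha
  have h2 : ψ (M + 1) = a := huniq _ _ (by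
    filter_upwards [lt_mem_nhds (lt_add_one M)] with y hy using hM y hy.le)
  rw [← huniq s _ hs, ← h2]
  exact hloc.apply_eq_of_isPreconnected isPreconnected_univ (mem_univ _) (mem_univ _)

/-- A translate of a proper linear subspace is a null set. -/
theorem volume_setOf_sub_mem {n : ℕ} (W : Submodule ℝ (Fin n → ℝ)) (hW : W ≠ ⊤) (p : Fin n → ℝ) :
    volume {x : Fin n → ℝ | x - p ∈ W} = 0 := by
  have : {x : Fin n → ℝ | x - p ∈ W} = (fun x => x + -p) ⁻¹' (W : Set (Fin n → ℝ)) := by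
    ext x
    simp [sub_eq_add_neg]
  rw [this, measure_preimage_add_right]
  exact Measure.addHaar_submodule _ W hW

/-- An affine hyperplane is a null set. -/
theorem volume_hyperplane {n : ℕ} {m : Fin n → ℝ} (hm : m ≠ 0) (c : ℝ) :
    volume {x : Fin n → ℝ | m ⬝ᵥ x = c} = 0 := by
  rcases Set.eq_empty_or_nonempty {x : Fin n → ℝ | m ⬝ᵥ x = c} with h | ⟨p, hp⟩
  · simp [h]
  · refine measure_mono_null ?_ (volume_setOf_sub_mem (LinearMap.ker (dotProductBilin ℝ ℝ m)) ?_ p)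
    · intro x hx
      simp only [mem_ofPred_eq] at hx hp
      simp [dotProduct_sub, hx, hp]
    · intro h
      have : m ∈ LinearMap.ker (dotProductBilin ℝ ℝ m) := h ▸ Submodule.mem_top
      simp at this
      exact hm this

/-- A bounded open set `S` of `ℝⁿ` whose boundary consists of finitely many disjoint flat pieces
`Φ i '' P i`, up to a set `N` that is negligible seen from every direction. The piece `i` lies in a
hyperplane with normal `m i`, and near it `S` is the side of this hyperplane to which
`-(ω i) • m i` points. The map `Φ i` is a volume preserving parametrisation of the hyperplane, in
the sense that `(y, s) ↦ Φ i y - s • ν` scales volumes by `|m i ⬝ᵥ ν|`. -/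
structure FlatBoundary {n : ℕ} (E ι : Type*) [MeasureSpace E] [TopologicalSpace E]
    (S : Set (Fin n → ℝ)) where
  P : ι → Set E
  Φ : ι → E → Fin n → ℝ
  m : ι → Fin n → ℝ
  ω : ι → ℝ
  N : Set (Fin n → ℝ)
  isOpen : IsOpen S
  bounded : Bornology.IsBounded S
  normal_ne : ∀ i, m i ≠ 0
  meas : ∀ i, MeasurableSet (P i)
  subset_compact : ∀ i, ∃ K, IsCompact K ∧ P i ⊆ K
  cont : ∀ i, Continuous (Φ i)
  inj : ∀ i, Function.Injective (Φ i)
  flat : ∀ i, ∃ c, ∀ y, m i ⬝ᵥ Φ i y = c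
  sign : ∀ i, ω i = 1 ∨ ω i = -1
  side : ∀ i, ∀ y ∈ P i, ∀ᶠ z in 𝓝 (Φ i y), (z ∈ S ↔ ω i * (m i ⬝ᵥ (z - Φ i y)) < 0)
  disj : ∀ i j, i ≠ j → Disjoint (Φ i '' P i) (Φ j '' P j)
  subset_frontier : ∀ i, Φ i '' P i ⊆ frontier S
  frontier_subset : frontier S ⊆ (⋃ i, Φ i '' P i) ∪ N
  null : ∀ ν : Fin n → ℝ, volume {x | ∃ s : ℝ, x + s • ν ∈ N} = 0
  map : ∀ i (ν : Fin n → ℝ), m i ⬝ᵥ ν ≠ 0 →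
    Measure.map (fun p : E × ℝ => Φ i p.1 - p.2 • ν) (volume.prod volume)
      = ENNReal.ofReal |m i ⬝ᵥ ν|⁻¹ • volume

namespace FlatBoundary

variable {n : ℕ} {E ι : Type*} [MeasureSpace E] [TopologicalSpace E] {S : Set (Fin n → ℝ)}
  (B : FlatBoundary E ι S)

/-- The shadow `A_i - (0, ∞) ν` of the piece `A_i`. -/
def shadow (ν : Fin n → ℝ) (i : ι) : Set (Fin n → ℝ) :=
  {x | ∃ s : ℝ, 0 < s ∧ x + s • ν ∈ B.Φ i '' B.P i}

theorem crossing_unique {ν : Fin n → ℝ} {i : ι} (h : B.m i ⬝ᵥ ν ≠ 0) {x : Fin n → ℝ} {s s' : ℝ}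
    (hs : x + s • ν ∈ B.Φ i '' B.P i) (hs' : x + s' • ν ∈ B.Φ i '' B.P i) : s = s' := by
  obtain ⟨c, hc⟩ := B.flat i
  obtain ⟨y, -, hy⟩ := hs
  obtain ⟨y', -, hy'⟩ := hs'
  have h1 := hc y
  have h2 := hc y'
  rw [hy, dotProduct_add, dotProduct_smul, smul_eq_mul] at h1
  rw [hy', dotProduct_add, dotProduct_smul, smul_eq_mul] at h2
  exact mul_right_cancel₀ h (by linarith)

theorem mem_shadow_iff_of_crossing {ν : Fin n → ℝ} {i : ι} (h : B.m i ⬝ᵥ ν ≠ 0) {x : Fin n → ℝ}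
    {s₀ : ℝ} (hs : x + s₀ • ν ∈ B.Φ i '' B.P i) (s : ℝ) : x + s • ν ∈ B.shadow ν i ↔ s < s₀ := by
  have e : ∀ t : ℝ, x + s • ν + t • ν = x + (s + t) • ν := fun t => by rw [add_smul, add_assoc]
  simp only [shadow, mem_ofPred_eq, e]
  constructor
  · rintro ⟨t, ht, hx⟩
    rw [B.crossing_unique h hs hx]
    linarith
  · intro hlt
    exact ⟨s₀ - s, by linarith, by rwa [add_sub_cancel]⟩

theorem not_mem_shadow {ν : Fin n → ℝ} {i : ι} {x : Fin n → ℝ}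
    (h : ¬ ∃ s₀ : ℝ, x + s₀ • ν ∈ B.Φ i '' B.P i) (s : ℝ) : x + s • ν ∉ B.shadow ν i := by
  rintro ⟨t, -, ht⟩
  exact h ⟨s + t, by rwa [add_smul, ← add_assoc]⟩

theorem eventually_mem_shadow {ν : Fin n → ℝ} {i : ι} (h : B.m i ⬝ᵥ ν ≠ 0) {x : Fin n → ℝ}
    {s₀ : ℝ} (hs : x + s₀ • ν ∉ B.Φ i '' B.P i) :
    ∀ᶠ s in 𝓝 s₀, (x + s • ν ∈ B.shadow ν i ↔ x + s₀ • ν ∈ B.shadow ν i) := by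
  by_cases hex : ∃ s₁ : ℝ, x + s₁ • ν ∈ B.Φ i '' B.P i
  · obtain ⟨s₁, h₁⟩ := hex
    simp only [B.mem_shadow_iff_of_crossing h h₁]
    have hne : s₀ ≠ s₁ := by
      rintro rfl
      exact hs h₁
    rcases hne.lt_or_gt with hlt | hlt
    · filter_upwards [gt_mem_nhds hlt] with s h2
      simp [h2, hlt]
    · filter_upwards [lt_mem_nhds hlt] with s h2
      exact iff_of_false (not_lt.2 (le_of_lt h2)) hlt.not_gt
  · exact Eventually.of_forall fun s => by simp [B.not_mem_shadow hex]

open scoped Classical in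
/-- On a line in direction `ν` that meets the boundary of `S` only at points of pieces transversal
to `ν`, the indicator function of `S` is the signed sum of those of the shadows: the difference
does not jump at the crossings, and vanishes far away. -/
theorem indicator_eq_sum_shadow [Fintype ι] {ν : Fin n → ℝ} (hν : ν ≠ 0) {x : Fin n → ℝ}
    (hN : ∀ s : ℝ, x + s • ν ∉ B.N)
    (hpar : ∀ i, B.m i ⬝ᵥ ν = 0 → ∀ s : ℝ, x + s • ν ∉ B.Φ i '' B.P i)
    (hx : ∀ i, x ∉ B.Φ i '' B.P i) :
    (if x ∈ S then (1 : ℝ) else 0)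
      = ∑ i, B.ω i * Real.sign (B.m i ⬝ᵥ ν) * (if x ∈ B.shadow ν i then 1 else 0) := by
  set φ : ℝ → ℝ := fun s => (if x + s • ν ∈ S then (1 : ℝ) else 0)
    - ∑ i, B.ω i * Real.sign (B.m i ⬝ᵥ ν) * (if x + s • ν ∈ B.shadow ν i then 1 else 0) with hφ
  have hcont : Continuous fun s : ℝ => x + s • ν := by fun_prop
  have hterm : ∀ i (s₀ : ℝ), x + s₀ • ν ∉ B.Φ i '' B.P i → ∀ᶠ s in 𝓝 s₀,
      B.ω i * Real.sign (B.m i ⬝ᵥ ν) * (if x + s • ν ∈ B.shadow ν i then (1 : ℝ) else 0)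
        = B.ω i * Real.sign (B.m i ⬝ᵥ ν) * (if x + s₀ • ν ∈ B.shadow ν i then 1 else 0) := by
    intro i s₀ hs
    by_cases hi : B.m i ⬝ᵥ ν = 0
    · simp [hi]
    · filter_upwards [B.eventually_mem_shadow hi hs] with s h
      simp [h]
  have hreg : ∀ s₀ : ℝ, (∀ i, x + s₀ • ν ∉ B.Φ i '' B.P i) → ∀ᶠ s in 𝓝 s₀, φ s = φ s₀ := by
    intro s₀ h0
    have hfr : x + s₀ • ν ∉ frontier S := by
      intro hf
      rcases B.frontier_subset hf with h | h
      · obtain ⟨i, hi⟩ := mem_iUnion.1 h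
        exact h0 i hi
      · exact hN _ h
    have hS : ∀ᶠ s in 𝓝 s₀, (x + s • ν ∈ S ↔ x + s₀ • ν ∈ S) := by
      by_cases hin : x + s₀ • ν ∈ S
      · filter_upwards [hcont.continuousAt.eventually (B.isOpen.mem_nhds hin)] with s hs
        have hs' : x + s • ν ∈ S := hs
        simp [hs', hin]
      · have hcl : x + s₀ • ν ∈ (closure S)ᶜ := by
          intro hc
          exact hfr ⟨hc, fun h => hin (interior_subset h)⟩
        filter_upwards [hcont.continuousAt.eventually
          (isClosed_closure.isOpen_compl.mem_nhds hcl)] with s hs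
        have : x + s • ν ∉ S := fun h => hs (subset_closure h)
        simp [this, hin]
    filter_upwards [hS, eventually_all.2 fun i => hterm i s₀ (h0 i)] with s h1 h2
    simp only [hφ, h1, Finset.sum_congr rfl fun i _ => h2 i]
  have hpunct : ∀ s₀ : ℝ, ∃ c, ∀ᶠ s in 𝓝[≠] s₀, φ s = c := by
    intro s₀
    by_cases h0 : ∀ i, x + s₀ • ν ∉ B.Φ i '' B.P i
    · exact ⟨_, (hreg s₀ h0).filter_mono nhdsWithin_le_nhds⟩
    push Not at h0
    obtain ⟨i, hi⟩ := h0
    have hiν : B.m i ⬝ᵥ ν ≠ 0 := fun h => hpar i h s₀ hi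
    have hother : ∀ j, j ≠ i → x + s₀ • ν ∉ B.Φ j '' B.P j := fun j hj h =>
      (disjoint_left.1 (B.disj j i hj)) h hi
    have hrest : ∀ᶠ s in 𝓝 s₀, ∀ j ∈ Finset.univ.erase i,
        B.ω j * Real.sign (B.m j ⬝ᵥ ν) * (if x + s • ν ∈ B.shadow ν j then (1 : ℝ) else 0)
        = B.ω j * Real.sign (B.m j ⬝ᵥ ν) * (if x + s₀ • ν ∈ B.shadow ν j then 1 else 0) := by
      rw [Filter.eventually_all_finset]
      intro j hj
      exact hterm j s₀ (hother j (Finset.ne_of_mem_erase hj))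
    have hside : ∀ᶠ s in 𝓝 s₀,
        (x + s • ν ∈ S ↔ B.ω i * ((s - s₀) * (B.m i ⬝ᵥ ν)) < 0) := by
      obtain ⟨y, hy, hyx⟩ := hi
      have h1 := B.side i y hy
      rw [hyx] at h1
      filter_upwards [hcont.continuousAt.eventually h1] with s hs
      rw [hs, add_sub_add_left_eq_sub, ← sub_smul, dotProduct_smul, smul_eq_mul]
    -- the value of the `i`-th jump is taken up by the indicator function of `S`
    have hjump : ∀ᶠ s in 𝓝[≠] s₀, (if x + s • ν ∈ S then (1 : ℝ) else 0)
        - B.ω i * Real.sign (B.m i ⬝ᵥ ν) * (if x + s • ν ∈ B.shadow ν i then 1 else 0)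
        = if B.ω i * (B.m i ⬝ᵥ ν) < 0 then 1 else 0 := by
      filter_upwards [hside.filter_mono nhdsWithin_le_nhds, self_mem_nhdsWithin] with s h1 hne
      have hne' : s ≠ s₀ := hne
      simp only [h1, B.mem_shadow_iff_of_crossing hiν hi]
      rcases B.sign i with hω | hω <;> rcases hiν.lt_or_gt with hm | hm <;>
        rcases hne'.lt_or_gt with hs | hs <;>
        simp [hω, hm, Real.sign_of_neg, Real.sign_of_pos, hs, mul_neg_iff, mul_pos_iff,
          hm.not_gt, hs.not_gt]
    refine ⟨(if B.ω i * (B.m i ⬝ᵥ ν) < 0 then 1 else 0) - ∑ j ∈ Finset.univ.erase i,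
        B.ω j * Real.sign (B.m j ⬝ᵥ ν) * (if x + s₀ • ν ∈ B.shadow ν j then 1 else 0), ?_⟩
    filter_upwards [hjump, hrest.filter_mono nhdsWithin_le_nhds] with s h1 h2
    rw [← h1, ← Finset.sum_congr rfl h2]
    simp only [hφ]
    rw [← Finset.add_sum_erase _ _ (Finset.mem_univ i)]
    ring
  have hinf : ∀ᶠ s in atTop, φ s = 0 := by
    have hS : ∀ᶠ s : ℝ in atTop, x + s • ν ∉ S := by
      obtain ⟨R, hR⟩ := B.bounded.subset_closedBall 0
      filter_upwards [eventually_gt_atTop ((R + ‖x‖) / ‖ν‖), eventually_ge_atTop 0]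
        with s hs hs0 hmem
      have h1 := hR hmem
      rw [mem_closedBall_zero_iff] at h1
      rw [div_lt_iff₀ (norm_pos_iff.2 hν)] at hs
      have h2 : ‖s • ν‖ = s * ‖ν‖ := by rw [norm_smul, Real.norm_of_nonneg hs0]
      have h3 : ‖s • ν‖ ≤ ‖x + s • ν‖ + ‖x‖ := by
        have := norm_sub_le (x + s • ν) x
        rwa [add_sub_cancel_left] at this
      linarith
    have hQ : ∀ i, ∀ᶠ s : ℝ in atTop,
        B.ω i * Real.sign (B.m i ⬝ᵥ ν) * (if x + s • ν ∈ B.shadow ν i then (1 : ℝ) else 0) = 0 := by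
      intro i
      by_cases hi : B.m i ⬝ᵥ ν = 0
      · simp [hi]
      by_cases hex : ∃ s₁ : ℝ, x + s₁ • ν ∈ B.Φ i '' B.P i
      · obtain ⟨s₁, h₁⟩ := hex
        filter_upwards [eventually_ge_atTop s₁] with s hs
        simp [B.mem_shadow_iff_of_crossing hi h₁, not_lt.2 hs]
      · exact Eventually.of_forall fun s => by simp [B.not_mem_shadow hex]
    filter_upwards [hS, eventually_all.2 hQ] with s h1 h2
    simp only [hφ, h1, if_false, Finset.sum_congr rfl fun i _ => h2 i, Finset.sum_const_zero,
      sub_zero]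
  have hfin := eq_of_eventually_const_punctured hpunct
    (hreg 0 (fun i => by simpa using hx i)) hinf
  simp only [hφ, zero_smul, add_zero] at hfin
  linarith

theorem ae_indicator_eq_sum_shadow [Fintype ι] {ν : Fin n → ℝ} (hν : ν ≠ 0) (F : (Fin n → ℝ) → ℝ) :
    ∀ᵐ x, S.indicator F x
      = ∑ i, B.ω i * Real.sign (B.m i ⬝ᵥ ν) * (B.shadow ν i).indicator F x := by
  have h1 : ∀ᵐ x, ∀ s : ℝ, x + s • ν ∉ B.N := by
    rw [ae_iff]
    simpa using B.null ν
  have h2 : ∀ᵐ x, ∀ i, B.m i ⬝ᵥ ν = 0 → ∀ s : ℝ, x + s • ν ∉ B.Φ i '' B.P i := by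
    rw [ae_all_iff]
    intro i
    by_cases hi : B.m i ⬝ᵥ ν = 0
    · obtain ⟨c, hc⟩ := B.flat i
      filter_upwards [compl_mem_ae_iff.2 (volume_hyperplane (B.normal_ne i) c)] with x hx _ s hmem
      obtain ⟨y, -, hy⟩ := hmem
      apply hx
      have := hc y
      rw [hy, dotProduct_add, dotProduct_smul, hi, smul_zero, add_zero] at this
      exact this
    · simp [hi]
  have h3 : ∀ᵐ x, ∀ i, x ∉ B.Φ i '' B.P i := by
    rw [ae_all_iff]
    intro i
    obtain ⟨c, hc⟩ := B.flat i
    filter_upwards [compl_mem_ae_iff.2 (volume_hyperplane (B.normal_ne i) c)] with x hx hmem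
    obtain ⟨y, -, hy⟩ := hmem
    exact hx (hy ▸ hc y)
  filter_upwards [h1, h2, h3] with x k1 k2 k3
  have h := B.indicator_eq_sum_shadow hν k1 k2 k3
  classical
  have e : ∀ A : Set (Fin n → ℝ), A.indicator F x = (if x ∈ A then (1 : ℝ) else 0) * F x := by
    intro A
    by_cases hA : x ∈ A <;> simp [hA]
  rw [e S]
  simp only [e (B.shadow ν _)]
  convert congrArg (· * F x) h using 1
  · simp only [Finset.sum_mul, mul_assoc]

theorem shadow_eq_image (ν : Fin n → ℝ) (i : ι) :
    B.shadow ν i = (fun p : E × ℝ => B.Φ i p.1 - p.2 • ν) '' (B.P i ×ˢ Ioi 0) := by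
  ext x
  constructor
  · rintro ⟨s, hs, y, hy, hxy⟩
    exact ⟨(y, s), ⟨hy, hs⟩, by simp [hxy]⟩
  · rintro ⟨⟨y, s⟩, ⟨hy, hs⟩, rfl⟩
    exact ⟨s, hs, y, hy, by simp⟩

variable [BorelSpace E] [PolishSpace E]

theorem measurableEmbedding {ν : Fin n → ℝ} {i : ι} (h : B.m i ⬝ᵥ ν ≠ 0) :
    MeasurableEmbedding fun p : E × ℝ => B.Φ i p.1 - p.2 • ν := by
  refine Continuous.measurableEmbedding ?_ ?_
  · have := B.cont i
    fun_prop
  · rintro ⟨y, s⟩ ⟨y', s'⟩ hp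
    simp only at hp
    obtain ⟨c, hc⟩ := B.flat i
    have h1 := congrArg (B.m i ⬝ᵥ ·) hp
    simp only [dotProduct_sub, dotProduct_smul, hc, smul_eq_mul] at h1
    have hs : s = s' := mul_right_cancel₀ h (by linarith)
    subst hs
    rw [B.inj i (sub_left_injective hp)]

variable [SFinite (volume : Measure E)]

/-- The integral of a directional derivative over a shadow, by Fubini's theorem in the coordinates
given by the piece and the direction. -/
theorem integral_shadow {ν : Fin n → ℝ} {i : ι} (h : B.m i ⬝ᵥ ν ≠ 0) {g : (Fin n → ℝ) → ℝ}
    (hg : ContDiff ℝ 1 g) (hsupp : HasCompactSupport g) :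
    ∫ x in B.shadow ν i, fderiv ℝ g x ν = |B.m i ⬝ᵥ ν| * ∫ y in B.P i, g (B.Φ i y) := by
  have hν : ν ≠ 0 := by
    rintro rfl
    simp at h
  have hemb := B.measurableEmbedding h
  have hcont : Continuous fun x => fderiv ℝ g x ν :=
    (hg.continuous_fderiv one_ne_zero).clm_apply continuous_const
  have hint : Integrable fun x => fderiv ℝ g x ν :=
    hcont.integrable_of_hasCompactSupport (hsupp.fderiv_apply ℝ ν)
  have hpos : 0 < |B.m i ⬝ᵥ ν| := abs_pos.2 h
  have hline : ∀ y, ∫ s in Ioi (0 : ℝ), fderiv ℝ g (B.Φ i y - s • ν) ν = g (B.Φ i y) := by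
    intro y
    have hd : ContDiff ℝ 1 fun s : ℝ => g (B.Φ i y - s • ν) := by fun_prop
    have hs : HasCompactSupport fun s : ℝ => g (B.Φ i y - s • ν) := by
      obtain ⟨R, hR⟩ := hsupp.isBounded.subset_closedBall 0
      refine HasCompactSupport.intro (isCompact_closedBall 0 ((R + ‖B.Φ i y‖) / ‖ν‖)) fun s hs => ?_
      rw [mem_closedBall_zero_iff, not_le, div_lt_iff₀ (norm_pos_iff.2 hν), ← norm_smul] at hs
      by_contra hne
      have h1 := hR (subset_tsupport g hne)
      rw [mem_closedBall_zero_iff] at h1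
      have h2 := norm_sub_le (B.Φ i y) (B.Φ i y - s • ν)
      rw [sub_sub_cancel] at h2
      linarith
    have hderiv : ∀ s : ℝ, deriv (fun s : ℝ => g (B.Φ i y - s • ν)) s
        = -fderiv ℝ g (B.Φ i y - s • ν) ν := by
      intro s
      have h1 : HasDerivAt (fun s : ℝ => B.Φ i y - s • ν) (-ν) s := by
        have := ((hasDerivAt_id s).smul_const ν).const_sub (B.Φ i y)
        simpa using this
      have h2 :=
        ((hg.differentiable one_ne_zero) (B.Φ i y - s • ν)).hasFDerivAt.comp_hasDerivAt s h1
      rw [map_neg] at h2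
      exact h2.deriv
    have := hs.integral_Ioi_deriv_eq hd 0
    simp only [hderiv, integral_neg, zero_smul, sub_zero, neg_inj] at this
    exact this
  have hmap := B.map i ν h
  have hint' : Integrable (fun p : E × ℝ => fderiv ℝ g (B.Φ i p.1 - p.2 • ν) ν)
      (volume.prod volume) := by
    have : Integrable (fun x => fderiv ℝ g x ν)
        (Measure.map (fun p : E × ℝ => B.Φ i p.1 - p.2 • ν) (volume.prod volume)) := by
      rw [hmap]
      exact hint.smul_measure ENNReal.ofReal_ne_top
    exact hemb.integrable_map_iff.1 this
  have key : ∫ x in B.shadow ν i, fderiv ℝ g x ν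
      ∂(Measure.map (fun p : E × ℝ => B.Φ i p.1 - p.2 • ν) (volume.prod volume))
      = ∫ y in B.P i, g (B.Φ i y) := by
    rw [hemb.setIntegral_map, shadow_eq_image, preimage_image_eq _ hemb.injective,
      setIntegral_prod _ hint'.integrableOn]
    simp only [hline]
  rw [hmap, Measure.restrict_smul, integral_smul_measure, ENNReal.toReal_ofReal (by positivity),
    smul_eq_mul] at key
  rw [← key, ← mul_assoc, mul_inv_cancel₀ hpos.ne', one_mul]

/-- The divergence theorem in the direction `ν`, for compactly supported functions. -/
theorem integral_fderiv_apply [Fintype ι] (ν : Fin n → ℝ) {g : (Fin n → ℝ) → ℝ}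
    (hg : ContDiff ℝ 1 g) (hsupp : HasCompactSupport g) :
    ∫ x in S, fderiv ℝ g x ν
      = ∑ i, B.ω i * ((B.m i ⬝ᵥ ν) * ∫ y in B.P i, g (B.Φ i y)) := by
  by_cases hν : ν = 0
  · simp [hν]
  have hcont : Continuous fun x => fderiv ℝ g x ν :=
    (hg.continuous_fderiv one_ne_zero).clm_apply continuous_const
  have hint : Integrable fun x => fderiv ℝ g x ν :=
    hcont.integrable_of_hasCompactSupport (hsupp.fderiv_apply ℝ ν)
  have hshadow : ∀ i, B.m i ⬝ᵥ ν ≠ 0 → MeasurableSet (B.shadow ν i) := by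
    intro i hi
    rw [shadow_eq_image]
    exact (B.measurableEmbedding hi).measurableSet_image.2 ((B.meas i).prod measurableSet_Ioi)
  rw [← integral_indicator B.isOpen.measurableSet,
    integral_congr_ae (B.ae_indicator_eq_sum_shadow hν _), integral_finsetSum]
  · refine Finset.sum_congr rfl fun i _ => ?_
    by_cases hi : B.m i ⬝ᵥ ν = 0
    · simp [hi]
    rw [integral_const_mul, integral_indicator (hshadow i hi), B.integral_shadow hi hg hsupp]
    rcases lt_or_gt_of_ne hi with h | h
    · rw [Real.sign_of_neg h, abs_of_neg h]
      ring
    · rw [Real.sign_of_pos h, abs_of_pos h]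
      ring
  · intro i _
    by_cases hi : B.m i ⬝ᵥ ν = 0
    · simp [hi]
    exact (hint.indicator (hshadow i hi)).const_mul _

end FlatBoundary

theorem hasFDerivAt_eval {n : ℕ} (p : MvPolynomial (Fin n) ℝ) (x : Fin n → ℝ) :
    HasFDerivAt (fun x : Fin n → ℝ => MvPolynomial.eval x p)
      (∑ j, MvPolynomial.eval x (MvPolynomial.pderiv j p) •
        ContinuousLinearMap.proj (R := ℝ) (φ := fun _ : Fin n => ℝ) j) x := by
  induction p using MvPolynomial.induction_on with
  | C a => simpa using hasFDerivAt_const a x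
  | add p q hp hq =>
    simp only [map_add, add_smul, Finset.sum_add_distrib]
    exact hp.add hq
  | mul_X p i hp =>
    have h1 : HasFDerivAt (fun x : Fin n → ℝ => x i)
      (ContinuousLinearMap.proj (R := ℝ) (φ := fun _ : Fin n => ℝ) i) x :=
      (ContinuousLinearMap.proj (R := ℝ) (φ := fun _ : Fin n => ℝ) i).hasFDerivAt
    have h2 := hp.mul h1
    simp only [map_mul, MvPolynomial.eval_X]
    refine h2.congr_fderiv ?_
    ext v
    simp [Derivation.leibniz, MvPolynomial.pderiv_X, Pi.single_apply, apply_ite, Finset.mul_sum,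
      add_mul, Finset.sum_add_distrib]
    ring_nf

theorem contDiff_eval {n : ℕ} (p : MvPolynomial (Fin n) ℝ) :
    ContDiff ℝ 1 fun x : Fin n → ℝ => MvPolynomial.eval x p :=
  (AnalyticOnNhd.eval_mvPolynomial p).contDiff

theorem FlatBoundary.integral_pderiv {n : ℕ} {E ι : Type*} [MeasureSpace E] [TopologicalSpace E]
    [BorelSpace E] [PolishSpace E] [SFinite (volume : Measure E)] [Fintype ι] {S : Set (Fin n → ℝ)}
    (B : FlatBoundary E ι S) (j : Fin n) (p : MvPolynomial (Fin n) ℝ) :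
    ∫ x in S, MvPolynomial.eval x (MvPolynomial.pderiv j p)
      = ∑ i, B.ω i * (B.m i j * ∫ y in B.P i, MvPolynomial.eval (B.Φ i y) p) := by
  obtain ⟨R, hR⟩ := B.bounded.subset_closedBall 0
  have hR' : closure S ⊆ Metric.ball 0 (max R 0 + 1) := by
    refine (closure_minimal hR Metric.isClosed_closedBall).trans
      (Metric.closedBall_subset_ball ?_)
    linarith [le_max_left R 0]
  -- a cut-off function makes `p` compactly supported without changing it near the closure of `S`
  let χ : ContDiffBump (0 : Fin n → ℝ) := ⟨max R 0 + 1, max R 0 + 2, by positivity, by linarith⟩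
  have hχ : ∀ x ∈ closure S, ∀ᶠ z in 𝓝 x, χ z * MvPolynomial.eval z p = MvPolynomial.eval z p := by
    intro x hx
    filter_upwards [χ.eventuallyEq_one_of_mem_ball (hR' hx)] with z hz
    rw [hz, Pi.one_apply, one_mul]
  have hg : ContDiff ℝ 1 fun x => χ x * MvPolynomial.eval x p := χ.contDiff.mul (contDiff_eval p)
  have hs : HasCompactSupport fun x => χ x * MvPolynomial.eval x p := χ.hasCompactSupport.mul_right
  have key := B.integral_fderiv_apply (Pi.single j 1) hg hs
  have hl : ∫ x in S, fderiv ℝ (fun x => χ x * MvPolynomial.eval x p) x (Pi.single j 1)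
      = ∫ x in S, MvPolynomial.eval x (MvPolynomial.pderiv j p) := by
    refine setIntegral_congr_fun B.isOpen.measurableSet fun x hx => ?_
    have h1 : (fun x => χ x * MvPolynomial.eval x p) =ᶠ[𝓝 x] fun x => MvPolynomial.eval x p :=
      hχ x (subset_closure hx)
    rw [h1.fderiv_eq, (hasFDerivAt_eval p x).fderiv]
    simp [Pi.single_apply]
  rw [← hl, key]
  refine Finset.sum_congr rfl fun i _ => ?_
  rw [dotProduct_single, mul_one]
  congr 2
  refine setIntegral_congr_fun (B.meas i) fun y hy => ?_
  exact (hχ _ (frontier_subset_closure (B.subset_frontier i ⟨y, hy, rfl⟩))).self_of_nhds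

/-- The divergence theorem for polynomial vector fields. -/
theorem FlatBoundary.integral_div {n : ℕ} {E ι : Type*} [MeasureSpace E] [TopologicalSpace E]
    [BorelSpace E] [PolishSpace E] [SFinite (volume : Measure E)]
    [IsFiniteMeasureOnCompacts (volume : Measure E)] [Fintype ι] {S : Set (Fin n → ℝ)}
    (B : FlatBoundary E ι S) (v : Fin n → MvPolynomial (Fin n) ℝ) :
    ∫ x in S, fn (div v) x = ∑ i, B.ω i * ∫ y in B.P i, vfn v (B.Φ i y) ⬝ᵥ B.m i := by
  have hint : ∀ j, IntegrableOn (fun x => MvPolynomial.eval x (MvPolynomial.pderiv j (v j))) S := by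
    intro j
    refine (ContinuousOn.integrableOn_compact B.bounded.isCompact_closure
      (MvPolynomial.continuous_eval _).continuousOn).mono_set subset_closure
  have hint' : ∀ i j, IntegrableOn (fun y => MvPolynomial.eval (B.Φ i y) (v j)) (B.P i) := by
    intro i j
    obtain ⟨K, hK, hPK⟩ := B.subset_compact i
    exact (ContinuousOn.integrableOn_compact hK
      ((MvPolynomial.continuous_eval _).comp (B.cont i)).continuousOn).mono_set hPK
  have h1 : ∫ x in S, fn (div v) x
      = ∑ j, ∫ x in S, MvPolynomial.eval x (MvPolynomial.pderiv j (v j)) := by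
    rw [← integral_finsetSum _ fun j _ => hint j]
    simp [fn, div, pd]
  rw [h1]
  simp only [B.integral_pderiv]
  rw [Finset.sum_comm]
  refine Finset.sum_congr rfl fun i _ => ?_
  rw [← Finset.mul_sum]
  congr 1
  simp only [dotProduct, vfn]
  rw [integral_finsetSum _ fun j _ => (hint' i j).mul_const _]
  refine Finset.sum_congr rfl fun j _ => ?_
  rw [integral_mul_const, mul_comm]

/-! ### Sides of flat boundary pieces -/

theorem eventually_nhdsGT_of_nhds {n : ℕ} {p : (Fin n → ℝ) → Prop} {x : Fin n → ℝ}
    (h : ∀ᶠ z in 𝓝 x, p z) (m : Fin n → ℝ) : ∀ᶠ t : ℝ in 𝓝[>] 0, p (x + t • m) := by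
  have hc : ContinuousAt (fun t : ℝ => x + t • m) 0 := by fun_prop
  have h' : ∀ᶠ z in 𝓝 (x + (0 : ℝ) • m), p z := by simpa using h
  exact (hc.eventually h').filter_mono nhdsWithin_le_nhds

theorem dotProduct_self_pos {n : ℕ} {m : Fin n → ℝ} (hm : m ≠ 0) : 0 < m ⬝ᵥ m := by
  have h1 : 0 ≤ m ⬝ᵥ m := Finset.sum_nonneg fun i _ => mul_self_nonneg (m i)
  exact h1.lt_of_ne fun h => hm (dotProduct_self_eq_zero.1 h.symm)

theorem subset_or_disjoint_of_disjoint_frontier {α : Type*} [TopologicalSpace α]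
    {H S : Set α} (hH : IsPreconnected H) (hS : IsOpen S) (hd : Disjoint H (frontier S)) :
    H ⊆ S ∨ Disjoint H S := by
  have hcov : H ⊆ S ∪ (closure S)ᶜ := by
    intro x hx
    by_cases h : x ∈ S
    · exact Or.inl h
    · refine Or.inr fun hc => disjoint_left.1 hd hx ⟨hc, fun hi => h (interior_subset hi)⟩
  rcases hH.subset_or_subset hS isClosed_closure.isOpen_compl
    (disjoint_compl_right.mono_left subset_closure) hcov with h | h
  · exact Or.inl h
  · exact Or.inr (disjoint_left.2 fun x hx hxS => h hx (subset_closure hxS))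

/-- If the boundary of an open set with Lipschitz boundary is a hyperplane near one of its points,
then the set is locally one side of the hyperplane: it cannot be both sides, since arbitrarily
close to `x` there are open sets of points below the graph of the boundary. -/
theorem HasLipschitzBoundary.one_side {n : ℕ} {S : Set (Fin n → ℝ)} (hS : IsOpen S)
    (hL : HasLipschitzBoundary S) {m x : Fin n → ℝ} (hm : m ≠ 0) (hx : x ∈ frontier S)
    (hloc : ∀ᶠ z in 𝓝 x, (z ∈ frontier S ↔ m ⬝ᵥ (z - x) = 0)) :
    (∀ᶠ z in 𝓝 x, (z ∈ S ↔ m ⬝ᵥ (z - x) < 0)) ∨ (∀ᶠ z in 𝓝 x, (z ∈ S ↔ 0 < m ⬝ᵥ (z - x))) := by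
  obtain ⟨ε, hε, hB⟩ := Metric.eventually_nhds_iff_ball.1 hloc
  have hball : ∀ᶠ z in 𝓝 x, z ∈ Metric.ball x ε := Metric.ball_mem_nhds x hε
  have hpl : ∀ z ∈ Metric.ball x ε, m ⬝ᵥ (z - x) = 0 → z ∉ S := by
    intro z hz h hzS
    have := (hB z hz).2 h
    rw [hS.frontier_eq] at this
    exact this.2 hzS
  have hlin : IsLinearMap ℝ fun z : Fin n → ℝ => m ⬝ᵥ z :=
    ⟨fun a b => dotProduct_add _ _ _, fun c a => dotProduct_smul _ _ _⟩
  have hneg : Metric.ball x ε ∩ {z | m ⬝ᵥ z < m ⬝ᵥ x} ⊆ S ∨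
      Disjoint (Metric.ball x ε ∩ {z | m ⬝ᵥ z < m ⬝ᵥ x}) S := by
    refine subset_or_disjoint_of_disjoint_frontier
      ((convex_ball x ε).inter (convex_halfSpace_lt hlin _)).isPreconnected hS ?_
    rw [disjoint_left]
    rintro z ⟨hz, hz'⟩ hf
    have := (hB z hz).1 hf
    rw [dotProduct_sub] at this
    exact absurd hz' (by simp [sub_eq_zero.1 this])
  have hpos : Metric.ball x ε ∩ {z | m ⬝ᵥ x < m ⬝ᵥ z} ⊆ S ∨
      Disjoint (Metric.ball x ε ∩ {z | m ⬝ᵥ x < m ⬝ᵥ z}) S := by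
    refine subset_or_disjoint_of_disjoint_frontier
      ((convex_ball x ε).inter (convex_halfSpace_gt hlin _)).isPreconnected hS ?_
    rw [disjoint_left]
    rintro z ⟨hz, hz'⟩ hf
    have := (hB z hz).1 hf
    rw [dotProduct_sub] at this
    exact absurd hz' (by simp [sub_eq_zero.1 this])
  have hsub : ∀ z, m ⬝ᵥ (z - x) < 0 ↔ m ⬝ᵥ z < m ⬝ᵥ x := fun z => by
    rw [dotProduct_sub, sub_neg]
  have hsub' : ∀ z, 0 < m ⬝ᵥ (z - x) ↔ m ⬝ᵥ x < m ⬝ᵥ z := fun z => by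
    rw [dotProduct_sub, sub_pos]
  rcases hneg with h1 | h1 <;> rcases hpos with h2 | h2
  -- `S` on both sides: the points `x - t • ν` are strictly below the graph, so they have
  -- neighbourhoods outside `S`, which would have to be contained in the hyperplane
  · exfalso
    obtain ⟨ν, hν, K, h, hh, U, hU, hUS⟩ := hL x hx
    have hxS : x ∉ S := hpl x (Metric.mem_ball_self hε) (by simp)
    have hx' : ν ⬝ᵥ x ≤ h (x - (ν ⬝ᵥ x) • ν) := not_lt.1 fun hc =>
      hxS ((hUS x (mem_of_mem_nhds hU)).2 hc)
    have hev : ∀ᶠ z in 𝓝 x, z ∈ Metric.ball x ε ∧ z ∈ interior U :=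
      hball.and (isOpen_interior.mem_nhds (mem_interior_iff_mem_nhds.2 hU))
    obtain ⟨t, ⟨htB, htU⟩, ht0⟩ := ((eventually_nhdsGT_of_nhds hev (-ν)).and
      self_mem_nhdsWithin).exists
    have ht0 : 0 < t := ht0
    set y := x + t • -ν with hy
    have hνy : ν ⬝ᵥ y = ν ⬝ᵥ x - t := by
      rw [hy, dotProduct_add, dotProduct_smul, dotProduct_neg, hν, smul_eq_mul]
      ring
    have hperp : y - (ν ⬝ᵥ y) • ν = x - (ν ⬝ᵥ x) • ν := by
      rw [hνy, hy]
      module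
    have hcont : Continuous fun y : Fin n → ℝ => h (y - (ν ⬝ᵥ y) • ν) - ν ⬝ᵥ y := by
      have h1 : Continuous fun y : Fin n → ℝ => ν ⬝ᵥ y := by
        simp only [dotProduct]
        fun_prop
      exact (hh.continuous.comp (continuous_id.sub (h1.smul continuous_const))).sub h1
    have hlow : ∀ᶠ z in 𝓝 y, z ∉ S := by
      have h3 : 0 < h (y - (ν ⬝ᵥ y) • ν) - ν ⬝ᵥ y := by
        rw [hperp, hνy]
        linarith
      filter_upwards [hcont.continuousAt.eventually (lt_mem_nhds h3),
        isOpen_interior.mem_nhds htU] with z hz hzU hzS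
      have h4 := (hUS z (interior_subset hzU)).1 hzS
      linarith
    have hlow' : ∀ᶠ z in 𝓝 y, m ⬝ᵥ (z - x) = 0 := by
      filter_upwards [hlow, Metric.isOpen_ball.mem_nhds htB] with z hz hzB
      by_contra hne
      rcases lt_or_gt_of_ne hne with h3 | h3
      · exact hz (h1 ⟨hzB, (hsub z).1 h3⟩)
      · exact hz (h2 ⟨hzB, (hsub' z).1 h3⟩)
    obtain ⟨t', ht', ht0'⟩ := ((eventually_nhdsGT_of_nhds hlow' m).and self_mem_nhdsWithin).exists
    have ht0' : 0 < t' := ht0'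
    have hself := hlow'.self_of_nhds
    rw [add_sub_right_comm, dotProduct_add, hself, dotProduct_smul, smul_eq_mul, zero_add] at ht'
    exact (mul_pos ht0' (dotProduct_self_pos hm)).ne' ht'
  · left
    filter_upwards [hball] with z hz
    rw [hsub]
    refine ⟨fun hzS => ?_, fun h => h1 ⟨hz, h⟩⟩
    rcases lt_trichotomy (m ⬝ᵥ z) (m ⬝ᵥ x) with h | h | h
    · exact h
    · exact absurd hzS (hpl z hz (by rw [dotProduct_sub, h, sub_self]))
    · exact absurd hzS (disjoint_left.1 h2 ⟨hz, h⟩)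
  · right
    filter_upwards [hball] with z hz
    rw [hsub']
    refine ⟨fun hzS => ?_, fun h => h2 ⟨hz, h⟩⟩
    rcases lt_trichotomy (m ⬝ᵥ z) (m ⬝ᵥ x) with h | h | h
    · exact absurd hzS (disjoint_left.1 h1 ⟨hz, h⟩)
    · exact absurd hzS (hpl z hz (by rw [dotProduct_sub, h, sub_self]))
    · exact h
  -- `S` on neither side: `x` would not be in the closure of `S`
  · exfalso
    obtain ⟨z, hz, hzS⟩ := mem_closure_iff_nhds.1 (frontier_subset_closure hx) _ hball
    rcases lt_trichotomy (m ⬝ᵥ z) (m ⬝ᵥ x) with h | h | h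
    · exact disjoint_left.1 h1 ⟨hz, h⟩ hzS
    · exact hpl z hz (by rw [dotProduct_sub, h, sub_self]) hzS
    · exact disjoint_left.1 h2 ⟨hz, h⟩ hzS

open scoped Classical in
/-- Along a connected flat piece `A` of the boundary, `S` lies always on the same side, which is
detected by whether the normal points out of `S`. -/
theorem eventually_mem_iff_of_pointsOut {n : ℕ} {S A : Set (Fin n → ℝ)} {m : Fin n → ℝ}
    (hm : m ≠ 0) (hA : IsConnected A) (hflat : ∀ x ∈ A, ∀ y ∈ A, m ⬝ᵥ (y - x) = 0)
    (hside : ∀ x ∈ A, (∀ᶠ z in 𝓝 x, (z ∈ S ↔ m ⬝ᵥ (z - x) < 0)) ∨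
      (∀ᶠ z in 𝓝 x, (z ∈ S ↔ 0 < m ⬝ᵥ (z - x)))) :
    ∀ x ∈ A, ∀ᶠ z in 𝓝 x, (z ∈ S ↔
      (if ∀ x ∈ A, ∀ᶠ t : ℝ in 𝓝[>] 0, x + t • m ∉ S then (1 : ℝ) else -1)
        * (m ⬝ᵥ (z - x)) < 0) := by
  obtain ⟨x₀, hx₀⟩ := hA.nonempty
  have hbase : ∀ x ∈ A, ∀ z, m ⬝ᵥ (z - x) = m ⬝ᵥ (z - x₀) := by
    intro x hx z
    have := hflat x₀ hx₀ x hx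
    simp only [dotProduct_sub] at this ⊢
    linarith
  -- the two alternatives, written with the fixed base point `x₀`, are open conditions
  set U : Set (Fin n → ℝ) := {x | ∀ᶠ z in 𝓝 x, (z ∈ S ↔ m ⬝ᵥ (z - x₀) < 0)} with hU
  set V : Set (Fin n → ℝ) := {x | ∀ᶠ z in 𝓝 x, (z ∈ S ↔ 0 < m ⬝ᵥ (z - x₀))} with hV
  have hcov : A ⊆ U ∪ V := by
    intro x hx
    have := hside x hx
    simp only [hbase x hx] at this
    exact this
  have hdisj : Disjoint U V := by
    rw [disjoint_left]
    intro x hxU hxV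
    have hz : ∀ᶠ z in 𝓝 x, m ⬝ᵥ (z - x₀) = 0 := by
      filter_upwards [hxU, hxV] with z h1 h2
      by_contra hne
      rcases lt_or_gt_of_ne hne with h | h
      · exact lt_asymm h (h2.1 (h1.2 h))
      · exact lt_asymm h (h1.1 (h2.2 h))
    obtain ⟨t, ht, ht0⟩ := ((eventually_nhdsGT_of_nhds hz m).and self_mem_nhdsWithin).exists
    have ht0 : 0 < t := ht0
    rw [add_sub_right_comm, dotProduct_add, hz.self_of_nhds, dotProduct_smul, smul_eq_mul,
      zero_add] at ht
    exact (mul_pos ht0 (dotProduct_self_pos hm)).ne' ht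
  have hval : ∀ x ∈ A, ∀ t : ℝ, 0 < t → 0 < m ⬝ᵥ (x + t • m - x₀) := by
    intro x hx t ht
    rw [← hbase x hx, add_sub_cancel_left, dotProduct_smul, smul_eq_mul]
    exact mul_pos ht (dotProduct_self_pos hm)
  rcases hA.isPreconnected.subset_or_subset isOpen_setOfPred_eventually_nhds
    isOpen_setOfPred_eventually_nhds hdisj hcov with h | h
  · have hout : ∀ x ∈ A, ∀ᶠ t : ℝ in 𝓝[>] 0, x + t • m ∉ S := by
      intro x hx
      filter_upwards [eventually_nhdsGT_of_nhds (h hx) m, self_mem_nhdsWithin] with t ht ht0 hS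
      exact lt_asymm (ht.1 hS) (hval x hx t ht0)
    intro x hx
    rw [if_pos hout]
    have := h hx
    simp only [one_mul, hbase x hx]
    exact this
  · have hout : ¬ ∀ x ∈ A, ∀ᶠ t : ℝ in 𝓝[>] 0, x + t • m ∉ S := by
      intro hall
      obtain ⟨t, ⟨h1, h2⟩, ht0⟩ := (((hall x₀ hx₀).and
        (eventually_nhdsGT_of_nhds (h hx₀) m)).and self_mem_nhdsWithin).exists
      exact h1 (h2.2 (hval x₀ hx₀ t ht0))
    intro x hx
    rw [if_neg hout]
    have := h hx
    simp only [neg_mul, one_mul, hbase x hx, neg_lt_zero]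
    exact this

/-- An affine change of variables in `ℝⁿ`, in terms of the matrix of its linear part. -/
theorem map_add_mulVec {n : ℕ} {E : Type*} [MeasureSpace E] {e : E × ℝ → Fin n → ℝ}
    (he : MeasurePreserving e (volume.prod volume) volume) {M : Matrix (Fin n) (Fin n) ℝ}
    (hM : M.det ≠ 0) (p : Fin n → ℝ) :
    Measure.map (fun z => p + M *ᵥ e z) ((volume : Measure E).prod (volume : Measure ℝ))
      = ENNReal.ofReal |M.det|⁻¹ • volume := by
  have h1 : (fun z => p + M *ᵥ e z) = (fun x => p + x) ∘ (Matrix.toLin' M) ∘ e := by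
    ext z
    simp
  have h2 : Measurable (Matrix.toLin' M) :=
    (LinearMap.continuous_of_finiteDimensional _).measurable
  rw [h1, ← Measure.map_map (measurable_const_add p) (h2.comp he.measurable),
    ← Measure.map_map h2 he.measurable, he.map_eq, Real.map_matrix_volume_pi_eq_smul_volume_pi hM,
    Measure.map_smul, map_add_left_eq_self, abs_inv]

namespace Polytope

variable {n : ℕ} (X : Polytope n)

theorem isOpen : IsOpen X.carrier := by
  obtain ⟨S, -, h⟩ := X.simplices
  rw [h]
  exact isOpen_interior

theorem isBounded : Bornology.IsBounded X.carrier := by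
  obtain ⟨S, hS, h⟩ := X.simplices
  have hK : IsCompact (⋃ s ∈ S, convexHull ℝ (Set.range s.points)) :=
    hS.isCompact_biUnion fun s _ => (Set.finite_range _).isCompact_convexHull ℝ
  rw [h]
  exact hK.isBounded.subset interior_subset

end Polytope

/-! ### Geometry of faces and edges -/

namespace Face

variable (f : Face)

theorem n_dot_τ1 : f.n ⬝ᵥ f.τ1 = 0 := by
  rw [dotProduct_comm]
  exact dot_self_cross _ _

theorem n_dot_τ2 : f.n ⬝ᵥ f.τ2 = 0 := by
  rw [dotProduct_comm]
  exact dot_cross_self _ _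

theorem n_dot_n : f.n ⬝ᵥ f.n = 1 := by
  simp [n, cross_dot_cross, f.unit1, f.unit2, f.orth]

theorem n_ne : f.n ≠ 0 := by
  intro h
  have := f.n_dot_n
  simp [h] at this

theorem τ1_cross_n : f.τ1 ⨯₃ f.n = -f.τ2 := by
  have h1 := f.unit1
  have h2 := f.orth
  simp only [dotProduct, Fin.sum_univ_three] at h1 h2
  ext i
  fin_cases i <;> simp [n, cross_apply]
  · linear_combination f.τ1 0 * h2 - f.τ2 0 * h1
  · linear_combination f.τ1 1 * h2 - f.τ2 1 * h1
  · linear_combination f.τ1 2 * h2 - f.τ2 2 * h1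

theorem τ2_cross_n : f.τ2 ⨯₃ f.n = f.τ1 := by
  have h1 := f.unit2
  have h2 := f.orth
  simp only [dotProduct, Fin.sum_univ_three] at h1 h2
  ext i
  fin_cases i <;> simp [n, cross_apply]
  · linear_combination f.τ1 0 * h1 - f.τ2 0 * h2
  · linear_combination f.τ1 1 * h1 - f.τ2 1 * h2
  · linear_combination f.τ1 2 * h1 - f.τ2 2 * h2

/-- The matrix with rows `τ₁`, `τ₂`, `n_F` is orthogonal. -/
theorem frame_mul_transpose :
    (Matrix.of ![f.τ1, f.τ2, f.n])ᵀ * Matrix.of ![f.τ1, f.τ2, f.n] = 1 := by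
  rw [mul_eq_one_comm]
  have h : f.τ2 ⬝ᵥ f.τ1 = 0 := by rw [dotProduct_comm, f.orth]
  have h1 : f.τ1 ⬝ᵥ f.n = 0 := by rw [dotProduct_comm, f.n_dot_τ1]
  have h2 : f.τ2 ⬝ᵥ f.n = 0 := by rw [dotProduct_comm, f.n_dot_τ2]
  ext i j
  rw [Matrix.mul_apply']
  fin_cases i <;> fin_cases j <;>
    simp [Matrix.transpose] <;>
    first
      | exact f.unit1 | exact f.unit2 | exact f.orth | exact f.n_dot_n | exact f.n_dot_τ1
      | exact f.n_dot_τ2 | exact h | exact h1 | exact h2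

/-- Expansion of a vector in the orthonormal frame of the face. -/
theorem frame_expand (u : Fin 3 → ℝ) :
    u = (f.τ1 ⬝ᵥ u) • f.τ1 + (f.τ2 ⬝ᵥ u) • f.τ2 + (f.n ⬝ᵥ u) • f.n := by
  have h := congrArg (· *ᵥ u) f.frame_mul_transpose
  simp only [Matrix.one_mulVec, ← Matrix.mulVec_mulVec] at h
  conv_lhs => rw [← h]
  ext i
  simp [Matrix.mulVec, dotProduct, Fin.sum_univ_three, Matrix.transpose]
  ring

theorem dot_eq_tang_add (u w : Fin 3 → ℝ) :
    u ⬝ᵥ w = f.tang u ⬝ᵥ f.tang w + (f.n ⬝ᵥ u) * (f.n ⬝ᵥ w) := by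
  conv_lhs => rw [f.frame_expand u]
  simp [tang, add_dotProduct, smul_dotProduct]

theorem continuous_emb : Continuous f.emb := by
  unfold emb
  fun_prop

theorem continuous_coord : Continuous f.coord := by
  unfold coord
  refine continuous_pi fun i => ?_
  fin_cases i <;> simp [dotProduct] <;> fun_prop

theorem coord_emb (y : Fin 2 → ℝ) : f.coord (f.emb y) = y := by
  have h : f.τ2 ⬝ᵥ f.τ1 = 0 := by rw [dotProduct_comm, f.orth]
  ext i
  fin_cases i <;>
    simp [coord, emb, add_sub_right_comm, dotProduct_add, dotProduct_smul, f.unit1, f.unit2, f.orth,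
      h]

theorem n_dot_emb (y : Fin 2 → ℝ) : f.n ⬝ᵥ f.emb y = f.n ⬝ᵥ f.o := by
  simp [emb, dotProduct_add, dotProduct_smul, f.n_dot_τ1, f.n_dot_τ2]

theorem emb_coord {x : Fin 3 → ℝ} (h : f.n ⬝ᵥ x = f.n ⬝ᵥ f.o) : f.emb (f.coord x) = x := by
  have h1 := f.frame_expand (x - f.o)
  have h2 : f.n ⬝ᵥ (x - f.o) = 0 := by rw [dotProduct_sub, h, sub_self]
  rw [h2, zero_smul, add_zero] at h1
  simp only [emb, coord, Matrix.cons_val_zero, Matrix.cons_val_one]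
  rw [add_assoc, ← h1, add_sub_cancel]

theorem coord_add (x u : Fin 3 → ℝ) : f.coord (x + u) = f.coord x + f.tang u := by
  ext i
  fin_cases i <;> simp [coord, tang, add_sub_right_comm, dotProduct_add]

theorem tang_smul (c : ℝ) (u : Fin 3 → ℝ) : f.tang (c • u) = c • f.tang u := by
  ext i
  fin_cases i <;> simp [tang, dotProduct_smul]

theorem emb_add_smul (y : Fin 2 → ℝ) (c : ℝ) {u : Fin 3 → ℝ} (hu : f.n ⬝ᵥ u = 0) :
    f.emb y + c • u = f.emb (y + c • f.tang u) := by
  rw [← f.emb_coord (x := f.emb y + c • u), coord_add, coord_emb, tang_smul]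
  rw [dotProduct_add, dotProduct_smul, hu, smul_zero, add_zero, n_dot_emb]

theorem emb_injective : Function.Injective f.emb :=
  Function.LeftInverse.injective f.coord_emb

theorem isClosedEmbedding_emb : Topology.IsClosedEmbedding f.emb :=
  Function.LeftInverse.isClosedEmbedding f.coord_emb f.continuous_coord f.continuous_emb

theorem closure_set : closure f.set = f.set ∪ f.bdry := by
  rw [set, f.isClosedEmbedding_emb.closure_image_eq, bdry, ← image_union,
    closure_eq_self_union_frontier]

theorem n_dot_of_mem_closure {x : Fin 3 → ℝ} (hx : x ∈ closure f.set) :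
    f.n ⬝ᵥ x = f.n ⬝ᵥ f.o := by
  rw [set, f.isClosedEmbedding_emb.closure_image_eq] at hx
  obtain ⟨y, -, rfl⟩ := hx
  exact f.n_dot_emb y

/-- The parametrisation of space by the face and a direction transversal to it. -/
theorem map_emb_sub_smul {ν : Fin 3 → ℝ} (h : f.n ⬝ᵥ ν ≠ 0) :
    Measure.map (fun p : (Fin 2 → ℝ) × ℝ => f.emb p.1 - p.2 • ν) (volume.prod volume)
      = ENNReal.ofReal |f.n ⬝ᵥ ν|⁻¹ • volume := by
  have he : MeasurePreserving (fun p : (Fin 2 → ℝ) × ℝ =>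
      (MeasurableEquiv.piFinSuccAbove (fun _ : Fin 3 => ℝ) 0).symm p.swap)
      (volume.prod volume) volume :=
    (volume_preserving_piFinSuccAbove (fun _ : Fin 3 => ℝ) 0).symm.comp
      Measure.measurePreserving_swap
  have hdet : (Matrix.of ![-ν, f.τ1, f.τ2])ᵀ.det = -(f.n ⬝ᵥ ν) := by
    rw [Matrix.det_transpose, Matrix.det_fin_three]
    simp [n, cross_apply, dotProduct, Fin.sum_univ_three]
    ring
  have key := map_add_mulVec he (M := (Matrix.of ![-ν, f.τ1, f.τ2])ᵀ)
    (by rw [hdet]; exact neg_ne_zero.2 h) f.o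
  rw [hdet, abs_neg] at key
  rw [← key]
  congr 1
  ext p i
  simp [emb, MeasurableEquiv.piFinSuccAbove, Matrix.mulVec, dotProduct, Fin.sum_univ_three,
    Matrix.transpose]
  change _ = f.o i + (-(ν i * p.2) + f.τ1 i * p.1 0 + f.τ2 i * p.1 1)
  ring

end Face

namespace Edge

variable (e : Edge)

theorem length_pos : 0 < e.length :=
  Real.sqrt_pos.2 (dotProduct_self_pos (sub_ne_zero.2 e.ne.symm))

theorem length_smul_t : e.length • e.t = e.x2 - e.x1 := by
  rw [t, smul_smul, mul_inv_cancel₀ e.length_pos.ne', one_smul]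

theorem t_dot_t : e.t ⬝ᵥ e.t = 1 := by
  have h : e.length * e.length = (e.x2 - e.x1) ⬝ᵥ (e.x2 - e.x1) :=
    Real.mul_self_sqrt (dotProduct_self_pos (sub_ne_zero.2 e.ne.symm)).le
  rw [t, smul_dotProduct, dotProduct_smul, ← h, smul_eq_mul, smul_eq_mul]
  have := e.length_pos.ne'
  field_simp

theorem t_ne : e.t ≠ 0 := by
  intro h
  have := e.t_dot_t
  simp [h] at this

theorem pt_zero : e.pt 0 = e.x1 := by simp [pt]

theorem pt_length : e.pt e.length = e.x2 := by simp [pt, length_smul_t]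

theorem continuous_pt : Continuous e.pt := by
  unfold pt
  fun_prop

theorem cl_eq_image : e.cl = e.pt '' Icc 0 e.length := by
  have h := e.length_pos
  rw [cl, segment_eq_image', ← mul_one e.length]
  have : Icc 0 (e.length * 1) = (fun θ => e.length * θ) '' Icc (0 : ℝ) 1 := by
    rw [image_mul_left_Icc h.le zero_le_one]
    simp
  rw [this, image_image]
  refine image_congr fun θ _ => ?_
  rw [pt, mul_comm, mul_smul, length_smul_t]

theorem op_eq_image : e.op = e.pt '' Ioo 0 e.length := by
  have h := e.length_pos
  rw [op, openSegment_eq_image', ← mul_one e.length]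
  have : Ioo 0 (e.length * 1) = (fun θ => e.length * θ) '' Ioo (0 : ℝ) 1 := by
    rw [image_mul_left_Ioo h]
    simp
  rw [this, image_image]
  refine image_congr fun θ _ => ?_
  rw [pt, mul_comm, mul_smul, length_smul_t]

theorem op_subset_cl : e.op ⊆ e.cl := openSegment_subset_segment ℝ _ _

theorem isClosed_cl : IsClosed e.cl := by
  rw [cl_eq_image]
  exact (isCompact_Icc.image e.continuous_pt).isClosed

theorem cl_subset : e.cl ⊆ e.op ∪ {e.x1, e.x2} := by
  rw [cl, op, ← insert_endpoints_openSegment]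
  rintro x (h | h | h) <;> simp [h]

end Edge

/-! ### The boundary of a polyhedron and of its faces -/

theorem span_ne_top {n : ℕ} (s : Finset (Fin n → ℝ)) (hs : s.card < n) :
    Submodule.span ℝ (s : Set (Fin n → ℝ)) ≠ ⊤ := by
  intro h
  have h1 := finrank_span_finset_le_card (R := ℝ) s
  rw [Set.finrank, h, finrank_top, Module.finrank_fin_fun] at h1
  omega

namespace Polyhedron

variable (T : Polyhedron)

theorem mem_edgesOf {f : Fin T.nF} {e : Fin T.nE} :
    e ∈ T.edgesOf f ↔ (T.edge e).cl ⊆ (T.face f).bdry := by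
  simp [edgesOf]

theorem mem_bdry_iff {f : Fin T.nF} {x : Fin 3 → ℝ} :
    x ∈ (T.face f).bdry ↔ ∃ e ∈ T.edgesOf f, x ∈ (T.edge e).cl := by
  rw [T.face_bdry f]
  simp only [mem_iUnion, exists_prop, mem_edgesOf]
  rfl

theorem not_mem_bdry {f f' : Fin T.nF} {x : Fin 3 → ℝ} (hx : x ∈ (T.face f).set) :
    x ∉ (T.face f').bdry := by
  intro h
  obtain ⟨e, -, he⟩ := T.mem_bdry_iff.1 h
  exact disjoint_left.1 (T.face_edge_disjoint f e) hx he

theorem not_mem_closure_set {f f' : Fin T.nF} (h : f ≠ f') {x : Fin 3 → ℝ}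
    (hx : x ∈ (T.face f).set) : x ∉ closure (T.face f').set := by
  rw [Face.closure_set]
  rintro (h1 | h1)
  · exact disjoint_left.1 (T.face_disjoint f f' h) hx h1
  · exact T.not_mem_bdry hx h1

theorem set_subset_frontier (f : Fin T.nF) : (T.face f).set ⊆ frontier T.carrier := by
  rw [T.frontier_eq]
  exact subset_closure.trans (subset_iUnion (fun f => closure (T.face f).set) f)

theorem eventually_mem_frontier_iff {f : Fin T.nF} {x : Fin 3 → ℝ} (hx : x ∈ (T.face f).set) :
    ∀ᶠ z in 𝓝 x, (z ∈ frontier T.carrier ↔ (T.face f).n ⬝ᵥ (z - x) = 0) := by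
  have h1 : ∀ᶠ z in 𝓝 x, ∀ f', f' ≠ f → z ∉ closure (T.face f').set := by
    rw [eventually_all]
    intro f'
    by_cases h : f' = f
    · simp [h]
    · filter_upwards [isClosed_closure.isOpen_compl.mem_nhds (T.not_mem_closure_set (Ne.symm h) hx)]
        with z hz _ using hz
  have hnx := (T.face f).n_dot_of_mem_closure (subset_closure hx)
  have h2 : ∀ᶠ z in 𝓝 x, (T.face f).coord z ∈ (T.face f).poly.carrier := by
    refine (T.face f).continuous_coord.continuousAt.eventually
      ((T.face f).poly.isOpen.mem_nhds ?_)
    obtain ⟨y, hy, rfl⟩ := hx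
    rwa [Face.coord_emb]
  filter_upwards [h1, h2] with z hz1 hz2
  rw [dotProduct_sub, hnx, sub_eq_zero]
  constructor
  · intro hz
    rw [T.frontier_eq] at hz
    obtain ⟨f', hf'⟩ := mem_iUnion.1 hz
    have : f' = f := by
      by_contra hne
      exact hz1 f' hne hf'
    subst this
    exact (T.face f').n_dot_of_mem_closure hf'
  · intro hz
    exact T.set_subset_frontier f ⟨_, hz2, (T.face f).emb_coord hz⟩

theorem isConnected_set (f : Fin T.nF) : IsConnected (T.face f).set :=
  (T.face f).poly.connected.image _ (T.face f).continuous_emb.continuousOn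

theorem face_side {f : Fin T.nF} {x : Fin 3 → ℝ} (hx : x ∈ (T.face f).set) :
    ∀ᶠ z in 𝓝 x, (z ∈ T.carrier ↔ T.ωF f * ((T.face f).n ⬝ᵥ (z - x)) < 0) := by
  refine eventually_mem_iff_of_pointsOut (T.face f).n_ne (T.isConnected_set f) ?_ ?_ x hx
  · intro x hx y hy
    rw [dotProduct_sub, (T.face f).n_dot_of_mem_closure (subset_closure hx),
      (T.face f).n_dot_of_mem_closure (subset_closure hy), sub_self]
  · intro x hx
    exact HasLipschitzBoundary.one_side T.isOpen T.lipschitz (T.face f).n_ne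
      (T.set_subset_frontier f hx) (T.eventually_mem_frontier_iff hx)

/-- The boundary of a polyhedron consists of its faces, up to the closed edges. -/
noncomputable def flatBoundary : FlatBoundary (Fin 2 → ℝ) (Fin T.nF) T.carrier where
  P f := (T.face f).poly.carrier
  Φ f := (T.face f).emb
  m f := (T.face f).n
  ω := T.ωF
  N := ⋃ e, (T.edge e).cl
  isOpen := T.isOpen
  bounded := T.isBounded
  normal_ne f := (T.face f).n_ne
  meas f := (T.face f).poly.isOpen.measurableSet
  subset_compact f := ⟨_, (T.face f).poly.isBounded.isCompact_closure, subset_closure⟩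
  cont f := (T.face f).continuous_emb
  inj f := (T.face f).emb_injective
  flat f := ⟨_, (T.face f).n_dot_emb⟩
  sign f := by
    unfold ωF
    split_ifs <;> simp
  side f y hy := T.face_side ⟨y, hy, rfl⟩
  disj f f' h := T.face_disjoint f f' h
  subset_frontier f := T.set_subset_frontier f
  frontier_subset := by
    intro x hx
    rw [T.frontier_eq] at hx
    obtain ⟨f, hf⟩ := mem_iUnion.1 hx
    rw [Face.closure_set] at hf
    rcases hf with hf | hf
    · exact Or.inl (mem_iUnion.2 ⟨f, hf⟩)
    · obtain ⟨e, -, he⟩ := T.mem_bdry_iff.1 hf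
      exact Or.inr (mem_iUnion.2 ⟨e, he⟩)
  null ν := by
    classical
    refine measure_mono_null (t := ⋃ e, {x | x - (T.edge e).x1 ∈
      Submodule.span ℝ (({(T.edge e).t, ν} : Finset (Fin 3 → ℝ)) : Set (Fin 3 → ℝ))}) ?_
      (measure_iUnion_null fun e => volume_setOf_sub_mem _ (span_ne_top _ ?_) _)
    · rintro x ⟨s, hs⟩
      obtain ⟨e, he⟩ := mem_iUnion.1 hs
      rw [Edge.cl_eq_image] at he
      obtain ⟨r, -, hr⟩ := he
      refine mem_iUnion.2 ⟨e, ?_⟩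
      have : x - (T.edge e).x1 = r • (T.edge e).t - s • ν := by
        rw [eq_sub_iff_add_eq, sub_add_eq_add_sub, ← hr, Edge.pt, add_sub_cancel_left]
      simp only [mem_ofPred_eq, this]
      refine Submodule.sub_mem _ (Submodule.smul_mem _ _ (Submodule.subset_span ?_))
        (Submodule.smul_mem _ _ (Submodule.subset_span ?_)) <;> simp
    · exact Finset.card_le_two.trans_lt (by norm_num)
  map f ν h := (T.face f).map_emb_sub_smul h

/-- Gauss' theorem on a polyhedron. -/
theorem integral_div (v : Fin 3 → MvPolynomial (Fin 3) ℝ) :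
    ∫ x in T.carrier, fn (div v) x = ∑ f, T.ωF f * ∫ y in (T.face f).poly.carrier,
      vfn v ((T.face f).emb y) ⬝ᵥ (T.face f).n :=
  T.flatBoundary.integral_div v

variable {T} {f : Fin T.nF} {e : Fin T.nE}

theorem n_dot_of_mem_cl (he : e ∈ T.edgesOf f) {x : Fin 3 → ℝ} (hx : x ∈ (T.edge e).cl) :
    (T.face f).n ⬝ᵥ x = (T.face f).n ⬝ᵥ (T.face f).o := by
  refine (T.face f).n_dot_of_mem_closure ?_
  rw [Face.closure_set]
  exact Or.inr (T.mem_edgesOf.1 he hx)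

theorem emb_coord_of_mem_cl (he : e ∈ T.edgesOf f) {x : Fin 3 → ℝ} (hx : x ∈ (T.edge e).cl) :
    (T.face f).emb ((T.face f).coord x) = x :=
  (T.face f).emb_coord (n_dot_of_mem_cl he hx)

theorem n_dot_t (he : e ∈ T.edgesOf f) : (T.face f).n ⬝ᵥ (T.edge e).t = 0 := by
  rw [Edge.t, dotProduct_smul, dotProduct_sub,
    n_dot_of_mem_cl he (left_mem_segment ℝ _ _), n_dot_of_mem_cl he (right_mem_segment ℝ _ _),
    sub_self, smul_zero]

theorem emb_coord_pt (he : e ∈ T.edgesOf f) (s : ℝ) :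
    (T.face f).emb ((T.face f).coord ((T.edge e).pt s)) = (T.edge e).pt s := by
  refine (T.face f).emb_coord ?_
  rw [Edge.pt, dotProduct_add, dotProduct_smul, n_dot_t he, smul_zero, add_zero]
  exact n_dot_of_mem_cl he (left_mem_segment ℝ _ _)

theorem coord_pt (s : ℝ) : (T.face f).coord ((T.edge e).pt s)
    = (T.face f).coord (T.edge e).x1 + s • (T.face f).tang (T.edge e).t := by
  rw [Edge.pt, Face.coord_add, Face.tang_smul]

/-- In the coordinates of the face, `n_{FE}` is the tangent rotated by `π/2`. -/
theorem tang_nE (F : Face) (E : Edge) : F.tang (F.nE E) = ![-(F.tang E.t 1), F.tang E.t 0] := by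
  have h1 : ∀ u, u ⬝ᵥ F.n ⨯₃ E.t = E.t ⬝ᵥ u ⨯₃ F.n := fun u =>
    (triple_product_permutation _ _ _).trans (triple_product_permutation _ _ _)
  ext i
  fin_cases i
  · simp [Face.tang, Face.nE, h1, F.τ1_cross_n, dotProduct_comm]
  · simp [Face.tang, Face.nE, h1, F.τ2_cross_n, dotProduct_comm]

theorem tang_t_sq (he : e ∈ T.edgesOf f) : (T.face f).tang (T.edge e).t 0 ^ 2
    + (T.face f).tang (T.edge e).t 1 ^ 2 = 1 := by
  have h := (T.face f).dot_eq_tang_add (T.edge e).t (T.edge e).t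
  rw [(T.edge e).t_dot_t, n_dot_t he, dotProduct, Fin.sum_univ_two] at h
  linarith

theorem tang_nE_ne (he : e ∈ T.edgesOf f) : (T.face f).tang ((T.face f).nE (T.edge e)) ≠ 0 := by
  intro h
  rw [tang_nE] at h
  have h0 := congrFun h 0
  have h1 := congrFun h 1
  simp only [Matrix.cons_val_zero, Matrix.cons_val_one, Pi.zero_apply, neg_eq_zero] at h0 h1
  have := tang_t_sq he
  rw [h0, h1] at this
  norm_num at this

theorem n_dot_nE (F : Face) (E : Edge) : F.n ⬝ᵥ F.nE E = 0 := dot_self_cross _ _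

theorem tang_nE_dot_tang_t (F : Face) (E : Edge) : F.tang (F.nE E) ⬝ᵥ F.tang E.t = 0 := by
  rw [tang_nE, dotProduct, Fin.sum_univ_two]
  simp
  ring

theorem tang_nE_dot_coord_pt (s : ℝ) :
    (T.face f).tang ((T.face f).nE (T.edge e)) ⬝ᵥ (T.face f).coord ((T.edge e).pt s)
      = (T.face f).tang ((T.face f).nE (T.edge e)) ⬝ᵥ (T.face f).coord (T.edge e).x1 := by
  rw [coord_pt, dotProduct_add, dotProduct_smul, tang_nE_dot_tang_t, smul_zero, add_zero]

theorem coord_pt_injective (he : e ∈ T.edgesOf f) :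
    Function.Injective fun s => (T.face f).coord ((T.edge e).pt s) := by
  intro s s' h
  have h1 := congrArg (T.face f).emb h
  simp only [emb_coord_pt he] at h1
  simp only [Edge.pt, add_right_inj] at h1
  exact smul_left_injective ℝ (T.edge e).t_ne h1

theorem mem_frontier_iff {y : Fin 2 → ℝ} : y ∈ frontier (T.face f).poly.carrier ↔
    ∃ e ∈ T.edgesOf f, (T.face f).emb y ∈ (T.edge e).cl := by
  rw [← T.mem_bdry_iff, Face.bdry, (T.face f).emb_injective.mem_set_image]

theorem emb_mem_op_iff (he : e ∈ T.edgesOf f) {y : Fin 2 → ℝ} :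
    (T.face f).emb y ∈ (T.edge e).op ↔
      y ∈ (fun s => (T.face f).coord ((T.edge e).pt s)) '' Ioo 0 (T.edge e).length := by
  rw [Edge.op_eq_image]
  constructor
  · rintro ⟨s, hs, h⟩
    exact ⟨s, hs, by simp [h, Face.coord_emb]⟩
  · rintro ⟨s, hs, rfl⟩
    exact ⟨s, hs, (emb_coord_pt he s).symm⟩

/-- A point of the plane whose normal component relative to an edge vanishes lies on the line of
the edge. -/
theorem eq_coord_pt (he : e ∈ T.edgesOf f) {z : Fin 2 → ℝ}
    (hz : (T.face f).tang ((T.face f).nE (T.edge e)) ⬝ᵥ (z - (T.face f).coord (T.edge e).x1) = 0) :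
    (T.face f).coord ((T.edge e).pt
      ((T.face f).tang (T.edge e).t ⬝ᵥ (z - (T.face f).coord (T.edge e).x1))) = z := by
  rw [coord_pt, ← eq_sub_iff_add_eq']
  generalize z - (T.face f).coord (T.edge e).x1 = u at hz ⊢
  have hsq := tang_t_sq he
  rw [tang_nE] at hz
  generalize (T.face f).tang (T.edge e).t = t at hz hsq ⊢
  simp only [dotProduct, Fin.sum_univ_two, Matrix.cons_val_zero, Matrix.cons_val_one] at hz
  ext i
  fin_cases i <;> simp [dotProduct, Fin.sum_univ_two]
  · linear_combination u 0 * hsq + t 1 * hz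
  · linear_combination u 1 * hsq - t 0 * hz

theorem eventually_mem_frontier_iff_of_mem_edge (he : e ∈ T.edgesOf f) {s : ℝ}
    (hs : s ∈ Ioo 0 (T.edge e).length) : ∀ᶠ z in 𝓝 ((T.face f).coord ((T.edge e).pt s)),
    (z ∈ frontier (T.face f).poly.carrier ↔ (T.face f).tang ((T.face f).nE (T.edge e)) ⬝ᵥ
      (z - (T.face f).coord ((T.edge e).pt s)) = 0) := by
  have h1 : ∀ᶠ z in 𝓝 ((T.face f).coord ((T.edge e).pt s)), ∀ e', e' ≠ e →
      (T.face f).emb z ∉ (T.edge e').cl := by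
    rw [eventually_all]
    intro e'
    by_cases h : e' = e
    · simp [h]
    · have hn : (T.face f).emb ((T.face f).coord ((T.edge e).pt s)) ∈ ((T.edge e').cl)ᶜ := by
        rw [emb_coord_pt he]
        refine disjoint_left.1 (T.edge_disjoint e e' (Ne.symm h)) ?_
        rw [Edge.op_eq_image]
        exact ⟨s, hs, rfl⟩
      filter_upwards [(T.face f).continuous_emb.continuousAt.eventually
        ((T.edge e').isClosed_cl.isOpen_compl.mem_nhds hn)] with z hz _ using hz
  have h2 : ∀ᶠ z in 𝓝 ((T.face f).coord ((T.edge e).pt s)), (T.face f).tang (T.edge e).t ⬝ᵥ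
      (z - (T.face f).coord (T.edge e).x1) ∈ Ioo 0 (T.edge e).length := by
    have hc : Continuous fun z => (T.face f).tang (T.edge e).t ⬝ᵥ
        (z - (T.face f).coord (T.edge e).x1) := by
      simp only [dotProduct]
      fun_prop
    refine hc.continuousAt.eventually (isOpen_Ioo.mem_nhds ?_)
    have := tang_t_sq he
    beta_reduce
    rw [coord_pt, add_sub_cancel_left, dotProduct_smul, dotProduct, Fin.sum_univ_two, ← sq, ← sq,
      this, smul_eq_mul, mul_one]
    exact hs
  filter_upwards [h1, h2] with z hz1 hz2
  rw [dotProduct_sub, tang_nE_dot_coord_pt, ← dotProduct_sub]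
  constructor
  · intro hz
    obtain ⟨e', he', hz'⟩ := mem_frontier_iff.1 hz
    have : e' = e := by
      by_contra hne
      exact hz1 e' hne hz'
    subst this
    rw [Edge.cl_eq_image] at hz'
    obtain ⟨r, -, hr⟩ := hz'
    have hz'' : z = (T.face f).coord ((T.edge e').pt r) := by rw [hr, Face.coord_emb]
    rw [hz'', dotProduct_sub, tang_nE_dot_coord_pt, sub_self]
  · intro hz
    refine mem_frontier_iff.2 ⟨e, he, (T.edge e).op_subset_cl ?_⟩
    rw [emb_mem_op_iff he]
    exact ⟨_, hz2, eq_coord_pt he hz⟩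

theorem pointsOut_edge_iff (he : e ∈ T.edgesOf f) :
    PointsOut (T.face f).set (T.edge e).op ((T.face f).nE (T.edge e)) ↔
      ∀ y ∈ (fun s => (T.face f).coord ((T.edge e).pt s)) '' Ioo 0 (T.edge e).length,
        ∀ᶠ t : ℝ in 𝓝[>] 0, y + t • (T.face f).tang ((T.face f).nE (T.edge e))
          ∉ (T.face f).poly.carrier := by
  have key : ∀ y (t : ℝ), (T.face f).emb y + t • (T.face f).nE (T.edge e) ∈ (T.face f).set ↔
      y + t • (T.face f).tang ((T.face f).nE (T.edge e)) ∈ (T.face f).poly.carrier := by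
    intro y t
    rw [Face.emb_add_smul _ _ _ (n_dot_nE _ _), Face.set, (T.face f).emb_injective.mem_set_image]
  constructor
  · intro h y hy
    have := h _ ((emb_mem_op_iff he).2 hy)
    simpa only [key] using this
  · intro h x hx
    have hx' := emb_coord_of_mem_cl he ((T.edge e).op_subset_cl hx)
    rw [← hx'] at hx ⊢
    simpa only [key] using h _ ((emb_mem_op_iff he).1 hx)

theorem edge_side (he : e ∈ T.edgesOf f) {s : ℝ} (hs : s ∈ Ioo 0 (T.edge e).length) :
    ∀ᶠ z in 𝓝 ((T.face f).coord ((T.edge e).pt s)), (z ∈ (T.face f).poly.carrier ↔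
      T.ωE f e * ((T.face f).tang ((T.face f).nE (T.edge e)) ⬝ᵥ
        (z - (T.face f).coord ((T.edge e).pt s))) < 0) := by
  have hconn : IsConnected
      ((fun s => (T.face f).coord ((T.edge e).pt s)) '' Ioo 0 (T.edge e).length) :=
    (isConnected_Ioo (T.edge e).length_pos).image _
      ((T.face f).continuous_coord.comp (T.edge e).continuous_pt).continuousOn
  have h := eventually_mem_iff_of_pointsOut (S := (T.face f).poly.carrier) (tang_nE_ne he) hconn
    (by
      rintro _ ⟨s, -, rfl⟩ _ ⟨s', -, rfl⟩
      simp only [dotProduct_sub, tang_nE_dot_coord_pt, sub_self])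
    (by
      rintro _ ⟨s, hs, rfl⟩
      refine HasLipschitzBoundary.one_side (T.face f).poly.isOpen (T.face f).poly.lipschitz
        (tang_nE_ne he) ?_ (eventually_mem_frontier_iff_of_mem_edge he hs)
      refine mem_frontier_iff.2 ⟨e, he, (T.edge e).op_subset_cl ?_⟩
      exact (emb_mem_op_iff he).2 ⟨s, hs, rfl⟩) _ ⟨s, hs, rfl⟩
  have hiff := pointsOut_edge_iff he
  by_cases hp : PointsOut (T.face f).set (T.edge e).op ((T.face f).nE (T.edge e))
  · rw [if_pos (hiff.1 hp)] at h
    simpa only [ωE, if_pos hp] using h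
  · rw [if_neg (fun h' => hp (hiff.2 h'))] at h
    simpa only [ωE, if_neg hp] using h

theorem map_coord_pt_sub_smul {ν : Fin 2 → ℝ}
    (h : (T.face f).tang ((T.face f).nE (T.edge e)) ⬝ᵥ ν ≠ 0) :
    Measure.map (fun p : ℝ × ℝ => (T.face f).coord ((T.edge e).pt p.1) - p.2 • ν)
      (volume.prod volume)
      = ENNReal.ofReal |(T.face f).tang ((T.face f).nE (T.edge e)) ⬝ᵥ ν|⁻¹ • volume := by
  have he := (volume_preserving_finTwoArrow ℝ).symm
  have hdet : (Matrix.of ![(T.face f).tang (T.edge e).t, -ν])ᵀ.det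
      = -((T.face f).tang ((T.face f).nE (T.edge e)) ⬝ᵥ ν) := by
    rw [Matrix.det_transpose, Matrix.det_fin_two, tang_nE]
    simp [dotProduct, Fin.sum_univ_two]
  have key := map_add_mulVec he (M := (Matrix.of ![(T.face f).tang (T.edge e).t, -ν])ᵀ)
    (by rw [hdet]; exact neg_ne_zero.2 h) ((T.face f).coord (T.edge e).x1)
  rw [hdet, abs_neg] at key
  rw [← key]
  congr 1
  ext p i
  simp [coord_pt, Matrix.transpose]
  ring

variable (T f)

/-- The boundary of a face, in the coordinates of the face, consists of its edges, up to the
vertices. -/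
noncomputable def faceBoundary : FlatBoundary ℝ (T.edgesOf f) (T.face f).poly.carrier where
  P e := Ioo 0 (T.edge e).length
  Φ e s := (T.face f).coord ((T.edge e).pt s)
  m e := (T.face f).tang ((T.face f).nE (T.edge e))
  ω e := T.ωE f e
  N := ⋃ e, {(T.face f).coord (T.edge e).x1, (T.face f).coord (T.edge e).x2}
  isOpen := (T.face f).poly.isOpen
  bounded := (T.face f).poly.isBounded
  normal_ne e := tang_nE_ne e.2
  meas e := measurableSet_Ioo
  subset_compact e := ⟨_, isCompact_Icc, Ioo_subset_Icc_self⟩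
  cont e := (T.face f).continuous_coord.comp (T.edge e).continuous_pt
  inj e := coord_pt_injective e.2
  flat e := ⟨_, tang_nE_dot_coord_pt⟩
  sign e := by
    unfold ωE
    split_ifs <;> simp
  side e s hs := edge_side e.2 hs
  disj e e' h := by
    rw [disjoint_left]
    intro y hy hy'
    exact disjoint_left.1 (T.edge_disjoint e e' (fun h' => h (Subtype.ext h')))
      ((emb_mem_op_iff e.2).2 hy) ((T.edge e').op_subset_cl ((emb_mem_op_iff e'.2).2 hy'))
  subset_frontier e y hy :=
    mem_frontier_iff.2 ⟨e, e.2, (T.edge e).op_subset_cl ((emb_mem_op_iff e.2).2 hy)⟩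
  frontier_subset := by
    intro y hy
    obtain ⟨e, he, hy'⟩ := mem_frontier_iff.1 hy
    rcases (T.edge e).cl_subset hy' with h | h
    · exact Or.inl (mem_iUnion.2 ⟨⟨e, he⟩, (emb_mem_op_iff he).1 h⟩)
    · refine Or.inr (mem_iUnion.2 ⟨e, ?_⟩)
      rw [← (T.face f).coord_emb y]
      have h' : (T.face f).emb y = (T.edge e).x1 ∨ (T.face f).emb y = (T.edge e).x2 := h
      rcases h' with h | h <;> simp [h]
  null ν := by
    refine measure_mono_null (t := ⋃ e, ({x | x - (T.face f).coord (T.edge e).x1 ∈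
        Submodule.span ℝ (({ν} : Finset (Fin 2 → ℝ)) : Set (Fin 2 → ℝ))} ∪
      {x | x - (T.face f).coord (T.edge e).x2 ∈
        Submodule.span ℝ (({ν} : Finset (Fin 2 → ℝ)) : Set (Fin 2 → ℝ))})) ?_
      (measure_iUnion_null fun e => measure_union_null
        (volume_setOf_sub_mem _ (span_ne_top _ (by simp)) _)
        (volume_setOf_sub_mem _ (span_ne_top _ (by simp)) _))
    rintro x ⟨s, hs⟩
    obtain ⟨e, he⟩ := mem_iUnion.1 hs
    refine mem_iUnion.2 ⟨e, ?_⟩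
    have key : ∀ v, x + s • ν = v → x - v ∈
        Submodule.span ℝ (({ν} : Finset (Fin 2 → ℝ)) : Set (Fin 2 → ℝ)) := by
      rintro v rfl
      rw [sub_add_cancel_left, ← neg_smul]
      exact Submodule.smul_mem _ _ (Submodule.subset_span (by simp))
    rcases he with he | he
    · exact Or.inl (key _ he)
    · exact Or.inr (key _ he)
  map e ν h := map_coord_pt_sub_smul h

/-- Gauss' theorem on a face. -/
theorem integral_face_div (v : Fin 2 → MvPolynomial (Fin 2) ℝ) :
    ∫ x in (T.face f).poly.carrier, fn (div v) x
      = ∑ e : T.edgesOf f, T.ωE f e * ∫ s in (0 : ℝ)..(T.edge e).length,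
        vfn v ((T.face f).coord ((T.edge e).pt s)) ⬝ᵥ
          (T.face f).tang ((T.face f).nE (T.edge e)) := by
  simp only [intervalIntegral.integral_of_le (T.edge _).length_pos.le,
    integral_Ioc_eq_integral_Ioo]
  exact (T.faceBoundary f).integral_div v

end Polyhedron

/-! ### Orthogonal projections on polynomial spaces -/

/-- The Riesz representation for a definite bilinear form on a finite-dimensional subspace. -/
theorem exists_forall_eq_of_definite {V : Type*} [AddCommGroup V] [Module ℝ V]
    (B : V →ₗ[ℝ] V →ₗ[ℝ] ℝ) (hB : ∀ v, B v v = 0 → v = 0) (W : Submodule ℝ V)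
    [FiniteDimensional ℝ W] (l : V →ₗ[ℝ] ℝ) : ∃ p : W, ∀ r : W, B p r = l r := by
  let A : W →ₗ[ℝ] Module.Dual ℝ W := (B.comp W.subtype).compl₂ W.subtype
  have hinj : Function.Injective A := by
    rw [← LinearMap.ker_eq_bot, LinearMap.ker_eq_bot']
    intro p hp
    have := LinearMap.congr_fun hp p
    exact Subtype.ext (hB p this)
  have hsurj : Function.Surjective A :=
    (LinearMap.injective_iff_surjective_of_finrank_eq_finrank
      (Subspace.dual_finrank_eq (K := ℝ) (V := W)).symm).1 hinj
  obtain ⟨p, hp⟩ := hsurj (l.comp W.subtype)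
  exact ⟨p, fun r => LinearMap.congr_fun hp r⟩

theorem epsilon_eq {α : Type*} [h : Nonempty α] {P : α → Prop} {a : α} (ha : P a)
    (hu : ∀ b, P b → b = a) : @Classical.epsilon α h P = a :=
  hu _ (Classical.epsilon_spec ⟨a, ha⟩)

/-- A nonnegative continuous function with zero integral over an open set vanishes there. -/
theorem eqOn_zero_of_setIntegral_eq_zero {α : Type*} [TopologicalSpace α] [MeasurableSpace α]
    [BorelSpace α] {μ : Measure α} [μ.IsOpenPosMeasure] {U : Set α} (hU : IsOpen U) {F : α → ℝ}
    (hF : Continuous F) (hint : IntegrableOn F U μ) (hpos : ∀ x ∈ U, 0 ≤ F x)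
    (h0 : ∫ x in U, F x ∂μ = 0) : EqOn F 0 U := by
  have hnn : 0 ≤ᵐ[μ.restrict U] F :=
    (ae_restrict_iff' hU.measurableSet).2 (Eventually.of_forall hpos)
  have h1 := (setIntegral_eq_zero_iff_of_nonneg_ae hnn hint).1 h0
  exact Measure.eqOn_open_of_ae_eq h1 hU hF.continuousOn continuousOn_const

instance finiteDimensional_Poly (n : ℕ) (ℓ : ℤ) : FiniteDimensional ℝ (Poly n ℓ) := by
  have hfin : {m : Fin n →₀ ℕ | ((m.degree : ℕ) : ℤ) ≤ ℓ}.Finite := by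
    refine (Finsupp.finite_of_degree_le ℓ.toNat).subset fun m hm => ?_
    have hm' : ((m.degree : ℕ) : ℤ) ≤ ℓ := hm
    show m.degree ≤ ℓ.toNat
    omega
  have : Finite {m : Fin n →₀ ℕ | ((m.degree : ℕ) : ℤ) ≤ ℓ} := hfin
  exact Module.Finite.of_basis (MvPolynomial.basisRestrictSupport ℝ _)

instance finiteDimensional_VPoly (n : ℕ) (ℓ : ℤ) : FiniteDimensional ℝ (VPoly n ℓ) := by
  let A : (Fin n → Poly n ℓ) →ₗ[ℝ] (Fin n → MvPolynomial (Fin n) ℝ) :=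
    LinearMap.pi fun i => (Poly n ℓ).subtype ∘ₗ LinearMap.proj i
  have h : VPoly n ℓ ≤ LinearMap.range A := by
    intro v hv
    exact ⟨fun i => ⟨v i, hv i (mem_univ i)⟩, rfl⟩
  exact Submodule.finiteDimensional_of_le h

instance finiteDimensional_Roly2 (ℓ : ℤ) : FiniteDimensional ℝ (Roly2 ℓ) := by
  unfold Roly2
  infer_instance

instance finiteDimensional_Roly3 (ℓ : ℤ) : FiniteDimensional ℝ (Roly3 ℓ) := by
  unfold Roly3
  infer_instance

instance finiteDimensional_Goly3 (ℓ : ℤ) : FiniteDimensional ℝ (Goly3 ℓ) := by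
  unfold Goly3
  infer_instance

instance finiteDimensional_PolyE (ℓ : ℤ) : FiniteDimensional ℝ (PolyE ℓ) :=
  Module.Finite.equiv (Polynomial.degreeLTEquiv ℝ (ℓ + 1).toNat).symm

theorem eval_mul_eq {n : ℕ} (p q : MvPolynomial (Fin n) ℝ) (x : Fin n → ℝ) :
    fn p x * fn q x = MvPolynomial.eval x (p * q) := by simp [fn]

theorem vfn_dot_vfn {n m : ℕ} (u w : Fin m → MvPolynomial (Fin n) ℝ) (x : Fin n → ℝ) :
    vfn u x ⬝ᵥ vfn w x = MvPolynomial.eval x (u ⬝ᵥ w) := by simp [vfn, dotProduct]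

namespace Polytope

variable {n : ℕ} (X : Polytope n)

/-- The integral over a polytope as a linear form on the polynomials. -/
noncomputable def int : MvPolynomial (Fin n) ℝ →ₗ[ℝ] ℝ where
  toFun p := ∫ x in X.carrier, MvPolynomial.eval x p
  map_add' p q := by
    simp only [map_add]
    exact integral_add (X.integrableOn_eval p) (X.integrableOn_eval q)
  map_smul' c p := by
    simp only [MvPolynomial.smul_eval, RingHom.id_apply, smul_eq_mul]
    exact integral_const_mul c _

theorem int_apply (p : MvPolynomial (Fin n) ℝ) :
    X.int p = ∫ x in X.carrier, MvPolynomial.eval x p := rfl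

theorem int_mul (p q : MvPolynomial (Fin n) ℝ) :
    ∫ x in X.carrier, fn p x * fn q x = X.int (p * q) := by
  simp only [eval_mul_eq, int_apply]

theorem int_dot {m : ℕ} (u w : Fin m → MvPolynomial (Fin n) ℝ) :
    ∫ x in X.carrier, vfn u x ⬝ᵥ vfn w x = X.int (u ⬝ᵥ w) := by
  simp only [vfn_dot_vfn, int_apply]

theorem eq_zero_of_int_eq_zero {p : MvPolynomial (Fin n) ℝ}
    (hpos : ∀ x, 0 ≤ MvPolynomial.eval x p) (h : X.int p = 0) : p = 0 := by
  have h1 := eqOn_zero_of_setIntegral_eq_zero X.isOpen (MvPolynomial.continuous_eval p)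
    (X.integrableOn_eval p) (fun x _ => hpos x) h
  obtain ⟨x, hx⟩ := X.connected.nonempty
  obtain ⟨ε, hε, hB⟩ := Metric.isOpen_iff.1 X.isOpen x hx
  refine MvPolynomial.funext_set (fun i => Metric.ball (x i) ε)
    (fun i => ?_) fun y hy => ?_
  · rw [Real.ball_eq_Ioo]
    exact Ioo_infinite (by linarith)
  · rw [map_zero]
    refine h1 (hB ?_)
    rwa [ball_pi _ hε]

theorem eq_zero_of_int_self {p : MvPolynomial (Fin n) ℝ} (h : X.int (p * p) = 0) : p = 0 :=
  mul_self_eq_zero.1 (X.eq_zero_of_int_eq_zero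
    (fun x => by rw [map_mul]; exact mul_self_nonneg _) h)

theorem eq_zero_of_int_dot_self {m : ℕ} {u : Fin m → MvPolynomial (Fin n) ℝ}
    (h : X.int (u ⬝ᵥ u) = 0) : u = 0 := by
  have h1 : u ⬝ᵥ u = 0 := X.eq_zero_of_int_eq_zero (fun x => by
    rw [← vfn_dot_vfn]
    exact Finset.sum_nonneg fun i _ => mul_self_nonneg _) h
  ext1 i
  refine MvPolynomial.funext fun x => ?_
  have h2 : vfn u x ⬝ᵥ vfn u x = 0 := by rw [vfn_dot_vfn, h1, map_zero]
  simpa [vfn] using congrFun (dotProduct_self_eq_zero.1 h2) i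

instance finiteDimensional_perp (V : Submodule ℝ (Fin n → MvPolynomial (Fin n) ℝ)) (ℓ : ℤ) :
    FiniteDimensional ℝ (X.perp V ℓ) :=
  Submodule.finiteDimensional_of_le (S₂ := VPoly n ℓ) fun _ hv => hv.1

/-- The characterising relation of the scalar projection. -/
theorem int_proj_mul (ℓ : ℤ) (q : MvPolynomial (Fin n) ℝ) {r : MvPolynomial (Fin n) ℝ}
    (hr : r ∈ Poly n ℓ) : X.int ((X.proj ℓ (fn q)).1 * r) = X.int (q * r) := by
  have key : ∀ p r : MvPolynomial (Fin n) ℝ, ∫ x in X.carrier, (fn p x - fn q x) * fn r x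
      = X.int (p * r) - X.int (q * r) := by
    intro p r
    rw [← map_sub, ← sub_mul, ← int_mul]
    simp [fn]
  have hex : ∃ p : Poly n ℓ, ∀ r : Poly n ℓ,
      ∫ x in X.carrier, (fn p.1 x - fn q x) * fn r.1 x = 0 := by
    obtain ⟨p, hp⟩ := exists_forall_eq_of_definite ((LinearMap.mul ℝ _).compr₂ X.int)
      (fun v hv => X.eq_zero_of_int_self hv) (Poly n ℓ) (X.int ∘ₗ LinearMap.mul ℝ _ q)
    refine ⟨p, fun r => ?_⟩
    rw [key, sub_eq_zero]
    exact hp r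
  have h := Classical.epsilon_spec hex ⟨r, hr⟩
  rw [key, sub_eq_zero] at h
  exact h

/-- The characterising relation of the projection of vector fields. -/
theorem int_vproj_dot (W : Submodule ℝ (Fin n → MvPolynomial (Fin n) ℝ)) [FiniteDimensional ℝ W]
    (u : Fin n → MvPolynomial (Fin n) ℝ) {r : Fin n → MvPolynomial (Fin n) ℝ} (hr : r ∈ W) :
    X.int ((X.vproj W (vfn u)).1 ⬝ᵥ r) = X.int (u ⬝ᵥ r) := by
  have key : ∀ p r : Fin n → MvPolynomial (Fin n) ℝ,
      ∫ x in X.carrier, (vfn p x - vfn u x) ⬝ᵥ vfn r x = X.int (p ⬝ᵥ r) - X.int (u ⬝ᵥ r) := by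
    intro p r
    rw [← map_sub, ← sub_dotProduct, ← int_dot]
    congr 1
    ext x
    congr 1
    ext i
    simp [vfn]
  let B : (Fin n → MvPolynomial (Fin n) ℝ) →ₗ[ℝ] (Fin n → MvPolynomial (Fin n) ℝ) →ₗ[ℝ] ℝ :=
    LinearMap.mk₂ ℝ (fun u w => X.int (u ⬝ᵥ w)) (fun a b c => by rw [add_dotProduct, map_add])
      (fun c a b => by rw [smul_dotProduct, map_smul])
      (fun a b c => by rw [dotProduct_add, map_add])
      (fun c a b => by rw [dotProduct_smul, map_smul])
  have hex : ∃ p : W, ∀ r : W,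
      ∫ x in X.carrier, (vfn p.1 x - vfn u x) ⬝ᵥ vfn r.1 x = 0 := by
    obtain ⟨p, hp⟩ := exists_forall_eq_of_definite B
      (fun v hv => X.eq_zero_of_int_dot_self hv) W (B u)
    refine ⟨p, fun r => ?_⟩
    rw [key, sub_eq_zero]
    exact hp r
  have h := Classical.epsilon_spec hex ⟨r, hr⟩
  rw [key, sub_eq_zero] at h
  exact h

theorem eq_of_int_mul {ℓ : ℤ} {p q : Poly n ℓ}
    (h : ∀ r : Poly n ℓ, X.int (p.1 * r.1) = X.int (q.1 * r.1)) : p = q := by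
  refine sub_eq_zero.1 (Subtype.ext (X.eq_zero_of_int_self ?_))
  have := h (p - q)
  rw [← sub_eq_zero, ← map_sub, ← sub_mul] at this
  exact this

theorem eq_of_int_dot {W : Submodule ℝ (Fin n → MvPolynomial (Fin n) ℝ)} {p q : W}
    (h : ∀ r : W, X.int (p.1 ⬝ᵥ r.1) = X.int (q.1 ⬝ᵥ r.1)) : p = q := by
  refine sub_eq_zero.1 (Subtype.ext (X.eq_zero_of_int_dot_self ?_))
  have := h (p - q)
  rw [← sub_eq_zero, ← map_sub, ← sub_dotProduct] at this
  exact this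

end Polytope

namespace Edge

variable (e : Edge)

/-- The integral over an edge as a linear form on the polynomials in the arc length. -/
noncomputable def int : Polynomial ℝ →ₗ[ℝ] ℝ where
  toFun p := ∫ s in (0 : ℝ)..e.length, p.eval s
  map_add' p q := by
    simp only [Polynomial.eval_add]
    exact intervalIntegral.integral_add (p.continuous.intervalIntegrable _ _)
      (q.continuous.intervalIntegrable _ _)
  map_smul' c p := by
    simp only [Polynomial.eval_smul, RingHom.id_apply, smul_eq_mul]
    exact intervalIntegral.integral_const_mul c _

theorem int_apply (p : Polynomial ℝ) : e.int p = ∫ s in (0 : ℝ)..e.length, p.eval s := rfl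

theorem eq_zero_of_int_eq_zero {p : Polynomial ℝ}
    (hpos : ∀ s ∈ Ioo 0 e.length, 0 ≤ p.eval s) (h : e.int p = 0) : p = 0 := by
  rw [int_apply, intervalIntegral.integral_of_le e.length_pos.le, integral_Ioc_eq_integral_Ioo] at h
  have h1 := eqOn_zero_of_setIntegral_eq_zero isOpen_Ioo p.continuous
    ((p.continuous.continuousOn.integrableOn_compact isCompact_Icc).mono_set Ioo_subset_Icc_self)
    hpos h
  exact Polynomial.eq_zero_of_infinite_isRoot p ((Ioo_infinite e.length_pos).mono fun s hs => h1 hs)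

theorem eq_zero_of_int_self {p : Polynomial ℝ} (h : e.int (p * p) = 0) : p = 0 :=
  mul_self_eq_zero.1 (e.eq_zero_of_int_eq_zero
    (fun x _ => by rw [Polynomial.eval_mul]; exact mul_self_nonneg _) h)

/-- The characterising relation of the projection on an edge. -/
theorem int_proj_mul (ℓ : ℤ) (q : Polynomial ℝ) {r : Polynomial ℝ} (hr : r ∈ PolyE ℓ) :
    e.int ((e.proj ℓ fun s => q.eval s).1 * r) = e.int (q * r) := by
  have key : ∀ p r : Polynomial ℝ, ∫ s in (0 : ℝ)..e.length, (p.eval s - q.eval s) * r.eval s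
      = e.int (p * r) - e.int (q * r) := by
    intro p r
    rw [← map_sub, ← sub_mul, int_apply]
    simp
  have hex : ∃ p : PolyE ℓ, ∀ r : PolyE ℓ,
      ∫ s in (0 : ℝ)..e.length, (p.1.eval s - q.eval s) * r.1.eval s = 0 := by
    obtain ⟨p, hp⟩ := exists_forall_eq_of_definite ((LinearMap.mul ℝ _).compr₂ e.int)
      (fun v hv => e.eq_zero_of_int_self hv) (PolyE ℓ) (e.int ∘ₗ LinearMap.mul ℝ _ q)
    refine ⟨p, fun r => ?_⟩
    rw [key, sub_eq_zero]
    exact hp r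
  have h := Classical.epsilon_spec hex ⟨r, hr⟩
  rw [key, sub_eq_zero] at h
  exact h

theorem eq_of_int_mul {ℓ : ℤ} {p q : PolyE ℓ}
    (h : ∀ r : PolyE ℓ, e.int (p.1 * r.1) = e.int (q.1 * r.1)) : p = q := by
  refine sub_eq_zero.1 (Subtype.ext (e.eq_zero_of_int_self ?_))
  have := h (p - q)
  rw [← sub_eq_zero, ← map_sub, ← sub_mul] at this
  exact this

theorem proj_eq_self {ℓ : ℤ} {q : Polynomial ℝ} (hq : q ∈ PolyE ℓ) :
    e.proj ℓ (fun s => q.eval s) = ⟨q, hq⟩ :=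
  e.eq_of_int_mul fun r => e.int_proj_mul ℓ q r.2

theorem mem_PolyE_iff {ℓ : ℤ} {p : Polynomial ℝ} : p ∈ PolyE ℓ ↔ p.degree < (ℓ + 1).toNat :=
  Polynomial.mem_degreeLT

/-- A polynomial of degree `k + 1` on an edge is determined by its values at the vertices and its
projection of degree `k - 1`: a polynomial for which these data vanish is
`s (|E| - s) r` with `r` of degree `k - 1`, and is orthogonal to `r`. -/
theorem eq_of_proj_eq {k : ℕ} {p q : PolyE (k + 1)}
    (h : e.proj (k - 1) (fun s => p.1.eval s) = e.proj (k - 1) (fun s => q.1.eval s))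
    (h0 : p.1.eval 0 = q.1.eval 0) (h1 : p.1.eval e.length = q.1.eval e.length) : p = q := by
  set d : Polynomial ℝ := p.1 - q.1 with hd
  have hdmem : d ∈ PolyE (k + 1) := sub_mem p.2 q.2
  have horth : ∀ r ∈ PolyE (k - 1), e.int (d * r) = 0 := by
    intro r hr
    rw [hd, sub_mul, map_sub, ← e.int_proj_mul _ p.1 hr, ← e.int_proj_mul _ q.1 hr, h, sub_self]
  obtain ⟨r₁, hr₁⟩ := Polynomial.dvd_iff_isRoot.2 (show d.IsRoot 0 by simp [hd, h0])
  have hroot : r₁.IsRoot e.length := by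
    have : d.eval e.length = 0 := by simp [hd, h1]
    rw [hr₁] at this
    simpa [e.length_pos.ne'] using this
  obtain ⟨r, hr⟩ := Polynomial.dvd_iff_isRoot.2 hroot
  have hfac : d = (Polynomial.X - Polynomial.C 0) *
      ((Polynomial.X - Polynomial.C e.length) * r) := by
    rw [hr₁, hr]
  have hr0 : r = 0 := by
    by_contra hne
    have hdeg : d.degree = 1 + (1 + r.degree) := by
      rw [hfac, Polynomial.degree_mul, Polynomial.degree_mul, Polynomial.degree_X_sub_C,
        Polynomial.degree_X_sub_C]
    have hrmem : r ∈ PolyE (k - 1) := by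
      rw [mem_PolyE_iff] at hdmem ⊢
      rw [hdeg, Polynomial.degree_eq_natDegree hne] at hdmem
      rw [Polynomial.degree_eq_natDegree hne]
      have e1 : ((k : ℤ) + 1 + 1).toNat = k + 2 := by omega
      have e2 : ((k : ℤ) - 1 + 1).toNat = k := by omega
      rw [e1] at hdmem
      rw [e2]
      have : 1 + (1 + r.natDegree) < k + 2 := by exact_mod_cast hdmem
      exact_mod_cast (by omega : r.natDegree < k)
    have h2 : -(d * r) = 0 := by
      refine e.eq_zero_of_int_eq_zero (fun s hs => ?_) (by rw [map_neg, horth r hrmem, neg_zero])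
      have h3 : (-(d * r)).eval s = (s * (e.length - s)) * (r.eval s * r.eval s) := by
        rw [hfac]
        simp
        ring
      rw [h3]
      exact mul_nonneg (mul_nonneg hs.1.le (sub_nonneg.2 hs.2.le)) (mul_self_nonneg _)
    rw [neg_eq_zero, mul_eq_zero] at h2
    rcases h2 with h2 | h2
    · rw [h2, Polynomial.degree_zero, Polynomial.degree_eq_natDegree hne] at hdeg
      have h4 : (⊥ : WithBot ℕ) = ((1 + (1 + r.natDegree) : ℕ) : WithBot ℕ) := by
        rw [hdeg]
        push_cast
        rfl
      exact WithBot.bot_ne_coe h4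
    · exact hne h2
  refine Subtype.ext (sub_eq_zero.1 ?_)
  rw [← hd, hfac, hr0, mul_zero, mul_zero]

end Edge

/-! ### Degrees, differential identities and traces of polynomials -/

theorem mem_Poly {n : ℕ} {ℓ : ℤ} {p : MvPolynomial (Fin n) ℝ} :
    p ∈ Poly n ℓ ↔ ∀ m ∈ p.support, ((m.degree : ℕ) : ℤ) ≤ ℓ := Iff.rfl

theorem mem_VPoly {n : ℕ} {ℓ : ℤ} {v : Fin n → MvPolynomial (Fin n) ℝ} :
    v ∈ VPoly n ℓ ↔ ∀ i, v i ∈ Poly n ℓ := by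
  simp [VPoly, Submodule.mem_pi]

theorem Poly_mono {n : ℕ} {a b : ℤ} (h : a ≤ b) : Poly n a ≤ Poly n b :=
  fun _ hp m hm => (mem_Poly.1 hp m hm).trans h

theorem VPoly_mono {n : ℕ} {a b : ℤ} (h : a ≤ b) : VPoly n a ≤ VPoly n b :=
  fun _ hv => mem_VPoly.2 fun i => Poly_mono h (mem_VPoly.1 hv i)

theorem mul_mem_Poly {n : ℕ} {a b : ℤ} {p q : MvPolynomial (Fin n) ℝ} (hp : p ∈ Poly n a)
    (hq : q ∈ Poly n b) : p * q ∈ Poly n (a + b) := by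
  classical
  refine mem_Poly.2 fun m hm => ?_
  obtain ⟨m₁, h₁, m₂, h₂, rfl⟩ := Finset.mem_add.1 (MvPolynomial.support_mul p q hm)
  have e1 := mem_Poly.1 hp m₁ h₁
  have e2 := mem_Poly.1 hq m₂ h₂
  rw [map_add]
  push_cast
  linarith

theorem C_mem_Poly {n : ℕ} (c : ℝ) : MvPolynomial.C c ∈ Poly n 0 := by
  refine mem_Poly.2 fun m hm => ?_
  rw [← MvPolynomial.monomial_zero'] at hm
  rw [Finset.mem_singleton.1 (MvPolynomial.support_monomial_subset hm)]
  simp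

theorem X_mem_Poly {n : ℕ} (i : Fin n) :
    (MvPolynomial.X i : MvPolynomial (Fin n) ℝ) ∈ Poly n 1 := by
  refine mem_Poly.2 fun m hm => ?_
  rw [MvPolynomial.X] at hm
  rw [Finset.mem_singleton.1 (MvPolynomial.support_monomial_subset hm)]
  simp

theorem C_mul_mem_Poly {n : ℕ} {ℓ : ℤ} (c : ℝ) {p : MvPolynomial (Fin n) ℝ} (hp : p ∈ Poly n ℓ) :
    MvPolynomial.C c * p ∈ Poly n ℓ := by
  simpa using mul_mem_Poly (C_mem_Poly c) hp

theorem pd_mem_Poly {n : ℕ} {ℓ : ℤ} {p : MvPolynomial (Fin n) ℝ} (hp : p ∈ Poly n (ℓ + 1))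
    (i : Fin n) : pd i p ∈ Poly n ℓ := by
  refine mem_Poly.2 fun m hm => ?_
  have h : MvPolynomial.coeff m (MvPolynomial.pderiv i p) ≠ 0 := MvPolynomial.mem_support_iff.1 hm
  rw [MvPolynomial.coeff_pderiv] at h
  have h1 := mem_Poly.1 hp _ (MvPolynomial.mem_support_iff.2 (left_ne_zero_of_mul h))
  rw [map_add, Finsupp.degree_single] at h1
  push_cast at h1
  linarith

/-- Substitution of affine functions does not raise the degree. -/
theorem aeval_mem_Poly {n m : ℕ} {ℓ : ℤ} {g : Fin m → MvPolynomial (Fin n) ℝ}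
    (hg : ∀ i, g i ∈ Poly n 1) {p : MvPolynomial (Fin m) ℝ} (hp : p ∈ Poly m ℓ) :
    MvPolynomial.aeval g p ∈ Poly n ℓ := by
  have hpow : ∀ i (a : ℕ), g i ^ a ∈ Poly n a := by
    intro i a
    induction a with
    | zero => simpa using C_mem_Poly (n := n) 1
    | succ a ih =>
      rw [pow_succ]
      push_cast
      exact mul_mem_Poly ih (hg i)
  have hprod : ∀ (s : Finset (Fin m)) (d : Fin m →₀ ℕ),
      ∏ i ∈ s, g i ^ d i ∈ Poly n ((∑ i ∈ s, d i : ℕ) : ℤ) := by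
    intro s d
    induction s using Finset.induction_on with
    | empty => simpa using C_mem_Poly (n := n) 1
    | insert i s hi ih =>
      rw [Finset.prod_insert hi, Finset.sum_insert hi]
      push_cast
      have := mul_mem_Poly (hpow i (d i)) ih
      push_cast at this
      exact this
  rw [MvPolynomial.aeval_def, MvPolynomial.eval₂_eq]
  refine Submodule.sum_mem _ fun d hd => ?_
  refine C_mul_mem_Poly _ (Poly_mono ?_ (hprod _ d))
  exact mem_Poly.1 hp d hd

theorem grad_mem_VPoly {n : ℕ} {ℓ : ℤ} {p : MvPolynomial (Fin n) ℝ} (hp : p ∈ Poly n (ℓ + 1)) :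
    grad p ∈ VPoly n ℓ :=
  mem_VPoly.2 fun i => pd_mem_Poly hp i

theorem div_mem_Poly {n : ℕ} {ℓ : ℤ} {v : Fin n → MvPolynomial (Fin n) ℝ}
    (hv : v ∈ VPoly n (ℓ + 1)) : div v ∈ Poly n ℓ := by
  simp only [div, LinearMap.sum_apply]
  exact Submodule.sum_mem _ fun i _ => pd_mem_Poly (mem_VPoly.1 hv i) i

theorem curl_mem_VPoly {ℓ : ℤ} {v : Fin 3 → MvPolynomial (Fin 3) ℝ} (hv : v ∈ VPoly 3 (ℓ + 1)) :
    curl v ∈ VPoly 3 ℓ := by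
  rw [mem_VPoly] at hv ⊢
  intro i
  fin_cases i <;> simp [curl] <;>
    exact Submodule.sub_mem _ (pd_mem_Poly (hv _) _) (pd_mem_Poly (hv _) _)

theorem vrot_mem_VPoly {ℓ : ℤ} {r : MvPolynomial (Fin 2) ℝ} (hr : r ∈ Poly 2 (ℓ + 1)) :
    vrot r ∈ VPoly 2 ℓ := by
  refine mem_VPoly.2 fun i => ?_
  fin_cases i
  · exact pd_mem_Poly hr 1
  · exact neg_mem (pd_mem_Poly hr 0)

theorem cross_mem_VPoly {a b : ℤ} {u w : Fin 3 → MvPolynomial (Fin 3) ℝ} (hu : u ∈ VPoly 3 a)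
    (hw : w ∈ VPoly 3 b) : u ⨯₃ w ∈ VPoly 3 (a + b) := by
  rw [mem_VPoly] at *
  intro i
  fin_cases i <;> simp [cross_apply] <;>
    exact sub_mem (mul_mem_Poly (hu _) (hw _)) (mul_mem_Poly (hu _) (hw _))

theorem vfn_smul {n m : ℕ} (q : MvPolynomial (Fin n) ℝ) (v : Fin m → MvPolynomial (Fin n) ℝ)
    (x : Fin n → ℝ) : vfn (q • v) x = fn q x • vfn v x := by
  ext i
  simp [vfn, fn]

theorem div_smul {n : ℕ} (q : MvPolynomial (Fin n) ℝ) (v : Fin n → MvPolynomial (Fin n) ℝ) :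
    div (q • v) = grad q ⬝ᵥ v + q * div v := by
  simp only [div, grad, dotProduct, LinearMap.sum_apply, LinearMap.comp_apply, LinearMap.proj_apply,
    Pi.smul_apply, smul_eq_mul, LinearMap.pi_apply, Finset.mul_sum, ← Finset.sum_add_distrib]
  refine Finset.sum_congr rfl fun i _ => ?_
  simp [pd, Derivation.leibniz]
  ring

theorem div_cross (w v : Fin 3 → MvPolynomial (Fin 3) ℝ) :
    div (w ⨯₃ v) = v ⬝ᵥ curl w - curl v ⬝ᵥ w := by
  simp [div, curl, cross_apply, dotProduct, Fin.sum_univ_three, pd, Derivation.leibniz]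
  ring

/-- The chain rule for a derivation and a polynomial in elements of the algebra. -/
theorem derivation_aeval {σ A : Type*} [Fintype σ] [CommRing A] [Algebra ℝ A]
    (D : Derivation ℝ A A) (g : σ → A) (p : MvPolynomial σ ℝ) :
    D (MvPolynomial.aeval g p)
      = ∑ i, MvPolynomial.aeval g (MvPolynomial.pderiv i p) * D (g i) := by
  classical
  induction p using MvPolynomial.induction_on with
  | C a => simp
  | add p q hp hq => simp only [map_add, hp, hq, add_mul, Finset.sum_add_distrib]
  | mul_X p i hp =>
    simp [Derivation.leibniz, hp, MvPolynomial.pderiv_X, Pi.single_apply, apply_ite,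
      Finset.mul_sum, add_mul, Finset.sum_add_distrib, mul_assoc]

namespace Face

variable (f : Face)

/-- The restriction of a polynomial to the plane of the face, in the coordinates of the face. -/
noncomputable def pull : MvPolynomial (Fin 3) ℝ →ₐ[ℝ] MvPolynomial (Fin 2) ℝ :=
  MvPolynomial.aeval fun i => MvPolynomial.C (f.o i) + MvPolynomial.C (f.τ1 i) * MvPolynomial.X 0
    + MvPolynomial.C (f.τ2 i) * MvPolynomial.X 1

theorem fn_pull (q : MvPolynomial (Fin 3) ℝ) (y : Fin 2 → ℝ) :
    fn (f.pull q) y = fn q (f.emb y) := by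
  induction q using MvPolynomial.induction_on with
  | C a => simp [fn, pull]
  | add p q hp hq => simpa [fn] using congrArg₂ (· + ·) hp hq
  | mul_X p i hp =>
    have h : fn (f.pull (MvPolynomial.X i)) y = f.emb y i := by
      simp [fn, pull, emb]
      ring
    simp only [fn, map_mul, MvPolynomial.eval_X] at hp h ⊢
    rw [hp, h]

theorem pull_mem_Poly {ℓ : ℤ} {q : MvPolynomial (Fin 3) ℝ} (hq : q ∈ Poly 3 ℓ) :
    f.pull q ∈ Poly 2 ℓ := by
  refine aeval_mem_Poly (fun i => ?_) hq
  exact add_mem (add_mem (Poly_mono zero_le_one (C_mem_Poly _)) (C_mul_mem_Poly _ (X_mem_Poly _)))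
    (C_mul_mem_Poly _ (X_mem_Poly _))

/-- The tangential part on the face of a polynomial vector field, in the coordinates of the face. -/
noncomputable def pullTang (v : Fin 3 → MvPolynomial (Fin 3) ℝ) : Fin 2 → MvPolynomial (Fin 2) ℝ :=
  ![∑ i, MvPolynomial.C (f.τ1 i) * f.pull (v i), ∑ i, MvPolynomial.C (f.τ2 i) * f.pull (v i)]

/-- The normal component on the face of a polynomial vector field. -/
noncomputable def pullNormal (v : Fin 3 → MvPolynomial (Fin 3) ℝ) : MvPolynomial (Fin 2) ℝ :=
  ∑ i, MvPolynomial.C (f.n i) * f.pull (v i)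

theorem vfn_pullTang (v : Fin 3 → MvPolynomial (Fin 3) ℝ) (y : Fin 2 → ℝ) :
    vfn (f.pullTang v) y = f.tang (vfn v (f.emb y)) := by
  have h : ∀ i, MvPolynomial.eval y (f.pull (v i)) = MvPolynomial.eval (f.emb y) (v i) :=
    fun i => f.fn_pull (v i) y
  ext j
  fin_cases j <;> simp [vfn, pullTang, tang, dotProduct, h]

theorem fn_pullNormal (v : Fin 3 → MvPolynomial (Fin 3) ℝ) (y : Fin 2 → ℝ) :
    fn (f.pullNormal v) y = vfn v (f.emb y) ⬝ᵥ f.n := by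
  have h : ∀ i, MvPolynomial.eval y (f.pull (v i)) = MvPolynomial.eval (f.emb y) (v i) :=
    fun i => f.fn_pull (v i) y
  simp [vfn, fn, pullNormal, dotProduct, h, mul_comm]

theorem pullTang_mem_VPoly {ℓ : ℤ} {v : Fin 3 → MvPolynomial (Fin 3) ℝ} (hv : v ∈ VPoly 3 ℓ) :
    f.pullTang v ∈ VPoly 2 ℓ := by
  have key : ∀ c : Fin 3 → ℝ, ∑ i, MvPolynomial.C (c i) * f.pull (v i) ∈ Poly 2 ℓ := fun c =>
    Submodule.sum_mem _ fun i _ => C_mul_mem_Poly _ (f.pull_mem_Poly (mem_VPoly.1 hv i))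
  refine mem_VPoly.2 fun j => ?_
  fin_cases j
  · exact key f.τ1
  · exact key f.τ2

theorem pullNormal_mem_Poly {ℓ : ℤ} {v : Fin 3 → MvPolynomial (Fin 3) ℝ} (hv : v ∈ VPoly 3 ℓ) :
    f.pullNormal v ∈ Poly 2 ℓ :=
  Submodule.sum_mem _ fun i _ => C_mul_mem_Poly _ (f.pull_mem_Poly (mem_VPoly.1 hv i))

theorem pd_pull (q : MvPolynomial (Fin 3) ℝ) :
    pd 0 (f.pull q) = ∑ i, MvPolynomial.C (f.τ1 i) * f.pull (pd i q) ∧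
    pd 1 (f.pull q) = ∑ i, MvPolynomial.C (f.τ2 i) * f.pull (pd i q) := by
  constructor
  · refine (derivation_aeval (MvPolynomial.pderiv (0 : Fin 2)) _ q).trans
      (Finset.sum_congr rfl fun i _ => ?_)
    rw [mul_comm]
    congr 1
    simp [MvPolynomial.pderiv_X, Derivation.leibniz]
  · refine (derivation_aeval (MvPolynomial.pderiv (1 : Fin 2)) _ q).trans
      (Finset.sum_congr rfl fun i _ => ?_)
    rw [mul_comm]
    congr 1
    simp [MvPolynomial.pderiv_X, Derivation.leibniz]

theorem grad_pull (q : MvPolynomial (Fin 3) ℝ) : grad (f.pull q) = f.pullTang (grad q) := by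
  ext1 j
  fin_cases j
  · exact (f.pd_pull q).1
  · exact (f.pd_pull q).2

/-- The normal component of the curl is the scalar curl of the tangential part. -/
theorem pullNormal_curl (v : Fin 3 → MvPolynomial (Fin 3) ℝ) :
    f.pullNormal (curl v) = pd 0 (f.pullTang v 1) - pd 1 (f.pullTang v 0) := by
  have hC : ∀ (j : Fin 2) (c : ℝ) (p : MvPolynomial (Fin 2) ℝ),
      pd j (MvPolynomial.C c * p) = MvPolynomial.C c * pd j p := by
    intro j c p
    simp [pd, Derivation.leibniz]
  simp only [pullNormal, pullTang, Fin.sum_univ_three, Matrix.cons_val_zero, Matrix.cons_val_one,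
    map_add, hC, (f.pd_pull _).1, (f.pd_pull _).2]
  simp [curl, n, cross_apply]
  ring

end Face

namespace Edge

variable (e : Edge)

/-- The restriction of a polynomial to an edge, as a polynomial in the arc length. -/
noncomputable def tr : MvPolynomial (Fin 3) ℝ →ₐ[ℝ] Polynomial ℝ :=
  MvPolynomial.aeval fun i => Polynomial.C (e.x1 i) + Polynomial.C (e.t i) * Polynomial.X

theorem eval_tr (q : MvPolynomial (Fin 3) ℝ) (s : ℝ) : (e.tr q).eval s = fn q (e.pt s) := by
  induction q using MvPolynomial.induction_on with
  | C a => simp [fn, tr]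
  | add p q hp hq => simpa [fn] using congrArg₂ (· + ·) hp hq
  | mul_X p i hp =>
    have h : (e.tr (MvPolynomial.X i)).eval s = e.pt s i := by
      simp [tr, pt]
      ring
    simp only [fn, map_mul, Polynomial.eval_mul, MvPolynomial.eval_X] at hp h ⊢
    rw [hp, h]

theorem aeval_mem_PolyE {n : ℕ} {ℓ : ℕ} (a b : Fin n → ℝ) {q : MvPolynomial (Fin n) ℝ}
    (hq : q ∈ Poly n ℓ) :
    MvPolynomial.aeval (fun i => Polynomial.C (a i) + Polynomial.C (b i) * Polynomial.X) q
      ∈ PolyE ℓ := by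
  have h1 : q.totalDegree ≤ ℓ := by
    refine Finset.sup_le fun m hm => ?_
    have := mem_Poly.1 hq m hm
    exact_mod_cast this
  have h2 := MvPolynomial.aeval_natDegree_le q h1
    (fun i => Polynomial.C (a i) + Polynomial.C (b i) * Polynomial.X) (n := 1)
    (fun i => by compute_degree)
  rw [mem_PolyE_iff]
  refine lt_of_le_of_lt Polynomial.degree_le_natDegree ?_
  have e1 : ((ℓ : ℤ) + 1).toNat = ℓ + 1 := by omega
  rw [e1]
  exact_mod_cast (by omega)

theorem tr_mem_PolyE {ℓ : ℕ} {q : MvPolynomial (Fin 3) ℝ} (hq : q ∈ Poly 3 ℓ) :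
    e.tr q ∈ PolyE ℓ := aeval_mem_PolyE _ _ hq

theorem derivative_tr (q : MvPolynomial (Fin 3) ℝ) :
    Polynomial.derivative (e.tr q) = ∑ i, Polynomial.C (e.t i) * e.tr (pd i q) := by
  refine (derivation_aeval Polynomial.derivative' _ q).trans (Finset.sum_congr rfl fun i _ => ?_)
  rw [mul_comm]
  congr 1
  simp [Polynomial.derivative']

/-- The tangential component of a polynomial vector field on an edge. -/
noncomputable def trTang (v : Fin 3 → MvPolynomial (Fin 3) ℝ) : Polynomial ℝ :=
  ∑ i, Polynomial.C (e.t i) * e.tr (v i)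

theorem eval_trTang (v : Fin 3 → MvPolynomial (Fin 3) ℝ) (s : ℝ) :
    (e.trTang v).eval s = vfn v (e.pt s) ⬝ᵥ e.t := by
  simp only [trTang, Polynomial.eval_finsetSum, Polynomial.eval_mul, Polynomial.eval_C, eval_tr]
  simp [vfn, fn, dotProduct, mul_comm]

theorem trTang_mem_PolyE {ℓ : ℕ} {v : Fin 3 → MvPolynomial (Fin 3) ℝ} (hv : v ∈ VPoly 3 ℓ) :
    e.trTang v ∈ PolyE ℓ := by
  refine Submodule.sum_mem _ fun i _ => ?_
  rw [← Polynomial.smul_eq_C_mul]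
  exact Submodule.smul_mem _ _ (e.tr_mem_PolyE (mem_VPoly.1 hv i))

/-- A polynomial on the plane of a face, restricted to the line of an edge. -/
noncomputable def trFace (f : Face) : MvPolynomial (Fin 2) ℝ →ₐ[ℝ] Polynomial ℝ :=
  MvPolynomial.aeval fun i =>
    Polynomial.C (f.coord e.x1 i) + Polynomial.C (f.tang e.t i) * Polynomial.X

theorem eval_trFace (f : Face) (q : MvPolynomial (Fin 2) ℝ) (s : ℝ) :
    (e.trFace f q).eval s = fn q (f.coord (e.pt s)) := by
  induction q using MvPolynomial.induction_on with
  | C a => simp [fn, trFace]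
  | add p q hp hq => simpa [fn] using congrArg₂ (· + ·) hp hq
  | mul_X p i hp =>
    have h : (e.trFace f (MvPolynomial.X i)).eval s = f.coord (e.pt s) i := by
      rw [pt, f.coord_add, f.tang_smul]
      simp [trFace]
      ring
    simp only [fn, map_mul, Polynomial.eval_mul, MvPolynomial.eval_X] at hp h ⊢
    rw [hp, h]

theorem trFace_mem_PolyE (f : Face) {ℓ : ℕ} {q : MvPolynomial (Fin 2) ℝ} (hq : q ∈ Poly 2 ℓ) :
    e.trFace f q ∈ PolyE ℓ := aeval_mem_PolyE _ _ hq

end Edge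

/-! ### The gradient -/

namespace Polyhedron

variable (T : Polyhedron) {k : ℕ}

theorem interpPc_eq_tr (S : Finset (Fin T.nE)) {Q : MvPolynomial (Fin 3) ℝ}
    (hQ : Q ∈ Poly 3 (k + 1)) {q : (Fin 3 → ℝ) → ℝ}
    (hq : ∀ e ∈ S, ∀ s, q ((T.edge e).pt s) = fn Q ((T.edge e).pt s)) (e : S) :
    ((T.interpPc k S q).1 e).1 = (T.edge e).tr Q := by
  have hmem : ∀ e, (T.edge e).tr Q ∈ PolyE (k + 1) := fun e => by
    have := (T.edge e).tr_mem_PolyE (ℓ := k + 1) (q := Q) (by push_cast; exact hQ)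
    push_cast at this
    exact this
  have hval : ∀ e : S, ∀ s, q ((T.edge e).pt s) = ((T.edge e).tr Q).eval s := fun e s => by
    rw [hq e e.2, Edge.eval_tr]
  let p : T.Pc S (k + 1) := ⟨fun e => ⟨(T.edge e).tr Q, hmem e⟩, fn Q,
    (MvPolynomial.continuous_eval Q).continuousOn, fun e s _ => ((T.edge e).eval_tr Q s).symm⟩
  have hp : T.interpPc k S q = p := by
    refine epsilon_eq (fun e => ⟨?_, ?_, ?_⟩) fun p' hp' => ?_
    · simp only [hval, p]
    · rw [← (T.edge e).pt_zero, hval]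
    · rw [← (T.edge e).pt_length, hval]
    · refine Subtype.ext (funext fun e => ?_)
      obtain ⟨h1, h2, h3⟩ := hp' e
      refine (T.edge e).eq_of_proj_eq ?_ ?_ ?_
      · rw [h1]
        simp only [hval, p]
      · rw [h2, ← (T.edge e).pt_zero, hval]
      · rw [h3, ← (T.edge e).pt_length, hval]
  rw [hp]

/-- The restriction to a face of the interpolate of a polynomial is the interpolate of the
restriction. -/
theorem onFace_Igrad (f : Fin T.nF) {Q : MvPolynomial (Fin 3) ℝ} (hQ : Q ∈ Poly 3 (k + 1)) :
    (T.Igrad k (fn Q)).onFace f = T.IgradF k f (fn ((T.face f).pull Q)) := by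
  have h1 : (fun y => fn Q ((T.face f).emb y)) = fn ((T.face f).pull Q) :=
    funext fun y => ((T.face f).fn_pull Q y).symm
  refine XGradF.ext ?_ (Subtype.ext (funext fun e => Subtype.ext ?_))
  · simp only [XGrad.onFace, Igrad, IgradF, h1]
  · refine (T.interpPc_eq_tr Finset.univ hQ (fun _ _ _ => rfl) ⟨e, Finset.mem_univ _⟩).trans
      (T.interpPc_eq_tr _ hQ (fun e he s => ?_) e).symm
    rw [Face.fn_pull, emb_coord_pt he]

theorem fullGT_Igrad (γ : ∀ f : Fin T.nF, T.XGradF k f → Poly 2 (k + 1))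
    (hγ : ∀ f : Fin T.nF, T.IsScalarTrace k f (γ f)) {q : MvPolynomial (Fin 3) ℝ}
    (hq : q ∈ Poly 3 (k + 1)) :
    T.fullGT γ (T.Igrad k (fn q)) = ⟨grad q, grad_mem_VPoly hq⟩ := by
  have hrel : ∀ v : VPoly 3 k, T.int (grad q ⬝ᵥ v.1)
      = -(∫ x in T.carrier, fn (T.Igrad k (fn q)).q.1 x * fn (div v.1) x)
        + ∑ f, T.ωF f * ∫ y in (T.face f).poly.carrier,
            fn (γ f ((T.Igrad k (fn q)).onFace f)).1 y *
              (vfn v.1 ((T.face f).emb y) ⬝ᵥ (T.face f).n) := by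
    rintro ⟨v, hv⟩
    have hγ' : ∀ f, γ f ((T.Igrad k (fn q)).onFace f)
        = ⟨(T.face f).pull q, (T.face f).pull_mem_Poly hq⟩ := fun f => by
      rw [T.onFace_Igrad f hq]
      exact (hγ f).1 ⟨_, (T.face f).pull_mem_Poly hq⟩
    have hdiv : div v ∈ Poly 3 (k - 1) := div_mem_Poly (by rwa [sub_add_cancel])
    have hgauss := T.integral_div (q • v)
    simp only [div_smul, vfn_smul, smul_dotProduct, smul_eq_mul] at hgauss
    have hl : ∫ x in T.carrier, fn (grad q ⬝ᵥ v + q * div v) x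
        = T.int (grad q ⬝ᵥ v) + T.int (q * div v) := by
      rw [← map_add]
      rfl
    rw [hl] at hgauss
    simp only [hγ', Face.fn_pull]
    rw [← hgauss, T.int_mul]
    have := T.int_proj_mul (k - 1) q hdiv
    simp only [Igrad]
    rw [this]
    ring
  refine epsilon_eq (fun v => ?_) fun G hG => T.eq_of_int_dot fun v => ?_
  · rw [T.int_dot]
    exact hrel v
  · rw [← T.int_dot, hG v]
    exact (hrel v).symm

theorem fullGF_IgradF (f : Fin T.nF) {q : MvPolynomial (Fin 3) ℝ} (hq : q ∈ Poly 3 (k + 1)) :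
    T.fullGF f (T.IgradF k f (fn ((T.face f).pull q)))
      = ⟨(T.face f).pullTang (grad q), (T.face f).pullTang_mem_VPoly (grad_mem_VPoly hq)⟩ := by
  set X := (T.face f).poly
  set Q := (T.face f).pull q
  set u := T.IgradF k f (fn Q) with hu
  have hrel : ∀ w : VPoly 2 k, X.int ((T.face f).pullTang (grad q) ⬝ᵥ w.1)
      = -(∫ x in X.carrier, fn u.q.1 x * fn (div w.1) x)
        + ∑ e : T.edgesOf f, T.ωE f e * ∫ s in (0 : ℝ)..(T.edge e).length,
            (u.bd.1 e).1.eval s * (vfn w.1 ((T.face f).coord ((T.edge e).pt s)) ⬝ᵥ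
              (T.face f).tang ((T.face f).nE (T.edge e))) := by
    rintro ⟨w, hw⟩
    have hbd : ∀ (e : T.edgesOf f) s,
        (u.bd.1 e).1.eval s = fn Q ((T.face f).coord ((T.edge e).pt s)) := fun e s => by
      have : (u.bd.1 e).1 = (T.edge e).tr q :=
        T.interpPc_eq_tr _ hq (fun e he s => by rw [Face.fn_pull, emb_coord_pt he]) e
      rw [this, Edge.eval_tr, Face.fn_pull, emb_coord_pt e.2]
    have hdiv : div w ∈ Poly 2 (k - 1) := div_mem_Poly (by rwa [sub_add_cancel])
    have hgauss := T.integral_face_div f (Q • w)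
    simp only [div_smul, vfn_smul, smul_dotProduct, smul_eq_mul] at hgauss
    have hl : ∫ x in X.carrier, fn (grad Q ⬝ᵥ w + Q * div w) x
        = X.int (grad Q ⬝ᵥ w) + X.int (Q * div w) := by
      rw [← map_add]
      rfl
    rw [hl] at hgauss
    simp only [hbd]
    rw [← hgauss, X.int_mul]
    have := X.int_proj_mul (k - 1) Q hdiv
    rw [← Face.grad_pull]
    have hu' : u.q = X.proj (k - 1) (fn Q) := rfl
    rw [hu', this]
    ring
  refine epsilon_eq (fun v => ?_) fun G hG => X.eq_of_int_dot fun v => ?_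
  · rw [X.int_dot]
    exact hrel v
  · rw [← X.int_dot, hG v]
    exact (hrel v).symm

theorem GT_Igrad (γ : ∀ f : Fin T.nF, T.XGradF k f → Poly 2 (k + 1))
    (hγ : ∀ f : Fin T.nF, T.IsScalarTrace k f (γ f)) {q : MvPolynomial (Fin 3) ℝ}
    (hq : q ∈ Poly 3 (k + 1)) : T.GT γ (T.Igrad k (fn q)) = T.Icurl k (vfn (grad q)) := by
  have hF : ∀ f, vfn (T.fullGF f ((T.Igrad k (fn q)).onFace f)).1
      = fun y => (T.face f).tang (vfn (grad q) ((T.face f).emb y)) := fun f => by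
    rw [T.onFace_Igrad f hq, T.fullGF_IgradF f hq]
    exact funext fun y => (T.face f).vfn_pullTang _ y
  refine XCurl.ext ?_ ?_ (funext fun f => ?_) (funext fun f => ?_) (funext fun e => ?_)
  · simp only [GT, Icurl, T.fullGT_Igrad γ hγ hq]
  · simp only [GT, Icurl, T.fullGT_Igrad γ hγ hq]
  · simp only [GT, Icurl, hF]
  · simp only [GT, Icurl, hF]
  · have h1 : (T.edge e).trTang (grad q) ∈ PolyE k :=
      (T.edge e).trTang_mem_PolyE (grad_mem_VPoly hq)
    have h2 := (T.edge e).proj_eq_self h1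
    simp only [Edge.eval_trTang] at h2
    simp only [GT, Icurl, h2]
    refine Subtype.ext ?_
    have h3 := T.interpPc_eq_tr Finset.univ hq (fun _ _ _ => rfl) ⟨e, Finset.mem_univ e⟩
    simp only [Igrad]
    rw [h3, Edge.derivative_tr]
    rfl

/-! ### The curl and the divergence -/

variable {T}

/-- Integration by parts on a face: the normal component of the curl against a scalar function. -/
theorem int_pullNormal_curl_mul (f : Fin T.nF) (v : Fin 3 → MvPolynomial (Fin 3) ℝ)
    (r : MvPolynomial (Fin 2) ℝ) :
    (T.face f).poly.int ((T.face f).pullNormal (curl v) * r)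
      = (T.face f).poly.int ((T.face f).pullTang v ⬝ᵥ vrot r)
        - ∑ e : T.edgesOf f, T.ωE f e *
          (T.edge e).int ((T.edge e).trTang v * (T.edge e).trFace (T.face f) r) := by
  set u := (T.face f).pullTang v with hu
  have hgauss := T.integral_face_div f ![r * u 1, -(r * u 0)]
  have hdiv : div ![r * u 1, -(r * u 0)] = (T.face f).pullNormal (curl v) * r - u ⬝ᵥ vrot r := by
    rw [Face.pullNormal_curl, ← hu]
    simp [div, vrot, pd, Fin.sum_univ_two, dotProduct, Derivation.leibniz]
    ring
  have hl : ∫ x in (T.face f).poly.carrier, fn (div ![r * u 1, -(r * u 0)]) x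
      = (T.face f).poly.int ((T.face f).pullNormal (curl v) * r)
        - (T.face f).poly.int (u ⬝ᵥ vrot r) := by
    rw [← map_sub, ← hdiv]
    rfl
  have hedge : ∀ e : T.edgesOf f, (∫ s in (0 : ℝ)..(T.edge e).length,
      vfn ![r * u 1, -(r * u 0)] ((T.face f).coord ((T.edge e).pt s)) ⬝ᵥ
          (T.face f).tang ((T.face f).nE (T.edge e)))
      = -(T.edge e).int ((T.edge e).trTang v * (T.edge e).trFace (T.face f) r) := by
    intro e
    rw [Edge.int_apply, ← intervalIntegral.integral_neg]
    congr 1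
    ext s
    rw [Polynomial.eval_mul, Edge.eval_trTang, Edge.eval_trFace]
    have h1 := (T.face f).dot_eq_tang_add (vfn v ((T.edge e).pt s)) (T.edge e).t
    have h2 := (T.face f).vfn_pullTang v ((T.face f).coord ((T.edge e).pt s))
    rw [emb_coord_pt e.2] at h2
    rw [n_dot_t e.2, mul_zero, add_zero, ← h2, ← hu] at h1
    rw [h1, tang_nE]
    simp [vfn, fn, dotProduct, Fin.sum_univ_two]
    ring
  rw [hl] at hgauss
  simp only [hedge, mul_neg, Finset.sum_neg_distrib] at hgauss
  linarith

theorem onFace_Icurl (f : Fin T.nF) (v : Fin 3 → MvPolynomial (Fin 3) ℝ) :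
    (T.Icurl k (vfn v)).onFace f
      = ⟨(T.face f).poly.vproj (Roly2 (k - 1)) (vfn ((T.face f).pullTang v)),
        (T.face f).poly.vproj ((T.face f).poly.perp (Roly2 k) k) (vfn ((T.face f).pullTang v)),
        fun e => (T.edge e).proj k fun s => ((T.edge e).trTang v).eval s⟩ := by
  have h : (fun y => (T.face f).tang (vfn v ((T.face f).emb y))) = vfn ((T.face f).pullTang v) :=
    funext fun y => ((T.face f).vfn_pullTang v y).symm
  simp only [XCurl.onFace, Icurl, h, Edge.eval_trTang]

theorem CF_Icurl (f : Fin T.nF) (v : Fin 3 → MvPolynomial (Fin 3) ℝ) :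
    T.CF f ((T.Icurl k (vfn v)).onFace f)
      = (T.face f).poly.proj k (fn ((T.face f).pullNormal (curl v))) := by
  rw [onFace_Icurl]
  set X := (T.face f).poly
  have hedge : ∀ (e : T.edgesOf f) (r : Poly 2 k), (∫ s in (0 : ℝ)..(T.edge e).length,
      ((T.edge e).proj k fun s => ((T.edge e).trTang v).eval s).1.eval s
        * fn r.1 ((T.face f).coord ((T.edge e).pt s)))
      = (T.edge e).int ((T.edge e).trTang v * (T.edge e).trFace (T.face f) r.1) := by
    intro e r
    rw [← (T.edge e).int_proj_mul k _ ((T.edge e).trFace_mem_PolyE _ r.2), Edge.int_apply]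
    simp only [Polynomial.eval_mul, Edge.eval_trFace]
  have hR : ∀ r : Poly 2 k, X.int ((X.vproj (Roly2 (k - 1)) (vfn ((T.face f).pullTang v))).1
      ⬝ᵥ vrot r.1) = X.int ((T.face f).pullTang v ⬝ᵥ vrot r.1) := by
    intro r
    refine X.int_vproj_dot _ _ ⟨r.1, ?_, rfl⟩
    rw [sub_add_cancel]
    exact r.2
  refine epsilon_eq (fun r => ?_) fun C hC => X.eq_of_int_mul fun r => ?_
  · simp only [hedge]
    rw [X.int_mul, X.int_dot, X.int_proj_mul k _ r.2, hR, int_pullNormal_curl_mul]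
  · have h := hC r
    simp only [hedge] at h
    rw [X.int_mul, X.int_dot, hR, ← int_pullNormal_curl_mul] at h
    rw [h, X.int_proj_mul k _ r.2]

/-- The tangential trace reconstruction is the projection of the tangential trace, provided that
the field has tangential components of degree `k` on the edges. -/
theorem tangTrace_Icurl (f : Fin T.nF) {v : Fin 3 → MvPolynomial (Fin 3) ℝ}
    (hv : v ∈ VPoly 3 (k + 1)) (hE : ∀ e, (T.edge e).trTang v ∈ PolyE k) :
    T.tangTrace f ((T.Icurl k (vfn v)).onFace f)
      = (T.face f).poly.vproj (VPoly 2 k) (vfn ((T.face f).pullTang v)) := by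
  have hCF := CF_Icurl (k := k) f v
  rw [onFace_Icurl] at hCF ⊢
  set X := (T.face f).poly with hX
  set u := (T.face f).pullTang v with hu
  have hcurl : (T.face f).pullNormal (curl v) ∈ Poly 2 k :=
    (T.face f).pullNormal_mem_Poly (curl_mem_VPoly hv)
  have hCF' : X.proj k (fn ((T.face f).pullNormal (curl v))) = ⟨_, hcurl⟩ :=
    X.eq_of_int_mul fun r => X.int_proj_mul k _ r.2
  rw [hCF'] at hCF
  simp only [(T.edge _).proj_eq_self (hE _)] at hCF ⊢
  have hrhs : ∀ r : MvPolynomial (Fin 2) ℝ, (∫ x in X.carrier,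
      fn ((T.face f).pullNormal (curl v)) x * fn r x)
      + ∑ e : T.edgesOf f, T.ωE f e * ∫ s in (0 : ℝ)..(T.edge e).length,
        ((T.edge e).trTang v).eval s * fn r ((T.face f).coord ((T.edge e).pt s))
      = X.int (u ⬝ᵥ vrot r) := by
    intro r
    have h := int_pullNormal_curl_mul f v r
    simp only [Edge.int_apply, Polynomial.eval_mul, Edge.eval_trFace] at h
    rw [X.int_mul, h]
    ring
  have hproj : ∀ w ∈ VPoly 2 k, X.int ((X.vproj (VPoly 2 k) (vfn u)).1 ⬝ᵥ w) = X.int (u ⬝ᵥ w) :=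
    fun w hw => X.int_vproj_dot _ _ hw
  refine epsilon_eq ⟨fun r _ => ?_, fun w => ?_⟩ ?_
  · rw [hCF, hrhs, X.int_dot, hproj _ (vrot_mem_VPoly r.2)]
  · rw [X.int_dot, X.int_dot, hproj _ w.2.1, X.int_vproj_dot _ _ w.2]
  · rintro γ ⟨h1, h2⟩
    set δ := γ.1 - (X.vproj (VPoly 2 k) (vfn u)).1 with hδ
    -- the mean value may be subtracted from the test functions, as `vrot` vanishes on constants
    have hrot : ∀ r ∈ Poly 2 (k + 1), X.int (δ ⬝ᵥ vrot r) = 0 := by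
      intro r hr
      have hone : X.int 1 ≠ 0 := by
        intro h
        refine one_ne_zero (α := MvPolynomial (Fin 2) ℝ) (X.eq_zero_of_int_self ?_)
        rwa [mul_one]
      set c : ℝ := X.int r / X.int 1
      have hC : (MvPolynomial.C c : MvPolynomial (Fin 2) ℝ) = c • 1 := by
        rw [MvPolynomial.smul_eq_C_mul, mul_one]
      have hmean : X.int (r - MvPolynomial.C c) = 0 := by
        rw [map_sub, hC, map_smul, smul_eq_mul, div_mul_cancel₀ _ hone, sub_self]
      have hvrot : vrot (r - MvPolynomial.C c) = vrot r := by
        rw [map_sub]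
        have : vrot (MvPolynomial.C c) = 0 := by
          ext1 i
          fin_cases i <;> simp [vrot, pd]
        rw [this, sub_zero]
      have h3 := h1 ⟨r - MvPolynomial.C c,
        sub_mem hr (Poly_mono (by positivity) (C_mem_Poly c))⟩ hmean
      rw [hCF, hrhs, X.int_dot] at h3
      simp only [hvrot] at h3
      rw [hδ, sub_dotProduct, map_sub, h3, hproj _ (vrot_mem_VPoly hr), sub_self]
    have hδmem : δ ∈ X.perp (Roly2 k) k := by
      refine ⟨sub_mem γ.2 (X.vproj (VPoly 2 k) (vfn u)).2, ?_⟩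
      rintro _ ⟨r, hr, rfl⟩
      exact hrot r hr
    have h4 := h2 ⟨δ, hδmem⟩
    rw [X.int_dot, X.int_dot, X.int_vproj_dot _ _ hδmem, ← hproj _ hδmem.1] at h4
    refine Subtype.ext (sub_eq_zero.1 (X.eq_zero_of_int_dot_self ?_))
    rw [← hδ]
    conv_lhs => rw [hδ, sub_dotProduct, map_sub]
    exact sub_eq_zero.2 h4

theorem fullCT_Icurl {v : Fin 3 → MvPolynomial (Fin 3) ℝ}
    (hv : v ∈ VPoly 3 (k + 1)) (hE : ∀ e, (T.edge e).trTang v ∈ PolyE k) :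
    T.fullCT (T.Icurl k (vfn v)) = ⟨curl v, curl_mem_VPoly hv⟩ := by
  have hvol : ∀ w : VPoly 3 k, T.int (((T.Icurl k (vfn v)).vR.1 + (T.Icurl k (vfn v)).vRp.1)
      ⬝ᵥ curl w.1) = T.int (v ⬝ᵥ curl w.1) := by
    intro w
    have h1 : T.int ((T.Icurl k (vfn v)).vR.1 ⬝ᵥ curl w.1) = T.int (v ⬝ᵥ curl w.1) := by
      refine T.int_vproj_dot _ _ ⟨w.1, ?_, rfl⟩
      rw [sub_add_cancel]
      exact w.2
    have h2 : T.int ((T.Icurl k (vfn v)).vRp.1 ⬝ᵥ curl w.1) = 0 :=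
      (T.Icurl k (vfn v)).vRp.2.2 _ ⟨w.1, VPoly_mono (by linarith) w.2, rfl⟩
    rw [add_dotProduct, map_add, h1, h2, add_zero]
  have hface : ∀ f (w : VPoly 3 k), (∫ y in (T.face f).poly.carrier,
      vfn (T.tangTrace f ((T.Icurl k (vfn v)).onFace f)).1 y ⬝ᵥ
        (T.face f).tang (vfn w.1 ((T.face f).emb y) ⨯₃ (T.face f).n))
      = -∫ y in (T.face f).poly.carrier, vfn (w.1 ⨯₃ v) ((T.face f).emb y) ⬝ᵥ (T.face f).n := by
    intro f w
    set c : Fin 3 → MvPolynomial (Fin 3) ℝ := fun i => MvPolynomial.C ((T.face f).n i) with hc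
    have hcmem : w.1 ⨯₃ c ∈ VPoly 3 k := by
      have := cross_mem_VPoly w.2 (mem_VPoly.2 fun i => C_mem_Poly ((T.face f).n i))
      rwa [add_zero] at this
    have hval : ∀ x, vfn (w.1 ⨯₃ c) x = vfn w.1 x ⨯₃ (T.face f).n := by
      intro x
      ext i
      fin_cases i <;> simp [vfn, hc, cross_apply]
    have h1 : ∀ y, (T.face f).tang (vfn w.1 ((T.face f).emb y) ⨯₃ (T.face f).n)
        = vfn ((T.face f).pullTang (w.1 ⨯₃ c)) y := fun y => by
      rw [Face.vfn_pullTang, hval]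
    simp only [h1]
    rw [tangTrace_Icurl f hv hE, Polytope.int_dot,
      Polytope.int_vproj_dot _ _ _ ((T.face f).pullTang_mem_VPoly hcmem), ← Polytope.int_dot,
      ← integral_neg]
    congr 1
    ext y
    have h2 := (T.face f).dot_eq_tang_add (vfn v ((T.face f).emb y))
      (vfn (w.1 ⨯₃ c) ((T.face f).emb y))
    have h3 : (T.face f).n ⬝ᵥ vfn (w.1 ⨯₃ c) ((T.face f).emb y) = 0 := by
      rw [hval]
      exact dot_cross_self _ _
    rw [h3, mul_zero, add_zero, ← Face.vfn_pullTang, ← Face.vfn_pullTang, hval] at h2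
    rw [← h2]
    simp [vfn, cross_apply, dotProduct, Fin.sum_univ_three]
    ring
  have hgauss : ∀ w : VPoly 3 k, T.int (v ⬝ᵥ curl w.1) + ∑ f, T.ωF f *
      (-∫ y in (T.face f).poly.carrier, vfn (w.1 ⨯₃ v) ((T.face f).emb y) ⬝ᵥ (T.face f).n)
      = T.int (curl v ⬝ᵥ w.1) := by
    intro w
    have h := T.integral_div (w.1 ⨯₃ v)
    have hl : ∫ x in T.carrier, fn (div (w.1 ⨯₃ v)) x
        = T.int (v ⬝ᵥ curl w.1) - T.int (curl v ⬝ᵥ w.1) := by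
      rw [← map_sub, ← div_cross]
      rfl
    rw [hl] at h
    simp only [mul_neg, Finset.sum_neg_distrib, ← h]
    ring
  refine epsilon_eq (fun w => ?_) fun C hC => T.eq_of_int_dot fun w => ?_
  · simp only [hface]
    rw [T.int_dot, T.int_dot, hvol, hgauss]
  · have h := hC w
    simp only [hface] at h
    rwa [T.int_dot, T.int_dot, hvol, hgauss] at h

theorem CT_Icurl {v : Fin 3 → MvPolynomial (Fin 3) ℝ}
    (hv : v ∈ VPoly 3 (k + 1)) (hE : ∀ e, (T.edge e).trTang v ∈ PolyE k) :
    T.CT (T.Icurl k (vfn v)) = T.Idiv k (vfn (curl v)) := by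
  refine XDiv.ext ?_ ?_ (funext fun f => ?_)
  · simp only [CT, Idiv, fullCT_Icurl hv hE]
  · simp only [CT, Idiv, fullCT_Icurl hv hE]
  · have h : (fun y => vfn (curl v) ((T.face f).emb y) ⬝ᵥ (T.face f).n)
        = fn ((T.face f).pullNormal (curl v)) :=
      funext fun y => ((T.face f).fn_pullNormal _ y).symm
    simp only [CT, Idiv, h, CF_Icurl]

theorem DT_Idiv {v : Fin 3 → MvPolynomial (Fin 3) ℝ} (hv : v ∈ VPoly 3 (k + 1)) :
    T.DT (T.Idiv k (vfn v)) = ⟨div v, div_mem_Poly hv⟩ := by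
  have hvol : ∀ q : Poly 3 k, T.int (((T.Idiv k (vfn v)).vG.1 + (T.Idiv k (vfn v)).vGp.1)
      ⬝ᵥ grad q.1) = T.int (v ⬝ᵥ grad q.1) := by
    intro q
    have h1 : T.int ((T.Idiv k (vfn v)).vG.1 ⬝ᵥ grad q.1) = T.int (v ⬝ᵥ grad q.1) := by
      refine T.int_vproj_dot _ _ ⟨q.1, ?_, rfl⟩
      rw [sub_add_cancel]
      exact q.2
    have h2 : T.int ((T.Idiv k (vfn v)).vGp.1 ⬝ᵥ grad q.1) = 0 :=
      (T.Idiv k (vfn v)).vGp.2.2 _ ⟨q.1, Poly_mono (by linarith) q.2, rfl⟩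
    rw [add_dotProduct, map_add, h1, h2, add_zero]
  have hface : ∀ f (q : Poly 3 k), (∫ y in (T.face f).poly.carrier,
      fn ((T.Idiv k (vfn v)).face f).1 y * fn q.1 ((T.face f).emb y))
      = ∫ y in (T.face f).poly.carrier,
        fn q.1 ((T.face f).emb y) * (vfn v ((T.face f).emb y) ⬝ᵥ (T.face f).n) := by
    intro f q
    have h : (fun y => vfn v ((T.face f).emb y) ⬝ᵥ (T.face f).n) = fn ((T.face f).pullNormal v) :=
      funext fun y => ((T.face f).fn_pullNormal _ y).symm
    simp only [Idiv, h, ← Face.fn_pull]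
    rw [Polytope.int_mul, Polytope.int_proj_mul _ _ _ ((T.face f).pull_mem_Poly q.2),
      ← Polytope.int_mul]
    simp only [Face.fn_pullNormal]
    congr 1
    ext y
    ring
  have hgauss : ∀ q : Poly 3 k, -T.int (v ⬝ᵥ grad q.1) + ∑ f, T.ωF f *
      (∫ y in (T.face f).poly.carrier,
        fn q.1 ((T.face f).emb y) * (vfn v ((T.face f).emb y) ⬝ᵥ (T.face f).n))
      = T.int (div v * q.1) := by
    intro q
    have h := T.integral_div (q.1 • v)
    simp only [div_smul, vfn_smul, smul_dotProduct, smul_eq_mul] at h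
    have hl : ∫ x in T.carrier, fn (grad q.1 ⬝ᵥ v + q.1 * div v) x
        = T.int (v ⬝ᵥ grad q.1) + T.int (div v * q.1) := by
      rw [← map_add, dotProduct_comm, mul_comm]
      rfl
    rw [← h, hl]
    ring
  refine epsilon_eq (fun q => ?_) fun D hD => T.eq_of_int_mul fun q => ?_
  · simp only [hface]
    rw [T.int_mul, T.int_dot, hvol, hgauss]
  · have h := hD q
    simp only [hface] at h
    rwa [T.int_mul, T.int_dot, hvol, hgauss] at h

/-! ### Trimmed spaces -/

variable (T)

theorem position_mem (i : Fin 3) : T.position i ∈ Poly 3 1 :=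
  sub_mem (X_mem_Poly i) (Poly_mono zero_le_one (C_mem_Poly _))

theorem NE_subset {v : Fin 3 → MvPolynomial (Fin 3) ℝ} (hv : v ∈ T.NE k) :
    v ∈ VPoly 3 (k + 1) := by
  obtain ⟨w, hw, z, hz, rfl⟩ := hv
  refine add_mem (VPoly_mono (by linarith) hw) ?_
  rw [add_comm]
  exact cross_mem_VPoly (mem_VPoly.2 T.position_mem) hz

/-- On an edge the tangential component of `(x - x_T) × z` has the degree of `z`, because the part
of `x - x_T` along the edge does not contribute. -/
theorem trTang_mem_of_NE {v : Fin 3 → MvPolynomial (Fin 3) ℝ} (hv : v ∈ T.NE k) (e : Fin T.nE) :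
    (T.edge e).trTang v ∈ PolyE k := by
  obtain ⟨w, hw, z, hz, rfl⟩ := hv
  set a : Fin 3 → MvPolynomial (Fin 3) ℝ :=
    fun i => MvPolynomial.C ((T.edge e).x1 i - T.centroid i) with ha
  have hmem : w + a ⨯₃ z ∈ VPoly 3 k := by
    refine add_mem hw ?_
    have := cross_mem_VPoly (mem_VPoly.2 fun i => C_mem_Poly ((T.edge e).x1 i - T.centroid i)) hz
    rwa [zero_add] at this
  have heq : (T.edge e).trTang (w + T.position ⨯₃ z) = (T.edge e).trTang (w + a ⨯₃ z) := by
    have hpos : ∀ i, (T.edge e).tr (T.position i)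
        = (T.edge e).tr (a i) + Polynomial.C ((T.edge e).t i) * Polynomial.X := by
      intro i
      simp [Edge.tr, position, ha]
      ring
    simp [Edge.trTang, Fin.sum_univ_three, cross_apply, hpos]
    ring
  rw [heq]
  exact (T.edge e).trTang_mem_PolyE hmem

theorem RT_subset {v : Fin 3 → MvPolynomial (Fin 3) ℝ} (hv : v ∈ T.RT k) :
    v ∈ VPoly 3 (k + 1) := by
  obtain ⟨w, hw, p, hp, rfl⟩ := hv
  exact add_mem (VPoly_mono (by linarith) hw)
    (mem_VPoly.2 fun i => mul_mem_Poly hp (T.position_mem i))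

end Polyhedron

end DDR

theorem mainTheorem3 (k : ℕ) (T : DDR.Polyhedron)
    (γ : ∀ f : Fin T.nF, T.XGradF k f → DDR.Poly 2 (k + 1))
    (hγ : ∀ f : Fin T.nF, T.IsScalarTrace k f (γ f)) :
    (∀ q ∈ DDR.Poly 3 (k + 1), DDR.grad q ∈ T.NE k ∧
      T.GT γ (T.Igrad k (DDR.fn q)) = T.Icurl k (DDR.vfn (DDR.grad q))) ∧
    (∀ v ∈ T.NE k, DDR.curl v ∈ T.RT k ∧
      T.CT (T.Icurl k (DDR.vfn v)) = T.Idiv k (DDR.vfn (DDR.curl v))) ∧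
    (∀ v ∈ T.RT k, DDR.div v ∈ DDR.Poly 3 k ∧
      (T.DT (T.Idiv k (DDR.vfn v)) : MvPolynomial (Fin 3) ℝ) = DDR.div v) := by
  refine ⟨fun q hq => ⟨?_, T.GT_Igrad γ hγ hq⟩, fun v hv => ⟨?_, ?_⟩, fun v hv => ⟨?_, ?_⟩⟩
  · exact ⟨_, DDR.grad_mem_VPoly hq, 0, zero_mem _, by simp⟩
  · exact ⟨_, DDR.curl_mem_VPoly (T.NE_subset hv), 0, zero_mem _, by simp⟩
  · exact DDR.Polyhedron.CT_Icurl (T.NE_subset hv) (T.trTang_mem_of_NE hv)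
  · exact DDR.div_mem_Poly (T.RT_subset hv)
  · rw [DDR.Polyhedron.DT_Idiv (T.RT_subset hv)]
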